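/- Let $X$ be a smooth $n$-manifold with corners ($n\ge 0$; Hausdorff, second countable, locally modelled on open subsets of $\mathbb{R}^{p,q}=\mathbb{R}^p\times[0,\infty)^q$ with $p+q=n$). The index of $x\in X$ is the number of the coordinates defining the corner that vanish at $x$ in a chart, and $\mathsf{P}(X)$ denotes the set of connected components of the subspaces $\{x\in X:\mathrm{index}(x)=q\}$, $0\le q\le n$. For $K\in\mathsf{P}(X)$ let $X_{[K]}\subseteq X$ be the subspace $K$, and let $\mathbb{R}^K=\mathbb{R}^{p,q}$, where $q$ is the index of the points of $K$ and $p=n-q$. At a point $x$ of index $q$ let $\mathsf{T}^i_xX\subseteq \mathsf{T}_xX$ be the quadrant of inner tangent vectors (those corresponding to $\mathbb{R}^{p,q}$ in a chart centred at $x$); an inner frame at $x$ is a linear isomorphism $\mathbb{R}^n\to\mathsf{T}_xX$ that maps $\mathbb{R}^{p,q}$ onto $\mathsf{T}^i_xX$. Let $I$ be a finite set and $Z\colon I\to\mathsf{P}(X)$ a function. Let $\mathrm{Emb}\big(\bigsqcup_{j\in I}\mathbb{R}^{Z(j)},X\big)$ be the space of smooth open embeddings $\varphi$ (diffeomorphisms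 onto open subsets of $X$) that map the deepest stratum $\mathbb{R}^{p}\times\{0\}$ of each $\mathbb{R}^{Z(j)}$ into $X_{[Z(j)]}$, with the weak (compact-open) $C^\infty$-topology. For $K\in\mathsf{P}(X)$ and a finite set $T$ let $\mathsf{Fr}^i_{[K]}\big(\mathrm{Conf}_T(X_{[K]})\big)$ be the space of families $(x_j,A_j)_{j\in T}$ of pairwise distinct points $x_j\in X_{[K]}$ with an inner frame $A_j$ of $X$ at each $x_j$, topologized as a subspace of the power $\mathsf{Fr}(X)^T$ of the frame bundle of $X$. Then differentiation at the origins, $\varphi\mapsto\big(\varphi_j(0),\mathsf{d}_0\varphi_j\big)_{j}$ with $\varphi_j=\varphi|_{\mathbb{R}^{Z(j)}}$, is a well-defined weak homotopy equivalence $$\mathrm{Emb}\Big(\bigsqcup_{j\in I}\mathbb{R}^{Z(j)},X\Big)\longrightarrow\prod_{K\in\mathsf{P}(X)}\mathsf{Fr}^i_{[K]}\big(\mathrm{Conf}_{Z^{-1}\{K\}}(X_{[K]})\big).$$ -/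

import Mathlib

open scoped Manifold ContDiff Topology
open Set

noncomputable section

/-! ### Weak homotopy equivalences -/

section WeakEquivalence

variable {A B : Type*} [TopologicalSpace A] [TopologicalSpace B]

/-- The map induced on sets of path components by a continuous map. -/
def zerothHomotopyMap (f : C(A, B)) : ZerothHomotopy A → ZerothHomotopy B :=
  Quotient.map f fun _ _ h => h.map f.continuous

/-- The map induced on `m`-th homotopy groups by a continuous map. -/
def homotopyGroupMap (f : C(A, B)) (m : ℕ) (a : A) :
    HomotopyGroup (Fin m) A a → HomotopyGroup (Fin m) B (f a) :=
  Quotient.map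
    (fun γ : GenLoop (Fin m) A a =>
      (⟨f.comp γ.1, fun y hy => congrArg f (γ.2 y hy)⟩ : GenLoop (Fin m) B (f a)))
    fun _ _ h => h.map fun H => H.compContinuousMap f

/-- A continuous map is a weak homotopy equivalence if it induces a bijection on path components
and, for every base point, bijections on all homotopy groups of positive degree. -/
def IsWeakHomotopyEquiv (f : A → B) : Prop :=
  ∃ hf : Continuous f,
    Function.Bijective (zerothHomotopyMap ⟨f, hf⟩) ∧
    ∀ (m : ℕ) (a : A), Function.Bijective (homotopyGroupMap ⟨f, hf⟩ (m + 1) a)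

end WeakEquivalence

/-! ### The local models -/

/-- The ambient Euclidean space `ℝⁿ`. -/
abbrev Euc (n : ℕ) : Type := EuclideanSpace ℝ (Fin n)

/-- The model with corners `[0, ∞)ⁿ ⊆ ℝⁿ`; every `ℝ^p × [0, ∞)^q` with `p + q = n` embeds in it as
an open subset, so manifolds with corners of dimension `n` are those modelled on it. -/
abbrev cornerModel (n : ℕ) : ModelWithCorners ℝ (Euc n) (EuclideanQuadrant n) :=
  modelWithCornersEuclideanQuadrant n

/-- The quadrant `ℝ^{p,q} = ℝ^p × [0, ∞)^q`, with `p = n - q`, as a subset of `ℝⁿ`: the last `q`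
coordinates are nonnegative. -/
def quadrantSet (n q : ℕ) : Set (Euc n) :=
  {v | ∀ i : Fin n, n ≤ i.val + q → 0 ≤ v i}

theorem convex_quadrantSet (n q : ℕ) : Convex ℝ (quadrantSet n q) := by
  intro x hx y hy a b ha hb _ i hi
  have h1 := hx i hi
  have h2 := hy i hi
  simp only [PiLp.add_apply, PiLp.smul_apply, smul_eq_mul]
  positivity

/-- The quadrant `ℝ^{p,q}` as a topological space. -/
abbrev Quadrant (n q : ℕ) : Type := quadrantSet n q

instance (n q : ℕ) : Zero (Quadrant n q) := ⟨⟨0, fun _ _ => le_of_eq rfl⟩⟩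

theorem Quadrant.coe_zero (n q : ℕ) : ((0 : Quadrant n q) : Euc n) = 0 := rfl

/-- The quadrant `ℝ^{p,q}` as a manifold with corners, with the inclusion in `ℝⁿ` as its
single chart. -/
def quadrantModel (n q : ℕ) : ModelWithCorners ℝ (Euc n) (Quadrant n q) where
  toFun := Subtype.val
  invFun v := ⟨WithLp.toLp 2 fun i => if n ≤ i.val + q then max (v i) 0 else v i,
    fun i hi => by simp [hi]⟩
  source := univ
  target := quadrantSet n q
  map_source' x _ := x.2
  map_target' _ _ := mem_univ _
  left_inv' x _ := by
    ext i
    by_cases h : n ≤ i.val + q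
    · simp [h, x.2 i h]
    · simp [h]
  right_inv' v hv := by
    ext i
    by_cases h : n ≤ i.val + q
    · simp [h, hv i h]
    · simp [h]
  source_eq := rfl
  convex_range' := by
    simp only [instIsRCLikeNormedField, ↓reduceDIte]
    apply Convex.convex_isRCLikeNormedField
    rw [Subtype.range_coe]
    exact convex_quadrantSet n q
  nonempty_interior' := by
    rw [Subtype.range_coe]
    refine ⟨WithLp.toLp 2 fun _ => 1, mem_interior.2 ⟨{v | ∀ i, 0 < v i}, ?_, ?_, ?_⟩⟩
    · exact fun v hv i _ => (hv i).le
    · simp only [ofPred_forall]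
      exact isOpen_iInter_of_finite fun i =>
        isOpen_lt continuous_const (PiLp.continuous_apply 2 _ i)
    · intro i
      simp
  continuous_toFun := continuous_subtype_val
  continuous_invFun := by
    refine Continuous.subtype_mk ((PiLp.continuous_toLp 2 _).comp (continuous_pi fun i => ?_)) _
    by_cases h : n ≤ i.val + q
    · simp only [h, if_true]
      exact (PiLp.continuous_apply 2 _ i).max continuous_const
    · simp only [h, if_false]
      exact PiLp.continuous_apply 2 _ i

/-- The deepest stratum `ℝ^p × {0}` of `ℝ^{p,q}`. -/
def deepestStratum (n q : ℕ) : Set (Quadrant n q) :=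
  {v | ∀ i : Fin n, n ≤ i.val + q → v.1 i = 0}

theorem zero_mem_deepestStratum (n q : ℕ) : (0 : Quadrant n q) ∈ deepestStratum n q :=
  fun _ _ => rfl

/-! ### Strata, inner tangent vectors and inner frames of a manifold with corners -/

section Corners

variable (n : ℕ) {X : Type*} [TopologicalSpace X] [ChartedSpace (EuclideanQuadrant n) X]

/-- The index (depth) of a point: the number of coordinates that vanish at it in a chart. -/
def cornerIndex (x : X) : ℕ :=
  {i : Fin n | extChartAt (cornerModel n) x x i = 0}.ncard

variable (X) in
/-- The set `P(X)`: connected components of the subspaces `X_{≤ k} \ X_{≤ k - 1}` of points of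
index `q = n - k`. -/
structure Stratum where
  /-- the common index `q` of the points of the stratum -/
  index : ℕ
  /-- the stratum as a subset of `X` -/
  carrier : Set X
  isComponent : ∃ x : X, cornerIndex n x = index ∧
    carrier = connectedComponentIn {y : X | cornerIndex n y = index} x

variable {n} in
theorem Stratum.cornerIndex_eq (K : Stratum n X) {x : X} (hx : x ∈ K.carrier) :
    cornerIndex n x = K.index := by
  obtain ⟨y, -, hK⟩ := K.isComponent
  rw [hK] at hx
  exact connectedComponentIn_subset {y : X | cornerIndex n y = K.index} y hx

/-- The coordinates of a tangent vector at `x` in the chart around `x`. -/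
def tangentCoords (x : X) : TangentSpace (cornerModel n) x →L[ℝ] Euc n :=
  mfderiv (cornerModel n) 𝓘(ℝ, Euc n) (extChartAt (cornerModel n) x) x

/-- The quadrant `T^i_x X` of inner tangent vectors at `x`: in a chart, the coordinates that vanish
at `x` have nonnegative derivative along the vector. -/
def innerTangent (x : X) : Set (TangentSpace (cornerModel n) x) :=
  {v | ∀ i : Fin n, extChartAt (cornerModel n) x x i = 0 → 0 ≤ tangentCoords n x v i}

/-- A linear map `A : ℝⁿ → T_x X` is an inner frame if it is an isomorphism that restricts to an
isomorphism of quadrants `ℝ^{p,q} ≅ T^i_x X`, where `q` is the index of `x`. -/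
def IsInnerFrame (x : X) (A : Euc n →L[ℝ] TangentSpace (cornerModel n) x) : Prop :=
  Function.Bijective A ∧ A '' quadrantSet n (cornerIndex n x) = innerTangent n x

variable (X) in
/-- The total space of the vector bundle `Hom(ℝⁿ, TX)` over `X`, in which the frame bundle `Fr(X)`
is the open subspace of isomorphisms. -/
abbrev HomBundle [IsManifold (cornerModel n) ∞ X] : Type _ :=
  Bundle.TotalSpace (Euc n →L[ℝ] Euc n)
    (fun x : X => Bundle.Trivial X (Euc n) x →L[ℝ] TangentSpace (cornerModel n) x)

/-- The inner frame bundle `Fr^i_{[K]}(Conf_T(X_{[K]}))`: configurations `(x_j)_{j ∈ T}` of pairwise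
distinct points of the stratum `K`, with an inner frame of `X` at each `x_j`. It carries the subspace
topology of the power `Fr(X)^T`, and its structure group over `Conf_T(X_{[K]})` is `GL(ℝ^K)^T`. -/
def InnerFrameConf [IsManifold (cornerModel n) ∞ X] (T : Type*) (K : Stratum n X) : Type _ :=
  {F : T → HomBundle n X //
    (∀ j, (F j).proj ∈ K.carrier) ∧ Function.Injective (fun j => (F j).proj) ∧
      ∀ j, IsInnerFrame n (F j).proj (F j).snd}

instance [IsManifold (cornerModel n) ∞ X] (T : Type*) (K : Stratum n X) :
    TopologicalSpace (InnerFrameConf n T K) :=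
  inferInstanceAs (TopologicalSpace (Subtype _))

end Corners

/-! ### Spaces of smooth maps and embeddings -/

section Embeddings

variable (n : ℕ) (X : Type*) [TopologicalSpace X] [ChartedSpace (EuclideanQuadrant n) X]
variable {ι : Type*}

/-- The disjoint union `⊔_j ℝ^{p_j,q_j}`, with `p_j = n - q_j`. -/
abbrev Quadrants (q : ι → ℕ) : Type _ := Σ j, Quadrant n (q j)

/-- The set of smooth maps `⊔_j ℝ^{p_j,q_j} → X`. -/
def SmoothMaps (q : ι → ℕ) : Type _ :=
  {f : Quadrants n q → X //
    ∀ j, ContMDiff (quadrantModel n (q j)) (cornerModel n) ∞ (fun v => f ⟨j, v⟩)}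

variable {X} in
/-- The `k`-th derivative at `v ∈ ℝ^{p_j,q_j}` of `f : ⊔_j ℝ^{p_j,q_j} → X`, read in the chart `e`
of `X`. -/
def chartDeriv {q : ι → ℕ} (e : OpenPartialHomeomorph X (EuclideanQuadrant n)) (k : ℕ)
    (f : Quadrants n q → X) (j : ι) (v : Quadrant n (q j)) : (Euc n) [×k]→L[ℝ] (Euc n) :=
  iteratedFDerivWithin ℝ k
    (fun w => e.extend (cornerModel n) (f ⟨j, (quadrantModel n (q j)).symm w⟩))
    (quadrantSet n (q j)) v

/-- The weak (compact-open) `C^∞`-topology. A subbasis consists of the sets `N^r(f; e, K, ε)` of all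
`g` such that `g(K)` lies in the domain of the chart `e` of `X` and, read in `e`, the derivatives of
`g` up to order `r` are `ε`-close to those of `f` on `K`; here `K` is a compact set in a component
of the source with `f(K)` in the domain of `e`. -/
instance (q : ι → ℕ) : TopologicalSpace (SmoothMaps n X q) :=
  TopologicalSpace.generateFrom
    {N | ∃ (f : SmoothMaps n X q) (e : OpenPartialHomeomorph X (EuclideanQuadrant n)) (j : ι)
        (K : Set (Quadrant n (q j))) (r : ℕ) (ε : ℝ),
      e ∈ IsManifold.maximalAtlas (cornerModel n) ∞ X ∧ IsCompact K ∧ 0 < ε ∧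
      (∀ v ∈ K, f.1 ⟨j, v⟩ ∈ e.source) ∧
      N = {g | ∀ v ∈ K, g.1 ⟨j, v⟩ ∈ e.source ∧
        ∀ k ≤ r, ‖chartDeriv n e k g.1 j v - chartDeriv n e k f.1 j v‖ < ε}}

variable {X} in
/-- The space `Emb(⊔_j ℝ^{Z(j)}, X)` of open embeddings, that is, diffeomorphisms onto open subsets
of `X`, that map the deepest stratum of each `ℝ^{Z(j)}` into the stratum `Z(j)`, with the weak
`C^∞`-topology. -/
def StratEmb (Z : ι → Stratum n X) : Type _ :=
  {φ : SmoothMaps n X (fun j => (Z j).index) //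
    Topology.IsOpenEmbedding φ.1 ∧
    (∀ j, IsLocalDiffeomorph (quadrantModel n (Z j).index) (cornerModel n) ∞
      (fun v => φ.1 ⟨j, v⟩)) ∧
    ∀ j, ∀ v ∈ deepestStratum n (Z j).index, φ.1 ⟨j, v⟩ ∈ (Z j).carrier}

instance (Z : ι → Stratum n X) : TopologicalSpace (StratEmb n Z) :=
  inferInstanceAs (TopologicalSpace (Subtype _))

end Embeddings

/-! ### Differentiation at the origins -/

section Derivative

variable {n : ℕ} {X : Type*} [TopologicalSpace X] [ChartedSpace (EuclideanQuadrant n) X]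

theorem nonneg_of_hasMFDerivAt {H M : Type*} [TopologicalSpace H]
    [TopologicalSpace M] [ChartedSpace H M] (I : ModelWithCorners ℝ (Euc n) H)
    {F : M → Euc n} {x : M} {F' : Euc n →L[ℝ] Euc n} (hF : HasMFDerivAt I 𝓘(ℝ, Euc n) F x F')
    (i : Fin n) (hpos : ∀ y, 0 ≤ F y i) (hx : F x i = 0) (w : Euc n)
    (hw : ∃ t : ℝ, 0 < t ∧ extChartAt I x x + t • w ∈ range I) : 0 ≤ F' w i := by
  obtain ⟨t, ht, hw⟩ := hw
  have h1 : HasFDerivWithinAt (fun u => F ((extChartAt I x).symm u)) F' (range I)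
      (extChartAt I x x) := hF.2
  have h2 : HasFDerivWithinAt (fun u => F ((extChartAt I x).symm u) i)
      ((EuclideanSpace.proj (𝕜 := ℝ) i).comp F') (range I) (extChartAt I x x) :=
    (EuclideanSpace.proj (𝕜 := ℝ) i).hasFDerivAt.comp_hasFDerivWithinAt _ h1
  have h3 : IsLocalMinOn (fun u => F ((extChartAt I x).symm u) i) (range I)
      (extChartAt I x x) := by
    refine Filter.Eventually.of_forall fun u => ?_
    simp only [extChartAt_to_inv, hx]
    exact hpos _
  have h4 := h3.hasFDerivWithinAt_nonneg h2
    (mem_posTangentConeAt_of_segment_subset (y := t • w)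
      (I.convex_range.segment_subset (mem_range_self _) hw))
  have h5 : 0 ≤ t * F' w i := by simpa using h4
  exact nonneg_of_mul_nonneg_right h5 ht

theorem hasMFDerivAt_extChartAt_self {H M : Type*} [TopologicalSpace H]
    [TopologicalSpace M] [ChartedSpace H M] (I : ModelWithCorners ℝ (Euc n) H)
    (x : M) :
    HasMFDerivAt I 𝓘(ℝ, Euc n) (extChartAt I x) x (ContinuousLinearMap.id ℝ (Euc n)) := by
  refine ⟨continuousAt_extChartAt x, ?_⟩
  refine (hasFDerivWithinAt_id _ _).congr_of_eventuallyEq ?_ ?_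
  · filter_upwards [extChartAt_target_mem_nhdsWithin (I := I) x] with u hu
    exact (extChartAt I x).right_inv hu
  · exact (extChartAt I x).right_inv (mem_extChartAt_target x)

theorem range_quadrantModel (n q : ℕ) : range (quadrantModel n q) = quadrantSet n q :=
  Subtype.range_coe

/-- The differential at the origin of a local diffeomorphism `ℝ^{p,q} → X` that sends the origin to
a point of index `q` is an inner frame. -/
theorem isInnerFrame_mfderiv {q : ℕ} {φ : Quadrant n q → X}
    (hφ : IsLocalDiffeomorph (quadrantModel n q) (cornerModel n) ∞ φ)
    (hq : cornerIndex n (φ 0) = q) :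
    IsInnerFrame n (φ 0) (mfderiv (quadrantModel n q) (cornerModel n) φ 0) := by
  set A : Euc n →L[ℝ] Euc n := mfderiv (quadrantModel n q) (cornerModel n) φ 0 with hA
  have htc : tangentCoords n (φ 0) = ContinuousLinearMap.id ℝ (Euc n) :=
    (hasMFDerivAt_extChartAt_self (cornerModel n) (φ 0)).mfderiv
  have hne : (∞ : WithTop ℕ∞) ≠ 0 := by simp
  have hloc := hφ 0
  have hbij : Function.Bijective A := (hloc.mfderivToContinuousLinearEquiv hne).bijective
  have hinner : ∀ w : Euc n, w ∈ innerTangent n (φ 0) ↔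
      ∀ i : Fin n, extChartAt (cornerModel n) (φ 0) (φ 0) i = 0 → 0 ≤ w i := by
    intro w
    simp only [innerTangent, htc]
    rfl
  have hdφ : HasMFDerivAt (quadrantModel n q) (cornerModel n) φ 0 A :=
    (hloc.mdifferentiableAt hne).hasMFDerivAt
  have hzero : extChartAt (quadrantModel n q) (0 : Quadrant n q) 0 = 0 := rfl
  refine ⟨hbij, ?_⟩
  rw [hq]
  apply Subset.antisymm
  · rintro _ ⟨v, hv, rfl⟩
    refine (hinner (A v)).2 fun i hi => ?_
    have hc : HasMFDerivAt (quadrantModel n q) 𝓘(ℝ, Euc n)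
        (extChartAt (cornerModel n) (φ 0) ∘ φ) 0 A :=
      (hasMFDerivAt_extChartAt_self (cornerModel n) (φ 0)).comp 0 hdφ
    refine nonneg_of_hasMFDerivAt (quadrantModel n q) hc i (fun y => ?_) hi v
      ⟨1, one_pos, ?_⟩
    · exact (chartAt (EuclideanQuadrant n) (φ 0) (φ y)).2 i
    · rw [range_quadrantModel, hzero]
      simpa using hv
  · intro w hw
    obtain ⟨v, rfl⟩ := hbij.2 w
    refine ⟨v, fun i hi => ?_, rfl⟩
    have hw' := (hinner (A v)).1 hw
    have hψ : HasMFDerivAt (cornerModel n) (quadrantModel n q) hloc.localInverse (φ 0)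
        (mfderiv (cornerModel n) (quadrantModel n q) hloc.localInverse (φ 0)) :=
      (hloc.localInverse_mdifferentiableAt hne).hasMFDerivAt
    have hψ0 : hloc.localInverse (φ 0) = 0 :=
      hloc.localInverse_left_inv hloc.localInverse_mem_target
    set B : Euc n →L[ℝ] Euc n :=
      mfderiv (cornerModel n) (quadrantModel n q) hloc.localInverse (φ 0)
    have hBA : B (A v) = v := (hloc.mfderivToContinuousLinearEquiv hne).left_inv v
    have hc : HasMFDerivAt (cornerModel n) 𝓘(ℝ, Euc n)
        (extChartAt (quadrantModel n q) (hloc.localInverse (φ 0)) ∘ hloc.localInverse) (φ 0) B :=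
      (hasMFDerivAt_extChartAt_self (quadrantModel n q) (hloc.localInverse (φ 0))).comp (φ 0) hψ
    have := nonneg_of_hasMFDerivAt (cornerModel n) hc i (fun y => ?_) ?_ (A v) ?_
    · rwa [hBA] at this
    · exact (hloc.localInverse y).2 i hi
    · change (hloc.localInverse (φ 0)).1 i = 0
      rw [hψ0]
      rfl
    · set c : Euc n := extChartAt (cornerModel n) (φ 0) (φ 0)
      have hcpos : ∀ k, 0 ≤ c k := fun k => (chartAt (EuclideanQuadrant n) (φ 0) (φ 0)).2 k
      have hev : ∀ k : Fin n, ∀ᶠ t in 𝓝[>] (0 : ℝ), 0 ≤ (c + t • A v) k := by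
        intro k
        rcases (hcpos k).eq_or_lt with h0 | h0
        · filter_upwards [self_mem_nhdsWithin] with t ht
          have h1 := hw' k h0.symm
          have h2 : (0 : ℝ) ≤ t := le_of_lt ht
          simp only [PiLp.add_apply, PiLp.smul_apply, smul_eq_mul, ← h0, zero_add]
          exact mul_nonneg h2 h1
        · have hcont : Continuous fun t : ℝ => (c + t • A v) k := by
            simp only [PiLp.add_apply, PiLp.smul_apply, smul_eq_mul]
            fun_prop
          have h1 : ∀ᶠ t in 𝓝 (0 : ℝ), 0 < (c + t • A v) k :=
            hcont.continuousAt.eventually (lt_mem_nhds (by simpa using h0))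
          exact (h1.filter_mono nhdsWithin_le_nhds).mono fun t ht => ht.le
      obtain ⟨t, ht, ht0⟩ := ((Filter.eventually_all.2 hev).and self_mem_nhdsWithin).exists
      exact ⟨t, ht0, ⟨⟨c + t • A v, ht⟩, rfl⟩⟩

variable [IsManifold (cornerModel n) ∞ X] {ι : Type*}

/-- Differentiation at the origins, `φ ↦ (φ_j(0), d_0 φ_j)_j`, where `φ_j` is the restriction of `φ`
to `ℝ^{Z(j)}` and the indices `j` are grouped according to the stratum `Z(j)`. -/
def derivAtOrigins (Z : ι → Stratum n X) (φ : StratEmb n Z) :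
    (K : Stratum n X) → InnerFrameConf n {j // Z j = K} K := fun _ =>
  ⟨fun j => ⟨φ.1.1 ⟨j.1, 0⟩,
      mfderiv (quadrantModel n (Z j.1).index) (cornerModel n) (fun v => φ.1.1 ⟨j.1, v⟩) 0⟩,
    fun j => Eq.subst (motive := fun L : Stratum n X => φ.1.1 ⟨j.1, 0⟩ ∈ L.carrier) j.2
      (φ.2.2.2 j.1 0 (zero_mem_deepestStratum n _)),
    fun _ _ h => Subtype.ext (congrArg Sigma.fst (φ.2.1.injective h)),
    fun j => isInnerFrame_mfderiv (φ.2.2.1 j.1)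
      ((Z j.1).cornerIndex_eq (φ.2.2.2 j.1 0 (zero_mem_deepestStratum n _)))⟩

end Derivative

end

/-! An embedding is determined up to shrinking by its germ at the origins, and germs with a
prescribed 1-jet can be deformed into one another along straight lines. This is made precise as a
relative lifting property, `HasRelativeLifts`: over a compact Hausdorff parameter space, a lift
given on an open set can be replaced by a global lift that agrees with it on a prescribed closed
subset. Tested on a point, an interval, cubes and cylinders over cubes, this property gives
bijections on path components and on homotopy groups (`HasRelativeLifts.isWeakHomotopyEquiv`); the
cubes are first reparametrized so that the boundary data extend to a neighbourhood of the boundary.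

Lifting germs is a local matter. In a chart, an inner frame with base coordinates `a` and matrix `M`
gives affine coordinates `u ↦ a + M u`. Along a stratum the index is constant, so the set of
vanishing chart coordinates cannot jump, and these affine coordinates identify a piece of the
quadrant, of uniform size, with an open piece of `X` (`IsFrameFamily.exists_isStraight`). In them, a
germ of a lift becomes a family of self-maps of the quadrant near `0` that fix `0`, have derivative
the identity there and preserve facets. Preservation of facets comes from openness
(`IsNearId.apply_eq_zero`); conversely, maps of this kind are local diffeomorphisms of the quadrant
(`IsNearId.exists_inverse`). These conditions survive straight-line deformation to the identity, so
a cutoff function extends germ lifts across one chart at a time, and finitely many charts suffice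
(`exists_isGermLiftAt`).

To pass from germs to embeddings, compactness gives one radius `r` on which all germs are embeddings
with disjoint images. Precomposition with a shrinking of the quadrants into balls of radius `r`,
switched off near the part of the parameter space where the lift is already prescribed, produces the
global lift (`hasRelativeLifts_derivAtOrigins`).

The weak topology enters through one equivalence: a family is continuous exactly when all its
derivatives in charts are jointly continuous in the parameter and the point
(`smoothMapFamilyAt_of_continuousAt`, `continuousAt_of_smoothMapFamilyAt`). -/

noncomputable section

/-! ### Weak homotopy equivalences from relative lifting -/

section Lifting

open unitInterval

/-- The self-map of the unit interval that collapses `[0, 1/3]` to `0` and `[2/3, 1]` to `1`. -/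
def collar : C(I, I) where
  toFun t := Set.projIcc 0 1 zero_le_one (3 * (t : ℝ) - 1)
  continuous_toFun := by fun_prop

theorem collar_of_lt {t : I} (h : (t : ℝ) < 1 / 3) : collar t = 0 :=
  Set.projIcc_of_le_left zero_le_one (by linarith)

theorem collar_of_gt {t : I} (h : 2 / 3 < (t : ℝ)) : collar t = 1 :=
  Set.projIcc_of_right_le zero_le_one (by linarith)

/-- The collar map on a cube. -/
def cubeCollar (N : Type*) : C(N → I, N → I) where
  toFun y i := collar (y i)
  continuous_toFun := by fun_prop

/-- The straight-line homotopy from the identity of the cube to the collar map. -/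
def cubeCollarHomotopy (N : Type*) : C(I × (N → I), N → I) where
  toFun p i := ⟨(1 - (p.1 : ℝ)) * p.2 i + p.1 * collar (p.2 i),
    (convex_Icc (0 : ℝ) 1) (p.2 i).2 (collar (p.2 i)).2 (by linarith [p.1.2.2]) p.1.2.1 (by ring)⟩
  continuous_toFun := by
    refine continuous_pi fun i => Continuous.subtype_mk ?_ _
    fun_prop

theorem cubeCollarHomotopy_boundary {N : Type*} (s : I) {y : N → I} (hy : y ∈ Cube.boundary N) :
    cubeCollarHomotopy N (s, y) ∈ Cube.boundary N := by
  obtain ⟨i, hi | hi⟩ := hy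
  · refine ⟨i, Or.inl (Subtype.ext ?_)⟩
    have : collar 0 = 0 := collar_of_lt (by norm_num)
    simp [cubeCollarHomotopy, hi, this]
  · refine ⟨i, Or.inr (Subtype.ext ?_)⟩
    have : collar 1 = 1 := collar_of_gt (by norm_num)
    simp [cubeCollarHomotopy, hi, this]

theorem cubeCollar_boundary {N : Type*} {y : N → I} (hy : y ∈ Cube.boundary N) :
    cubeCollar N y ∈ Cube.boundary N := by
  have h := cubeCollarHomotopy_boundary 1 hy
  have e : cubeCollarHomotopy N (1, y) = cubeCollar N y := by
    ext i; simp [cubeCollarHomotopy, cubeCollar]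
  rwa [e] at h

variable {A B : Type*} [TopologicalSpace A] [TopologicalSpace B]

/-- The straight-line homotopy keeps each boundary point inside the boundary, where `γ` is constant.
Hence loops may be replaced by loops that are constant near the boundary. -/
theorem homotopicRel_comp_cubeCollar {N : Type*} (γ : C(N → I, A)) {a : A}
    (hγ : ∀ y ∈ Cube.boundary N, γ y = a) :
    γ.HomotopicRel (γ.comp (cubeCollar N)) (Cube.boundary N) := by
  refine ⟨⟨⟨γ.comp (cubeCollarHomotopy N), fun y => ?_, fun y => ?_⟩, fun s y hy => ?_⟩⟩
  · change γ _ = γ _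
    congr 1; ext i; simp [cubeCollarHomotopy]
  · change γ _ = γ _
    congr 1; ext i; simp [cubeCollarHomotopy, cubeCollar]
  · change γ _ = γ _
    rw [hγ _ hy, hγ _ (cubeCollarHomotopy_boundary s hy)]

/-- A cube coordinate is close to the boundary. -/
theorem isOpen_nearBoundary {D : Type*} [TopologicalSpace D] {h : D → I} (hh : Continuous h) :
    IsOpen {d | (h d : ℝ) < 1 / 3 ∨ 2 / 3 < (h d : ℝ)} := by
  have hc : Continuous fun d => (h d : ℝ) := by fun_prop
  exact (isOpen_lt hc continuous_const).union (isOpen_lt continuous_const hc)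

theorem isClosed_cubeBoundary (N : Type*) [Finite N] : IsClosed (Cube.boundary N) := by
  have : Cube.boundary N = ⋃ i, {y : N → I | y i = 0 ∨ y i = 1} := by
    ext y; simp [Cube.boundary]
  rw [this]
  exact isClosed_iUnion_of_finite fun i =>
    (isClosed_eq (by fun_prop) continuous_const).union (isClosed_eq (by fun_prop) continuous_const)

/-- The relative lifting property against compact Hausdorff spaces: a partial lift on an open set
can be extended to a global lift after shrinking to a closed subset. -/
def HasRelativeLifts (f : A → B) : Prop :=
  ∀ (D : Type) [TopologicalSpace D] [CompactSpace D] [T2Space D] (v : C(D, B)) (C W : Set D)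
    (_ : IsClosed C) (_ : IsOpen W) (hCW : C ⊆ W) (g : C(W, A)), (∀ d, f (g d) = v d) →
    ∃ u : C(D, A), (∀ d, f (u d) = v d) ∧ ∀ d (h : d ∈ C), u d = g ⟨d, hCW h⟩

theorem HasRelativeLifts.surjective {f : A → B} (H : HasRelativeLifts f) (b : B) :
    ∃ a, f a = b := by
  obtain ⟨u, hu, -⟩ := H Unit (.const _ b) ∅ ∅ isClosed_empty isOpen_empty subset_rfl
    ⟨fun d => d.2.elim, by
      rw [continuous_iff_continuousAt]; exact fun d => d.2.elim⟩ (fun d => d.2.elim)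
  exact ⟨u (), hu ()⟩

/-- After collaring, the path downstairs is constant near both ends, so the two given points form a
partial lift there, and a global lift is a path between them. -/
theorem HasRelativeLifts.joined {f : A → B} (H : HasRelativeLifts f)
    {a₀ a₁ : A} (h : Joined (f a₀) (f a₁)) : Joined a₀ a₁ := by
  obtain ⟨p⟩ := h
  let W : Set I := {t | (t : ℝ) < 1 / 3 ∨ 2 / 3 < (t : ℝ)}
  -- The jump at `1/2` lies in the gap of `W`, so the function is locally constant.
  have hg : Continuous (fun t : W => if (t : ℝ) < 1 / 2 then a₀ else a₁) := by
    refine IsLocallyConstant.continuous ((IsLocallyConstant.iff_eventually_eq _).2 fun t => ?_)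
    have hc : Continuous fun s : W => (s : ℝ) := by fun_prop
    rcases t.2 with h | h
    · filter_upwards [(isOpen_lt hc continuous_const).mem_nhds
        (show (t : ℝ) < 1 / 2 by linarith)] with s hs
      rw [if_pos hs, if_pos (show (t : ℝ) < 1 / 2 by linarith)]
    · filter_upwards [(isOpen_lt continuous_const hc).mem_nhds
        (show 1 / 2 < (t : ℝ) by linarith)] with s hs
      rw [if_neg (not_lt.2 (le_of_lt hs)), if_neg (show ¬ (t : ℝ) < 1 / 2 by linarith)]
  obtain ⟨u, -, hu⟩ := H I (p.toContinuousMap.comp collar) {0, 1} W (by simp)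
    (isOpen_nearBoundary continuous_id) (by rintro t (rfl | rfl) <;> simp [W] <;> norm_num)
    ⟨_, hg⟩ (by
      rintro ⟨t, h | h⟩
      · simp [collar_of_lt h, show (t : ℝ) < 2⁻¹ by linarith]
      · simp [collar_of_gt h, show ¬ (t : ℝ) < 2⁻¹ by linarith])
  refine ⟨⟨u, ?_, ?_⟩⟩
  · refine (hu 0 (by simp)).trans ?_
    simp
  · refine (hu 1 (by simp)).trans ?_
    norm_num

/-- The collared loop equals `f a` near the boundary of the cube, so the constant `a` is a partial
lift there. -/
theorem HasRelativeLifts.exists_genLoop {f : A → B} (hf : Continuous f) (H : HasRelativeLifts f)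
    {N : Type} [Finite N] (a : A) (γ : GenLoop N B (f a)) :
    ∃ δ : GenLoop N A a, ContinuousMap.HomotopicRel (ContinuousMap.comp ⟨f, hf⟩ δ.1) γ.1
      (Cube.boundary N) := by
  let W : Set (N → I) := ⋃ i, {y | (y i : ℝ) < 1 / 3 ∨ 2 / 3 < (y i : ℝ)}
  have hW : ∀ y ∈ W, cubeCollar N y ∈ Cube.boundary N := by
    intro y hy
    obtain ⟨i, hi⟩ := mem_iUnion.1 hy
    exact ⟨i, hi.imp collar_of_lt collar_of_gt⟩
  obtain ⟨u, hu, hu'⟩ := H (N → I) (γ.1.comp (cubeCollar N)) (Cube.boundary N) W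
    (isClosed_cubeBoundary N) (isOpen_iUnion fun i => isOpen_nearBoundary (by fun_prop))
    (by
      rintro y ⟨i, hi⟩
      refine mem_iUnion.2 ⟨i, ?_⟩
      rcases hi with hi | hi <;> simp [hi] <;> norm_num)
    (.const _ a) (fun d => (γ.2 _ (hW _ d.2)).symm)
  refine ⟨⟨u, fun y hy => hu' y hy⟩, ?_⟩
  have : ContinuousMap.comp ⟨f, hf⟩ u = γ.1.comp (cubeCollar N) := by
    ext y; exact hu y
  change ContinuousMap.HomotopicRel (ContinuousMap.comp ⟨f, hf⟩ u) _ _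
  rw [this]
  exact (homotopicRel_comp_cubeCollar γ.1 γ.2).symm

/-- The homotopy downstairs is collared in time and in space. Then `γ₀` and `γ₁` lift it near the
two ends and the constant `a` lifts it near the sides, and these partial lifts fit together. -/
theorem HasRelativeLifts.homotopic {f : A → B} (hf : Continuous f) (H : HasRelativeLifts f)
    {N : Type} [Finite N] (a : A) (γ₀ γ₁ : GenLoop N A a)
    (h : ContinuousMap.HomotopicRel (ContinuousMap.comp ⟨f, hf⟩ γ₀.1)
      (ContinuousMap.comp ⟨f, hf⟩ γ₁.1) (Cube.boundary N)) : GenLoop.Homotopic γ₀ γ₁ := by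
  obtain ⟨F⟩ := h
  let V : Set (I × (N → I)) := ⋃ i, {p | (p.2 i : ℝ) < 1 / 3 ∨ 2 / 3 < (p.2 i : ℝ)}
  let W : Set (I × (N → I)) := {p | (p.1 : ℝ) < 1 / 3 ∨ 2 / 3 < (p.1 : ℝ)} ∪ V
  have hVo : IsOpen V := isOpen_iUnion fun i => isOpen_nearBoundary (by fun_prop)
  have hV : ∀ p ∈ V, cubeCollar N p.2 ∈ Cube.boundary N := by
    intro y hy
    obtain ⟨i, hi⟩ := mem_iUnion.1 hy
    exact ⟨i, hi.imp collar_of_lt collar_of_gt⟩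
  -- The jump at time `1/2` does no harm: inside `W` it is only met in `V`, where both branches
  -- equal `a`.
  let g : I × (N → I) → A := fun p =>
    if (p.1 : ℝ) < 1 / 2 then γ₀ (cubeCollar N p.2) else γ₁ (cubeCollar N p.2)
  have hgV : ∀ p ∈ V, g p = a := by
    intro p hp
    simp only [g]
    split_ifs
    · exact γ₀.2 _ (hV p hp)
    · exact γ₁.2 _ (hV p hp)
  have hg : Continuous (fun p : W => g p) := by
    rw [continuous_iff_continuousAt]
    rintro ⟨p, hp⟩
    refine ContinuousAt.comp (f := Subtype.val) (g := g) ?_ continuousAt_subtype_val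
    have hc : Continuous fun s : I × (N → I) => (s.1 : ℝ) := by fun_prop
    rcases hp with (h | h) | h
    · refine ContinuousAt.congr (f := fun p => γ₀.1 (cubeCollar N p.2)) (by fun_prop) ?_
      filter_upwards [(isOpen_lt hc continuous_const).mem_nhds
        (show (p.1 : ℝ) < 1 / 2 by linarith)] with s hs
      simp only [g, if_pos hs]; rfl
    · refine ContinuousAt.congr (f := fun p => γ₁.1 (cubeCollar N p.2)) (by fun_prop) ?_
      filter_upwards [(isOpen_lt continuous_const hc).mem_nhds
        (show 1 / 2 < (p.1 : ℝ) by linarith)] with s hs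
      simp only [g, if_neg (not_lt.2 (le_of_lt hs))]; rfl
    · refine ContinuousAt.congr (f := fun p => a) (by fun_prop) ?_
      filter_upwards [hVo.mem_nhds h] with s hs using (hgV s hs).symm
  have hFb : ∀ t, ∀ y ∈ Cube.boundary N, F (t, y) = f a := by
    intro t y hy
    rw [F.eq_fst t hy]
    exact congrArg f (γ₀.2 y hy)
  obtain ⟨u, -, hu⟩ := H (I × (N → I))
    (F.toContinuousMap.comp ((collar.comp .fst).prodMk ((cubeCollar N).comp .snd)))
    ({p | p.1 = 0 ∨ p.1 = 1} ∪ {p | p.2 ∈ Cube.boundary N}) W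
    (((isClosed_eq (by fun_prop) continuous_const).union
      (isClosed_eq (by fun_prop) continuous_const)).union
      ((isClosed_cubeBoundary N).preimage continuous_snd))
    ((isOpen_nearBoundary (by fun_prop)).union hVo)
    (by
      rintro ⟨t, y⟩ (hp | ⟨i, hi⟩)
      · left
        rcases hp with hp | hp <;> simp only at hp <;> simp [hp] <;> norm_num
      · right
        refine mem_iUnion.2 ⟨i, ?_⟩
        rcases hi with hi | hi <;> simp only at hi <;> simp [hi] <;> norm_num)
    ⟨_, hg⟩ (by
      rintro ⟨⟨t, y⟩, hp⟩
      change f (g (t, y)) = F (collar t, cubeCollar N y)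
      rcases hp with (h | h) | h
      · simp only at h
        rw [collar_of_lt h]
        simp only [g, if_pos (show (t : ℝ) < 1 / 2 by linarith)]
        exact (F.apply_zero _).symm
      · simp only at h
        rw [collar_of_gt h]
        simp only [g, if_neg (show ¬ (t : ℝ) < 1 / 2 by linarith)]
        exact (F.apply_one _).symm
      · rw [hgV _ h, hFb _ _ (hV _ h)])
  have key : ContinuousMap.HomotopicRel (γ₀.1.comp (cubeCollar N)) (γ₁.1.comp (cubeCollar N))
      (Cube.boundary N) := by
    refine ⟨⟨⟨u, fun y => ?_, fun y => ?_⟩, fun t y hy => ?_⟩⟩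
    · change u (0, y) = _
      rw [hu _ (by simp)]
      simp [g]
    · change u (1, y) = _
      rw [hu _ (by simp)]
      norm_num [g]
    · change u (t, y) = γ₀.1 (cubeCollar N y)
      rw [hu _ (Or.inr hy), γ₀.2 _ (cubeCollar_boundary hy)]
      obtain ⟨i, hi⟩ := hy
      refine hgV (t, y) (mem_iUnion.2 ⟨i, ?_⟩)
      rcases hi with hi | hi <;> simp [hi] <;> norm_num
  exact ((homotopicRel_comp_cubeCollar γ₀.1 γ₀.2).trans key).trans
    (homotopicRel_comp_cubeCollar γ₁.1 γ₁.2).symm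

theorem HasRelativeLifts.isWeakHomotopyEquiv {f : A → B} (hf : Continuous f)
    (H : HasRelativeLifts f) : IsWeakHomotopyEquiv f := by
  refine ⟨hf, ⟨?_, ?_⟩, fun m a => ⟨?_, ?_⟩⟩
  · rintro ⟨a₀⟩ ⟨a₁⟩ h
    exact Quotient.sound (H.joined (Quotient.exact h))
  · rintro ⟨b⟩
    obtain ⟨a, rfl⟩ := H.surjective b
    exact ⟨Quotient.mk _ a, rfl⟩
  · rintro ⟨γ₀⟩ ⟨γ₁⟩ h
    exact Quotient.sound (H.homotopic hf a γ₀ γ₁ (Quotient.exact h))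
  · rintro ⟨γ⟩
    obtain ⟨δ, hδ⟩ := H.exists_genLoop hf a γ
    exact ⟨Quotient.mk _ δ, Quotient.sound hδ⟩

end Lifting

end

noncomputable section

/-! ### Families of smooth maps with jointly continuous derivatives -/

section Families

open Filter

variable {D : Type*} [TopologicalSpace D]
  {E F G : Type*} [NormedAddCommGroup E] [NormedSpace ℝ E] [NormedAddCommGroup F] [NormedSpace ℝ F]
  [NormedAddCommGroup G] [NormedSpace ℝ G]

/-- The family `f d`, `d ∈ D`, consists of smooth maps on `S` near `p`, and all derivatives are
continuous at `p` jointly in the parameter and the variable. -/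
structure SmoothFamilyAt (f : D → E → F) (S : Set E) (p : D × E) : Prop where
  smooth : ∀ᶠ p' in 𝓝[univ ×ˢ S] p, ContDiffWithinAt ℝ ∞ (f p'.1) S p'.2
  cont : ∀ k, ContinuousWithinAt (fun p' => iteratedFDerivWithin ℝ k (f p'.1) S p'.2)
    (univ ×ˢ S) p

omit [NormedSpace ℝ E] in
theorem tendsto_slice_nhdsWithin {S : Set E} (d : D) (w : E) :
    Tendsto (fun y => (d, y)) (𝓝[S] w) (𝓝[univ ×ˢ S] (d, w)) :=
  tendsto_nhdsWithin_iff.2 ⟨(Continuous.tendsto (by fun_prop) w).mono_left nhdsWithin_le_nhds,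
    eventually_mem_nhdsWithin.mono fun _ h => ⟨mem_univ _, h⟩⟩

omit [NormedSpace ℝ E] in
-- A joint neighbourhood contains a neighbourhood in each nearby slice. This turns pointwise
-- identities between families into identities of germs in the variable alone, which is what
-- derivatives need.
theorem eventually_eventually_slice {S : Set E} {p : D × E} {P : D × E → Prop}
    (h : ∀ᶠ p' in 𝓝[univ ×ˢ S] p, P p') :
    ∀ᶠ p' in 𝓝[univ ×ˢ S] p, ∀ᶠ y in 𝓝[S] p'.2, P (p'.1, y) :=
  (eventually_eventually_nhdsWithin.2 h).mono fun p' hp' =>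
    (tendsto_slice_nhdsWithin p'.1 p'.2).eventually hp'

namespace SmoothFamilyAt

variable {f f' : D → E → F} {S : Set E} {p : D × E}

theorem contDiffWithinAt (h : SmoothFamilyAt f S p) (hp : p.2 ∈ S) :
    ContDiffWithinAt ℝ ∞ (f p.1) S p.2 :=
  h.smooth.self_of_nhdsWithin ⟨mem_univ _, hp⟩

theorem continuousWithinAt (h : SmoothFamilyAt f S p) :
    ContinuousWithinAt (fun p' => f p'.1 p'.2) (univ ×ˢ S) p := by
  have := (continuousMultilinearCurryFin0 ℝ E F).continuous.continuousAt.comp_continuousWithinAt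
    (h.cont 0)
  refine this.congr (fun p' _ => ?_) ?_ <;> simp [iteratedFDerivWithin_zero_eq_comp]

theorem continuousWithinAt_fderivWithin (hS : UniqueDiffOn ℝ S) (hp : p.2 ∈ S)
    (h : SmoothFamilyAt f S p) :
    ContinuousWithinAt (fun p' => fderivWithin ℝ (f p'.1) S p'.2) (univ ×ˢ S) p := by
  have := (continuousMultilinearCurryFin1 ℝ E F).continuous.continuousAt.comp_continuousWithinAt
    (h.cont 1)
  have key : ∀ p' : D × E, p'.2 ∈ S → fderivWithin ℝ (f p'.1) S p'.2 =
      continuousMultilinearCurryFin1 ℝ E F (iteratedFDerivWithin ℝ 1 (f p'.1) S p'.2) := by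
    intro p' hp'
    ext v
    simp only [continuousMultilinearCurryFin1_apply]
    rw [iteratedFDerivWithin_one_apply (hS _ hp')]
    rfl
  exact this.congr (fun p' h' => key p' h'.2) (key p hp)

theorem congr (h : SmoothFamilyAt f S p) (hp : p.2 ∈ S)
    (he : ∀ᶠ p' in 𝓝[univ ×ˢ S] p, f' p'.1 p'.2 = f p'.1 p'.2) : SmoothFamilyAt f' S p := by
  have h1 : ∀ᶠ p' in 𝓝[univ ×ˢ S] p, f' p'.1 =ᶠ[𝓝[S] p'.2] f p'.1 :=
    eventually_eventually_slice he
  refine ⟨?_, fun k => (h.cont k).congr_of_eventuallyEq ?_ ?_⟩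
  · filter_upwards [h.smooth, he, h1] with p' h2 h3 h4 using h2.congr_of_eventuallyEq h4 h3
  · filter_upwards [he, h1] with p' h3 h4 using h4.iteratedFDerivWithin_eq h3 k
  · exact (h1.self_of_nhdsWithin ⟨mem_univ _, hp⟩).iteratedFDerivWithin_eq
      (he.self_of_nhdsWithin ⟨mem_univ _, hp⟩) k

theorem of_contDiffWithinAt (hS : UniqueDiffOn ℝ S) {g : E → F}
    (hg : ∀ᶠ w in 𝓝[S] p.2, ContDiffWithinAt ℝ ∞ g S w) (hp : p.2 ∈ S) :
    SmoothFamilyAt (fun _ : D => g) S p := by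
  have htend : Tendsto Prod.snd (𝓝[univ ×ˢ S] p) (𝓝[S] p.2) :=
    tendsto_nhdsWithin_iff.2 ⟨continuous_snd.continuousWithinAt,
      eventually_mem_nhdsWithin.mono fun _ h => h.2⟩
  refine ⟨htend.eventually hg, fun k => ?_⟩
  exact ((hg.self_of_nhdsWithin hp).continuousWithinAt_iteratedFDerivWithin hS (k := k)
    (by exact_mod_cast le_top) hp).tendsto.comp htend

theorem add (hS : UniqueDiffOn ℝ S) (hp : p.2 ∈ S) (h : SmoothFamilyAt f S p)
    (h' : SmoothFamilyAt f' S p) :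
    SmoothFamilyAt (fun d w => f d w + f' d w) S p := by
  have key : ∀ p' : D × E, p'.2 ∈ S → ContDiffWithinAt ℝ ∞ (f p'.1) S p'.2 →
      ContDiffWithinAt ℝ ∞ (f' p'.1) S p'.2 → ∀ k : ℕ,
      iteratedFDerivWithin ℝ k (fun w => f p'.1 w + f' p'.1 w) S p'.2 =
      iteratedFDerivWithin ℝ k (f p'.1) S p'.2 + iteratedFDerivWithin ℝ k (f' p'.1) S p'.2 := by
    intro p' hp' h1 h2 k
    exact iteratedFDerivWithin_add_apply (h1.of_le (by exact_mod_cast le_top))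
      (h2.of_le (by exact_mod_cast le_top)) hS hp'
  refine ⟨?_, fun k => ((h.cont k).add (h'.cont k)).congr_of_eventuallyEq ?_ ?_⟩
  · filter_upwards [h.smooth, h'.smooth] with p' h1 h2 using h1.add h2
  · filter_upwards [h.smooth, h'.smooth, self_mem_nhdsWithin] with p' h1 h2 h3
      using key p' h3.2 h1 h2 k
  · exact key p hp (h.contDiffWithinAt hp) (h'.contDiffWithinAt hp) k

/-- By Faà di Bruno's formula, each derivative of the composite is a finite sum of continuous
multilinear expressions in derivatives of `g` and `f`, which are jointly continuous by assumption.
-/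
theorem comp {g : D → F → G} {T : Set F} (hS : UniqueDiffOn ℝ S) (hT : UniqueDiffOn ℝ T)
    (hp : p.2 ∈ S) (hg : SmoothFamilyAt g T (p.1, f p.1 p.2)) (hf : SmoothFamilyAt f S p)
    (hm : ∀ᶠ p' in 𝓝[univ ×ˢ S] p, f p'.1 p'.2 ∈ T) :
    SmoothFamilyAt (fun d w => g d (f d w)) S p := by
  have htend : Tendsto (fun p' : D × E => (p'.1, f p'.1 p'.2)) (𝓝[univ ×ˢ S] p)
      (𝓝[univ ×ˢ T] (p.1, f p.1 p.2)) :=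
    tendsto_nhdsWithin_iff.2 ⟨(continuous_fst.continuousWithinAt.tendsto).prodMk_nhds
      hf.continuousWithinAt, hm.mono fun p' h => ⟨mem_univ _, h⟩⟩
  have hgs := htend.eventually hg.smooth
  have hms := eventually_eventually_slice hm
  have hpS : p ∈ (univ : Set D) ×ˢ S := ⟨mem_univ _, hp⟩
  have key : ∀ p' : D × E, p'.2 ∈ S → ContDiffWithinAt ℝ ∞ (f p'.1) S p'.2 →
      ContDiffWithinAt ℝ ∞ (g p'.1) T (f p'.1 p'.2) →
      (∀ᶠ y in 𝓝[S] p'.2, f p'.1 y ∈ T) → ∀ k : ℕ,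
      iteratedFDerivWithin ℝ k (fun w => g p'.1 (f p'.1 w)) S p'.2 =
        ∑ c : OrderedFinpartition k, c.compAlongOrderedFinpartition
          (iteratedFDerivWithin ℝ c.length (g p'.1) T (f p'.1 p'.2))
          (fun m => iteratedFDerivWithin ℝ (c.partSize m) (f p'.1) S p'.2) := by
    intro p' hp' h1 h2 h3 k
    exact iteratedFDerivWithin_comp_of_eventually_mem h2 h1 hT hS hp' h3
      (by exact_mod_cast le_top)
  refine ⟨?_, fun k => ContinuousWithinAt.congr_of_eventuallyEq (f := fun p' : D × E =>
      ∑ c : OrderedFinpartition k, c.compAlongOrderedFinpartitionL ℝ E F G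
          (iteratedFDerivWithin ℝ c.length (g p'.1) T (f p'.1 p'.2))
          (fun m => iteratedFDerivWithin ℝ (c.partSize m) (f p'.1) S p'.2)) ?_ ?_ ?_⟩
  · filter_upwards [hf.smooth, hgs, hms] with p' h1 h2 h3
    exact ContDiffWithinAt.comp_of_preimage_mem_nhdsWithin (t := T) p'.2 h2 h1 h3
  · refine tendsto_finsetSum _ fun c _ => ?_
    have hcont : Continuous fun q : (F [×c.length]→L[ℝ] G) × (∀ m, E [×c.partSize m]→L[ℝ] F) =>
        c.compAlongOrderedFinpartitionL ℝ E F G q.1 q.2 := by fun_prop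
    have h1 : Tendsto (fun p' : D × E => iteratedFDerivWithin ℝ c.length (g p'.1) T (f p'.1 p'.2))
        (𝓝[univ ×ˢ S] p) (𝓝 (iteratedFDerivWithin ℝ c.length (g p.1) T (f p.1 p.2))) :=
      (hg.cont c.length).tendsto.comp htend
    have h2 : Tendsto (fun p' : D × E => fun m =>
        iteratedFDerivWithin ℝ (c.partSize m) (f p'.1) S p'.2)
        (𝓝[univ ×ˢ S] p) (𝓝 fun m => iteratedFDerivWithin ℝ (c.partSize m) (f p.1) S p.2) :=
      tendsto_pi_nhds.2 fun m => (hf.cont (c.partSize m)).tendsto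
    exact (hcont.tendsto _).comp (h1.prodMk_nhds h2)
  · filter_upwards [hf.smooth, hgs, hms, self_mem_nhdsWithin] with p' h1 h2 h3 h4
      using key p' h4.2 h1 h2 h3 k
  · exact key p hp (hf.contDiffWithinAt hp) (hgs.self_of_nhdsWithin hpS)
      (hms.self_of_nhdsWithin hpS) k

/-- A smooth map with a parameter in a normed space, where the parameter depends continuously on
`d ∈ D`. -/
theorem of_contDiff {P : Type*} [NormedAddCommGroup P] [NormedSpace ℝ P] {g : P × E → F}
    (hg : ContDiff ℝ ∞ g) {c : D → P} (hc : ContinuousAt c p.1) (hS : UniqueDiffOn ℝ S)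
    (hp : p.2 ∈ S) : SmoothFamilyAt (fun d w => g (c d, w)) S p := by
  have hs : ∀ a : P, ContDiff ℝ ∞ fun w => g (a, w) := fun a => hg.comp (by fun_prop)
  have key : ∀ (a : P) (w : E), w ∈ S → ∀ k : ℕ, iteratedFDerivWithin ℝ k (fun w => g (a, w)) S w =
      (iteratedFDeriv ℝ k g (a, w)).compContinuousLinearMap
        (fun _ => ContinuousLinearMap.inr ℝ P E) := by
    intro a w hw k
    have hk : (k : WithTop ℕ∞) ≤ ∞ := by exact_mod_cast le_top
    rw [iteratedFDerivWithin_eq_iteratedFDeriv hS ((hs a).contDiffAt.of_le hk) hw]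
    -- The partial map is a translate of `g` restricted along a linear inclusion, so its derivatives
    -- are restrictions of the full derivatives of `g`, which are continuous in both variables.
    have h1 : (fun w => g (a, w)) =
        (fun q => g ((a, 0) + q)) ∘ ContinuousLinearMap.inr ℝ P E := by
      ext w; simp
    have h2 : ContDiff ℝ ∞ fun q => g ((a, 0) + q) := hg.comp (by fun_prop)
    rw [h1, ContinuousLinearMap.iteratedFDeriv_comp_right _ h2 w hk, iteratedFDeriv_comp_add_left]
    simp
  refine ⟨Eventually.of_forall fun p' => (hs _).contDiffWithinAt, fun k => ?_⟩
  have h1 : ContinuousAt (fun p' : D × E => iteratedFDeriv ℝ k g (c p'.1, p'.2)) p :=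
    ((hg.continuous_iteratedFDeriv (by exact_mod_cast le_top)).continuousAt).comp
      ((ContinuousAt.comp (f := Prod.fst) hc continuousAt_fst).prodMk continuousAt_snd)
  have h2 := (ContinuousMultilinearMap.compContinuousLinearMapL (𝕜 := ℝ) (F := F)
    (fun _ : Fin k => ContinuousLinearMap.inr ℝ P E)).continuous.continuousAt.comp h1
  exact h2.continuousWithinAt.congr (fun p' h => key _ _ h.2 k) (key _ _ hp k)

theorem smul (hS : UniqueDiffOn ℝ S) (hp : p.2 ∈ S) {c : D → ℝ} (hc : ContinuousAt c p.1)
    (h : SmoothFamilyAt f S p) : SmoothFamilyAt (fun d w => c d • f d w) S p :=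
  comp (T := univ) (g := fun d y => c d • y) hS uniqueDiffOn_univ hp
    (of_contDiff (g := fun q : ℝ × F => q.1 • q.2) (by fun_prop) hc uniqueDiffOn_univ (mem_univ _))
    h (Eventually.of_forall fun _ => mem_univ _)

end SmoothFamilyAt

end Families

end

noncomputable section

/-! ### Maps of quadrants that are close to the identity -/

section NearIdentity

variable {n q : ℕ}

theorem uniqueDiffOn_quadrantSet (n q : ℕ) : UniqueDiffOn ℝ (quadrantSet n q) := by
  rw [← range_quadrantModel]
  exact (quadrantModel n q).uniqueDiffOn

theorem zero_mem_quadrantSet (n q : ℕ) : (0 : Euc n) ∈ quadrantSet n q := fun _ _ => le_rfl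

/-- The nearest point retraction of `ℝⁿ` onto a quadrant. -/
def quadrantProj (n q : ℕ) (v : Euc n) : Euc n := ((quadrantModel n q).symm v).1

theorem quadrantProj_apply (v : Euc n) (i : Fin n) :
    quadrantProj n q v i = if n ≤ i.val + q then max (v i) 0 else v i := rfl

theorem quadrantProj_mem (v : Euc n) : quadrantProj n q v ∈ quadrantSet n q :=
  ((quadrantModel n q).symm v).2

theorem quadrantProj_of_mem {v : Euc n} (hv : v ∈ quadrantSet n q) : quadrantProj n q v = v :=
  (quadrantModel n q).right_inv (by rwa [range_quadrantModel])

theorem euc_norm_le_of_abs_le {v w : Euc n} (h : ∀ i, |v i| ≤ |w i|) : ‖v‖ ≤ ‖w‖ := by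
  rw [EuclideanSpace.norm_eq, EuclideanSpace.norm_eq]
  refine Real.sqrt_le_sqrt (Finset.sum_le_sum fun i _ => ?_)
  rw [Real.norm_eq_abs, Real.norm_eq_abs]
  exact pow_le_pow_left₀ (abs_nonneg _) (h i) 2

/-- The retraction is 1-Lipschitz, so extending a map from the quadrant by means of it does not
worsen Lipschitz constants. -/
theorem norm_quadrantProj_sub_le (v w : Euc n) :
    ‖quadrantProj n q v - quadrantProj n q w‖ ≤ ‖v - w‖ := by
  refine euc_norm_le_of_abs_le fun i => ?_
  simp only [PiLp.sub_apply, quadrantProj_apply]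
  split_ifs
  · exact abs_max_sub_max_le_abs _ _ _
  · exact le_rfl

theorem norm_quadrantProj_le (v : Euc n) : ‖quadrantProj n q v‖ ≤ ‖v‖ := by
  simpa [quadrantProj_of_mem (zero_mem_quadrantSet n q)] using norm_quadrantProj_sub_le (q := q) v 0

/-- A map between pieces of a quadrant that is `C¹`-close to the identity and smooth. -/
structure IsNearId (q : ℕ) (f : Euc n → Euc n) (r : ℝ) : Prop where
  smooth : ContDiffOn ℝ ∞ f (quadrantSet n q ∩ Metric.ball 0 r)
  deriv : ∀ w ∈ quadrantSet n q ∩ Metric.ball 0 r,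
    ‖fderivWithin ℝ f (quadrantSet n q) w - ContinuousLinearMap.id ℝ (Euc n)‖ ≤ 1 / 4
  maps : MapsTo f (quadrantSet n q ∩ Metric.ball 0 r) (quadrantSet n q)

namespace IsNearId

variable {f : Euc n → Euc n} {r : ℝ}

theorem contDiffWithinAt (h : IsNearId q f r) {w : Euc n}
    (hw : w ∈ quadrantSet n q ∩ Metric.ball 0 r) :
    ContDiffWithinAt ℝ ∞ f (quadrantSet n q) w :=
  (contDiffWithinAt_inter (Metric.isOpen_ball.mem_nhds hw.2)).1 (h.smooth w hw)

theorem hasFDerivWithinAt (h : IsNearId q f r) {w : Euc n}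
    (hw : w ∈ quadrantSet n q ∩ Metric.ball 0 r) :
    HasFDerivWithinAt f (fderivWithin ℝ f (quadrantSet n q) w) (quadrantSet n q) w :=
  ((h.contDiffWithinAt hw).differentiableWithinAt (by simp)).hasFDerivWithinAt

theorem norm_sub_sub_le (h : IsNearId q f r) {x y : Euc n}
    (hx : x ∈ quadrantSet n q ∩ Metric.ball 0 r) (hy : y ∈ quadrantSet n q ∩ Metric.ball 0 r) :
    ‖f y - f x - (y - x)‖ ≤ 1 / 4 * ‖y - x‖ :=
  Convex.norm_image_sub_le_of_norm_hasFDerivWithin_le' (𝕜 := ℝ)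
    (φ := ContinuousLinearMap.id ℝ (Euc n))
    (fun _ hw => (h.hasFDerivWithinAt hw).mono inter_subset_left) h.deriv
    ((convex_quadrantSet n q).inter (convex_ball _ _)) hx hy

theorem injOn (h : IsNearId q f r) : InjOn f (quadrantSet n q ∩ Metric.ball 0 r) := by
  intro x hx y hy hxy
  have := h.norm_sub_sub_le hx hy
  rw [hxy, sub_self, zero_sub, norm_neg] at this
  have h0 : ‖y - x‖ = 0 := by linarith [norm_nonneg (y - x)]
  exact (sub_eq_zero.1 (norm_eq_zero.1 h0)).symm

/-- A near-identity map of quadrants that is open at `x` preserves the facets through `x`. -/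
theorem apply_eq_zero (h : IsNearId q f r) {x : Euc n}
    (hx : x ∈ quadrantSet n q ∩ Metric.ball 0 r)
    (hop : f '' (quadrantSet n q ∩ Metric.ball 0 r) ∈ 𝓝[quadrantSet n q] (f x))
    {i : Fin n} (hi : n ≤ i.val + q) (hxi : x i = 0) : f x i = 0 := by
  by_contra hne
  have hpos : 0 < f x i := lt_of_le_of_ne (h.maps hx i hi) (Ne.symm hne)
  -- If `f x i > 0`, then `f x - t e_i` stays in the quadrant for small `t`, so by openness it is `f
  -- y` for some `y` in the domain. The mean value bound gives `‖y - x‖ ≤ 4t/3`, so `y - x` is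
  -- within `t/3` of `-t e_i`. Since `x i = 0`, this forces `y i < 0`.
  set c : ℝ → Euc n := fun t => f x - t • EuclideanSpace.single i (1 : ℝ) with hc
  have hcc : Continuous c := by fun_prop
  have hcS : ∀ᶠ t in 𝓝[>] (0 : ℝ), c t ∈ quadrantSet n q := by
    filter_upwards [Ioo_mem_nhdsGT hpos] with t ht k hk
    rcases eq_or_ne k i with rfl | hki
    · simp [hc, ht.2.le]
    · simp [hc, hki, h.maps hx k hk]
  have htend : Filter.Tendsto c (𝓝[>] 0) (𝓝[quadrantSet n q] (f x)) := by
    refine tendsto_nhdsWithin_iff.2 ⟨?_, hcS⟩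
    have := hcc.tendsto 0
    simp only [hc, zero_smul, sub_zero] at this
    exact this.mono_left nhdsWithin_le_nhds
  obtain ⟨t, ⟨y, hy, hyt⟩, ht⟩ := ((htend.eventually_mem hop).and self_mem_nhdsWithin).exists
  have ht : 0 < t := ht
  have h1 := h.norm_sub_sub_le hx hy
  rw [hyt] at h1
  simp only [hc, sub_sub_cancel_left] at h1
  have h2 : ‖t • EuclideanSpace.single i (1 : ℝ)‖ = t := by
    simp [norm_smul, abs_of_pos ht]
  have h3 : ‖y - x‖ ≤ ‖-(t • EuclideanSpace.single i (1 : ℝ)) - (y - x)‖ + t := by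
    calc ‖y - x‖ = ‖-(-(t • EuclideanSpace.single i (1 : ℝ)) - (y - x))
          - t • EuclideanSpace.single i (1 : ℝ)‖ := by congr 1; abel
      _ ≤ _ := (norm_sub_le _ _).trans (by rw [norm_neg, h2])
  have h4 : ‖(-(t • EuclideanSpace.single i (1 : ℝ)) - (y - x)) i‖ ≤ _ :=
    PiLp.norm_apply_le (-(t • EuclideanSpace.single i (1 : ℝ)) - (y - x)) i
  simp only [PiLp.sub_apply, PiLp.neg_apply, PiLp.smul_apply, PiLp.single_apply,
    hxi, if_true, smul_eq_mul, mul_one, sub_zero, Real.norm_eq_abs] at h4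
  have h5 := neg_abs_le (-t - y i)
  have h6 := hy.1 i hi
  linarith

/-- A near-identity map of quadrants that preserves facets has relatively open image, and a smooth
inverse. -/
theorem exists_inverse (h : IsNearId q f r)
    (hfacet : ∀ x ∈ quadrantSet n q ∩ Metric.ball 0 r, ∀ i : Fin n, n ≤ i.val + q → x i = 0 →
      f x i = 0) :
    ∃ (U : Set (Euc n)) (g : Euc n → Euc n), IsOpen U ∧
      f '' (quadrantSet n q ∩ Metric.ball 0 r) = quadrantSet n q ∩ U ∧
      ContDiffOn ℝ ∞ g (quadrantSet n q ∩ U) ∧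
      ∀ x ∈ quadrantSet n q ∩ Metric.ball 0 r, g (f x) = x := by
  set S := quadrantSet n q
  set B := Metric.ball (0 : Euc n) r
  have hPB : ∀ w ∈ B, quadrantProj n q w ∈ S ∩ B := fun w hw =>
    ⟨quadrantProj_mem w, by
      simp only [B, mem_ball_zero_iff] at hw ⊢
      exact (norm_quadrantProj_le w).trans_lt hw⟩
  -- `F` extends `f` to the whole ball, and `F - id` is `1/4`-Lipschitz because the retraction is
  -- 1-Lipschitz. The quantitative inverse function theorem then applies on an open ball, without
  -- boundary.
  set F : Euc n → Euc n := fun w => w + (f (quadrantProj n q w) - quadrantProj n q w) with hF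
  have hFf : ∀ w ∈ S, F w = f w := fun w hw => by simp [hF, quadrantProj_of_mem hw]
  have happ : ApproximatesLinearOn F ((ContinuousLinearEquiv.refl ℝ (Euc n)) : Euc n →L[ℝ] Euc n)
      B (1 / 4) := by
    intro x hx y hy
    have h1 := h.norm_sub_sub_le (hPB y hy) (hPB x hx)
    have h2 := norm_quadrantProj_sub_le (q := q) x y
    have h3 : F x - F y - (x - y) = f (quadrantProj n q x) - f (quadrantProj n q y) -
        (quadrantProj n q x - quadrantProj n q y) := by
      simp only [hF]; abel
    simp only [ContinuousLinearEquiv.coe_refl, ContinuousLinearMap.coe_id', id]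
    rw [h3]
    push_cast
    linarith
  -- For `n = 0` the identity has norm `0`, which is why the trivial space is a separate case.
  have hc : Subsingleton (Euc n) ∨ (1 / 4 : NNReal) <
      ‖((ContinuousLinearEquiv.refl ℝ (Euc n)).symm : Euc n →L[ℝ] Euc n)‖₊⁻¹ := by
    rcases subsingleton_or_nontrivial (Euc n) with hs | hs
    · exact Or.inl hs
    · right
      have : ‖((ContinuousLinearEquiv.refl ℝ (Euc n)).symm : Euc n →L[ℝ] Euc n)‖₊ = 1 := by
        ext
        simp
      rw [this, inv_one, ← NNReal.coe_lt_coe]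
      norm_num
  set Φ := happ.toOpenPartialHomeomorph F B hc Metric.isOpen_ball with hΦ
  have hsrc : Φ.source = B := rfl
  have hcoe : ∀ w, Φ w = F w := fun _ => rfl
  have himg : f '' (S ∩ B) = S ∩ Φ.target := by
    ext y
    constructor
    · rintro ⟨x, hx, rfl⟩
      refine ⟨h.maps hx, ?_⟩
      rw [← hFf x hx.1]
      exact Φ.map_source hx.2
    · rintro ⟨hyS, hyt⟩
      have hwB : Φ.symm y ∈ B := Φ.map_target hyt
      have hwy : F (Φ.symm y) = y := Φ.right_inv hyt
      -- A negative coordinate of `w = Φ.symm y` is projected to `0`, which `f` keeps at `0` by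
      -- `hfacet`. So `F` does not change this coordinate, contradicting that `F w = y` lies in the
      -- quadrant.
      have hwS : Φ.symm y ∈ S := by
        intro i hi
        by_contra hneg
        push Not at hneg
        have h1 : quadrantProj n q (Φ.symm y) i = 0 := by
          rw [quadrantProj_apply, if_pos hi, max_eq_right hneg.le]
        have h2 : F (Φ.symm y) i = Φ.symm y i := by
          simp [hF, h1, hfacet _ (hPB _ hwB) i hi h1]
        have h3 := hyS i hi
        rw [← hwy, h2] at h3
        linarith
      exact ⟨_, ⟨hwS, hwB⟩, by rw [← hFf _ hwS, hwy]⟩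
  have hleft : ∀ x ∈ S ∩ B, Φ.symm (f x) = x := by
    intro x hx
    rw [← hFf x hx.1]
    exact Φ.left_inv hx.2
  have hmap : ∀ y ∈ S ∩ Φ.target, Φ.symm y ∈ S ∩ B ∧ f (Φ.symm y) = y := by
    intro y hy
    rw [← himg] at hy
    obtain ⟨x, hx, rfl⟩ := hy
    rw [hleft x hx]
    exact ⟨hx, rfl⟩
  have hTB : UniqueDiffOn ℝ (S ∩ B) := (uniqueDiffOn_quadrantSet n q).inter Metric.isOpen_ball
  have hfd : ContDiffOn ℝ ∞ (fderivWithin ℝ f (S ∩ B)) (S ∩ B) :=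
    h.smooth.fderivWithin hTB (by simp)
  -- A linear map at distance less than `1` from the identity is invertible, by the Neumann series.
  have hequiv : ∀ x ∈ S ∩ B, ∃ e : Euc n ≃L[ℝ] Euc n,
      (e : Euc n →L[ℝ] Euc n) = fderivWithin ℝ f (S ∩ B) x := by
    intro x hx
    have h1 : fderivWithin ℝ f (S ∩ B) x = fderivWithin ℝ f S x :=
      fderivWithin_inter (Metric.isOpen_ball.mem_nhds hx.2)
    have h2 := h.deriv x hx
    have h3 : ‖(1 : Euc n →L[ℝ] Euc n) - fderivWithin ℝ f (S ∩ B) x‖ < 1 := by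
      rw [h1, norm_sub_rev]
      exact h2.trans_lt (by norm_num)
    refine ⟨ContinuousLinearEquiv.unitsEquiv ℝ (Euc n) (Units.oneSub _ h3), ?_⟩
    ext v
    simp [Units.oneSub]
  have hder : ∀ y ∈ S ∩ Φ.target, HasFDerivWithinAt Φ.symm
      (ContinuousLinearMap.inverse (fderivWithin ℝ f (S ∩ B) (Φ.symm y))) (S ∩ Φ.target) y := by
    intro y hy
    obtain ⟨hx, hxy⟩ := hmap y hy
    obtain ⟨e, he⟩ := hequiv _ hx
    have h1 : HasFDerivWithinAt f (e : Euc n →L[ℝ] Euc n) (S ∩ B) (Φ.symm y) := by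
      rw [he]
      exact ((h.smooth _ hx).differentiableWithinAt (by simp)).hasFDerivWithinAt
    rw [← he, ContinuousLinearMap.inverse_equiv]
    refine HasFDerivWithinAt.of_local_left_inverse ?_ h1 hy ?_
    · exact tendsto_nhdsWithin_iff.2 ⟨(Φ.continuousAt_symm hy.2).continuousWithinAt,
        Filter.eventually_of_mem self_mem_nhdsWithin fun z hz => (hmap z hz).1⟩
    · exact Filter.eventually_of_mem self_mem_nhdsWithin fun z hz => (hmap z hz).2
  refine ⟨Φ.target, Φ.symm, Φ.open_target, himg, ?_, hleft⟩
  -- Bootstrapping: the derivative of the inverse is linear inversion applied to the derivative of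
  -- `f` at the inverse, so each order of smoothness gives the next.
  rw [contDiffOn_infty]
  intro m
  induction m with
  | zero =>
    rw [Nat.cast_zero, contDiffOn_zero]
    exact Φ.continuousOn_symm.mono inter_subset_right
  | succ m ih =>
    rw [Nat.cast_succ, contDiffOn_succ_iff_hasFDerivWithinAt (by simp)]
    intro y hy
    refine ⟨S ∩ Φ.target, by rw [insert_eq_of_mem hy]; exact self_mem_nhdsWithin, by simp,
      _, hder, ?_⟩
    intro z hz
    obtain ⟨e, he⟩ := hequiv _ (hmap z hz).1
    have h1 : ContDiffAt ℝ m ContinuousLinearMap.inverse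
        (fderivWithin ℝ f (S ∩ B) (Φ.symm z)) := by
      rw [← he]
      exact contDiffAt_map_inverse e
    exact h1.comp_contDiffWithinAt z (((hfd _ (hmap z hz).1).of_le
      (by exact_mod_cast le_top)).comp z (ih z hz) fun z hz => (hmap z hz).1)

end IsNearId

end NearIdentity

end

noncomputable section

/-! ### Inner tangent cones and the index in charts -/

section Index

variable {n : ℕ} {X : Type*} [TopologicalSpace X] [ChartedSpace (EuclideanQuadrant n) X]

theorem mem_range_cornerModel {y : Euc n} : y ∈ range (cornerModel n) ↔ ∀ i, 0 ≤ y i :=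
  ⟨by rintro ⟨z, rfl⟩; exact z.2, fun h => ⟨⟨y, h⟩, rfl⟩⟩

omit [ChartedSpace (EuclideanQuadrant n) X] in
theorem extend_nonneg (e : OpenPartialHomeomorph X (EuclideanQuadrant n)) (x : X) (i : Fin n) :
    0 ≤ e.extend (cornerModel n) x i := (e x).2 i

/-- The cone of directions that point into `[0, ∞)ⁿ` at `c`. -/
def innerCone (c : Euc n) : Set (Euc n) := {v | ∀ i, c i = 0 → 0 ≤ v i}

theorem exists_add_smul_mem_range {c v : Euc n} (hc : ∀ i, 0 ≤ c i) (hv : v ∈ innerCone c) :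
    ∃ t : ℝ, 0 < t ∧ c + t • v ∈ range (cornerModel n) := by
  have hev : ∀ k : Fin n, ∀ᶠ t in 𝓝[>] (0 : ℝ), 0 ≤ (c + t • v) k := by
    intro k
    rcases (hc k).eq_or_lt with h0 | h0
    · filter_upwards [self_mem_nhdsWithin] with t ht
      have h2 : (0 : ℝ) ≤ t := le_of_lt ht
      simp only [PiLp.add_apply, PiLp.smul_apply, smul_eq_mul, ← h0, zero_add]
      exact mul_nonneg h2 (hv k h0.symm)
    · have hcont : Continuous fun t : ℝ => (c + t • v) k := by
        simp only [PiLp.add_apply, PiLp.smul_apply, smul_eq_mul]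
        fun_prop
      have h1 : ∀ᶠ t in 𝓝 (0 : ℝ), 0 < (c + t • v) k :=
        hcont.continuousAt.eventually (lt_mem_nhds (by simpa using h0))
      exact (h1.filter_mono nhdsWithin_le_nhds).mono fun t ht => ht.le
  obtain ⟨t, ht, ht0⟩ := ((Filter.eventually_all.2 hev).and self_mem_nhdsWithin).exists
  exact ⟨t, ht0, mem_range_cornerModel.2 ht⟩

/-- A coordinate of `τ` that vanishes at `c` has a minimum there, so its derivative is nonnegative
along every direction that stays in the convex set `[0, ∞)ⁿ`. -/
theorem HasFDerivWithinAt.mem_innerCone {τ : Euc n → Euc n} {L : Euc n →L[ℝ] Euc n} {c : Euc n}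
    (hτ : HasFDerivWithinAt τ L (range (cornerModel n)) c) (hpos : ∀ u i, 0 ≤ τ u i)
    (hc : ∀ i, 0 ≤ c i) {v : Euc n} (hv : v ∈ innerCone c) : L v ∈ innerCone (τ c) := by
  intro k hk
  obtain ⟨t, ht, htv⟩ := exists_add_smul_mem_range hc hv
  have h2 := (EuclideanSpace.proj (𝕜 := ℝ) k).hasFDerivAt.comp_hasFDerivWithinAt _ hτ
  have h3 : IsLocalMinOn (EuclideanSpace.proj (𝕜 := ℝ) k ∘ τ) (range (cornerModel n)) c :=
    Filter.Eventually.of_forall fun u => by simpa [hk] using hpos u k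
  have h4 := h3.hasFDerivWithinAt_nonneg h2 (mem_posTangentConeAt_of_segment_subset (y := t • v)
    ((cornerModel n).convex_range.segment_subset (mem_range_cornerModel.2 hc) htv))
  have h5 : 0 ≤ t * L v k := by simpa using h4
  exact nonneg_of_mul_nonneg_right h5 ht

variable [IsManifold (cornerModel n) ∞ X]

theorem tangentCoordChange_mem_innerCone {x y z : X}
    (hz : z ∈ (extChartAt (cornerModel n) x).source ∩ (extChartAt (cornerModel n) y).source)
    {v : Euc n} (hv : v ∈ innerCone (extChartAt (cornerModel n) x z)) :
    tangentCoordChange (cornerModel n) x y z v ∈ innerCone (extChartAt (cornerModel n) y z) := by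
  have h := (hasFDerivWithinAt_tangentCoordChange hz).mem_innerCone
    (fun u i => (chartAt (EuclideanQuadrant n) y _).2 i)
    (fun i => (chartAt (EuclideanQuadrant n) x z).2 i) hv
  rwa [Function.comp_apply, (extChartAt (cornerModel n) x).left_inv hz.1] at h

theorem tangentCoordChange_symm {x y z : X}
    (hz : z ∈ (extChartAt (cornerModel n) x).source ∩ (extChartAt (cornerModel n) y).source)
    (v : Euc n) : tangentCoordChange (cornerModel n) x y z
      (tangentCoordChange (cornerModel n) y x z v) = v := by
  rw [tangentCoordChange_comp ⟨⟨hz.2, hz.1⟩, hz.2⟩, tangentCoordChange_self hz.2]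

/-- Extension of a vector by zero. -/
def extendByZero (J : Set (Fin n)) [DecidablePred (· ∈ J)] : (J → ℝ) →ₗ[ℝ] Euc n where
  toFun u := WithLp.toLp 2 fun i => if h : i ∈ J then u ⟨i, h⟩ else 0
  map_add' u v := by ext i; by_cases h : i ∈ J <;> simp [h]
  map_smul' u v := by ext i; by_cases h : i ∈ J <;> simp [h]

/-- Restriction of a vector to a set of coordinates. -/
def restrictCoords (J : Set (Fin n)) : Euc n →ₗ[ℝ] (J → ℝ) where
  toFun v i := v i
  map_add' _ _ := rfl
  map_smul' _ _ := rfl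

/-- A vector whose `J`-coordinates vanish lies in the inner cone together with its negative. The
coordinate change therefore kills its `J'`-coordinates, and so induces a surjection `ℝ^J → ℝ^J'`. -/
theorem ncard_zeros_le {x y z : X}
    (hz : z ∈ (extChartAt (cornerModel n) x).source ∩ (extChartAt (cornerModel n) y).source) :
    {i : Fin n | extChartAt (cornerModel n) y z i = 0}.ncard ≤
      {i : Fin n | extChartAt (cornerModel n) x z i = 0}.ncard := by
  classical
  set J := {i : Fin n | extChartAt (cornerModel n) x z i = 0}
  set J' := {i : Fin n | extChartAt (cornerModel n) y z i = 0}
  set L := tangentCoordChange (cornerModel n) x y z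
  let T : (J → ℝ) →ₗ[ℝ] (J' → ℝ) := (restrictCoords J').comp (L.toLinearMap.comp (extendByZero J))
  have hker : ∀ v : Euc n, (∀ i ∈ J, v i = 0) → ∀ k ∈ J', L v k = 0 := by
    intro v hv k hk
    refine le_antisymm ?_ (tangentCoordChange_mem_innerCone hz (fun i hi => (hv i hi).ge) k hk)
    have h1 := tangentCoordChange_mem_innerCone hz (v := -v)
      (fun i hi => by simp [hv i hi]) k hk
    rw [map_neg, PiLp.neg_apply] at h1
    exact neg_nonneg.1 h1
  have hT : Function.Surjective T := by
    intro u
    -- Truncating the preimage `v` to its `J`-coordinates changes `L v` only by the image of a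
    -- vector vanishing on `J`, which `hker` makes invisible on `J'`.
    set v := tangentCoordChange (cornerModel n) y x z (extendByZero J' u) with hv
    have hLv : L v = extendByZero J' u := tangentCoordChange_symm hz _
    refine ⟨restrictCoords J v, funext fun k => ?_⟩
    have h1 := hker (v - extendByZero J (restrictCoords J v))
      (fun i hi => by simp [extendByZero, hi]; exact sub_self _) k k.2
    rw [map_sub, hLv, PiLp.sub_apply, sub_eq_zero] at h1
    have h2 : extendByZero J' u k = u k := by simp [extendByZero]
    exact h1.symm.trans h2
  have := LinearMap.finrank_le_finrank_of_surjective hT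
  simpa [Module.finrank_fintype_fun_eq_card, Set.ncard_eq_toFinset_card', Fintype.card_subtype]
    using this

/-- Comparing the two charts in both directions shows that the index does not depend on the chart.
-/
theorem ncard_zeros_eq_cornerIndex {y z : X} (hz : z ∈ (extChartAt (cornerModel n) y).source) :
    {i : Fin n | extChartAt (cornerModel n) y z i = 0}.ncard = cornerIndex n z :=
  le_antisymm (ncard_zeros_le ⟨mem_extChartAt_source z, hz⟩)
    (ncard_zeros_le ⟨hz, mem_extChartAt_source z⟩)

omit [IsManifold (cornerModel n) ∞ X] in
-- Tangent vectors at `x` are by construction represented in the preferred chart at `x`.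
theorem tangentCoords_eq_id (x : X) : tangentCoords n x = ContinuousLinearMap.id ℝ (Euc n) :=
  (hasMFDerivAt_extChartAt_self (cornerModel n) x).mfderiv

omit [IsManifold (cornerModel n) ∞ X] in
theorem mem_innerTangent {x : X} {v : Euc n} :
    v ∈ innerTangent n x ↔ v ∈ innerCone (extChartAt (cornerModel n) x x) := by
  simp only [innerTangent, tangentCoords_eq_id]
  rfl

/-- Coordinates of a frame at `x` in the chart around `y`. -/
def frameCoords (y x : X) (A : Euc n →L[ℝ] Euc n) : Euc n →L[ℝ] Euc n :=
  (tangentCoordChange (cornerModel n) x y x).comp A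

theorem bijective_frameCoords {x y : X} (hx : x ∈ (extChartAt (cornerModel n) y).source)
    {A : Euc n →L[ℝ] Euc n} (hA : Function.Bijective A) :
    Function.Bijective (frameCoords y x A) := by
  have hz := (⟨mem_extChartAt_source x, hx⟩ : x ∈ (extChartAt (cornerModel n) x).source ∩ _)
  refine Function.Bijective.comp (g := tangentCoordChange (cornerModel n) x y x) ?_ hA
  exact Function.bijective_iff_has_inverse.2 ⟨tangentCoordChange (cornerModel n) y x x,
    tangentCoordChange_symm hz.symm, tangentCoordChange_symm hz⟩

theorem image_frameCoords {x y : X} (hx : x ∈ (extChartAt (cornerModel n) y).source)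
    {A : Euc n →L[ℝ] Euc n} (hA : IsInnerFrame n x A) :
    frameCoords y x A '' quadrantSet n (cornerIndex n x) =
      innerCone (extChartAt (cornerModel n) y x) := by
  have hz := (⟨mem_extChartAt_source x, hx⟩ : x ∈ (extChartAt (cornerModel n) x).source ∩ _)
  have h1 : frameCoords y x A '' quadrantSet n (cornerIndex n x) =
      tangentCoordChange (cornerModel n) x y x '' (A '' quadrantSet n (cornerIndex n x)) := by
    rw [← image_comp]; rfl
  have h2 := hA.2
  rw [h1]
  ext v
  constructor
  · rintro ⟨w, hw, rfl⟩
    exact tangentCoordChange_mem_innerCone hz (mem_innerTangent.1 (h2 ▸ hw))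
  · intro hv
    refine ⟨tangentCoordChange (cornerModel n) y x x v, ?_, tangentCoordChange_symm hz v⟩
    have := tangentCoordChange_mem_innerCone hz.symm hv
    rw [← mem_innerTangent] at this
    exact h2.symm ▸ this

/-- The coordinates of an element of `Hom(ℝⁿ, TX)` in the trivialization around `y`. -/
theorem trivializationAt_homBundle_apply {y : X} {v : HomBundle n X}
    (hv : v.proj ∈ (extChartAt (cornerModel n) y).source) :
    trivializationAt (Euc n →L[ℝ] Euc n)
      (fun x : X => Bundle.Trivial X (Euc n) x →L[ℝ] TangentSpace (cornerModel n) x) y v =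
      (v.proj, frameCoords y v.proj v.snd) := by
  rw [hom_trivializationAt_apply]
  refine Prod.ext rfl ?_
  ext1 w
  rw [extChartAt_source] at hv
  simp only [ContinuousLinearMap.inCoordinates, ContinuousLinearMap.comp_apply, frameCoords]
  rw [TangentBundle.continuousLinearMapAt_trivializationAt_eq_core hv]
  simp
  rfl

/-- Continuity is read in the trivialization around `y`, whose fibre component is `frameCoords`. -/
theorem continuousAt_homBundle_iff {D : Type*} [TopologicalSpace D] {v : D → HomBundle n X}
    {d : D} {y : X} (hv : (v d).proj ∈ (extChartAt (cornerModel n) y).source) :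
    ContinuousAt v d ↔ ContinuousAt (fun d => (v d).proj) d ∧
      ContinuousAt (fun d => frameCoords y (v d).proj (v d).snd) d := by
  set τ := trivializationAt (Euc n →L[ℝ] Euc n)
      (fun x : X => Bundle.Trivial X (Euc n) x →L[ℝ] TangentSpace (cornerModel n) x) y
  have hsrc : ∀ w : HomBundle n X, w.proj ∈ (extChartAt (cornerModel n) y).source →
      w ∈ τ.source := by
    intro w hw
    rw [extChartAt_source] at hw
    simpa [τ] using hw
  have hev : ContinuousAt (fun d => (v d).proj) d →
      (fun d => τ (v d)) =ᶠ[𝓝 d] fun d => ((v d).proj, frameCoords y (v d).proj (v d).snd) := by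
    intro h
    filter_upwards [h.eventually ((isOpen_extChartAt_source y).mem_nhds hv)] with d' hd'
    exact trivializationAt_homBundle_apply hd'
  constructor
  · intro h
    have h0 : ContinuousAt (fun d => (v d).proj) d :=
      (FiberBundle.continuous_proj (Euc n →L[ℝ] Euc n) (fun x : X =>
        Bundle.Trivial X (Euc n) x →L[ℝ] TangentSpace (cornerModel n) x)).continuousAt.comp h
    refine ⟨h0, ?_⟩
    have h1 : ContinuousAt (fun d => τ (v d)) d :=
      ContinuousAt.comp (τ.continuousAt (hsrc _ hv)) h
    exact (h1.congr (hev h0)).snd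
  · rintro ⟨h0, h1⟩
    have h2 : ContinuousAt (fun d => τ (v d)) d := (h0.prodMk h1).congr (hev h0).symm
    refine (τ.toOpenPartialHomeomorph.continuousAt_iff_continuousAt_comp_left (f := v) ?_).2 h2
    exact h0.eventually ((isOpen_extChartAt_source y).mem_nhds hv) |>.mono fun d' h => hsrc _ h

end Index

end

noncomputable section

/-! ### Families of smooth maps from a quadrant to a manifold with corners -/

section QuadrantFamilies

open Filter

variable {n q : ℕ} {X : Type*} [TopologicalSpace X] [ChartedSpace (EuclideanQuadrant n) X]
  {D : Type*} [TopologicalSpace D]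

theorem quadrantModel_symm_coe (w : Quadrant n q) : (quadrantModel n q).symm w.1 = w :=
  (quadrantModel n q).left_inv w

theorem coe_quadrantModel_symm {u : Euc n} (hu : u ∈ quadrantSet n q) :
    ((quadrantModel n q).symm u).1 = u := quadrantProj_of_mem hu

/-- Translates between the quadrant as a space, used for maps to `X`, and as a subset of `ℝⁿ`, used
for derivatives. -/
theorem nhdsWithin_quadrant_eq_map (d : D) (w : Quadrant n q) :
    𝓝[univ ×ˢ quadrantSet n q] (d, w.1) =
      map (fun p : D × Quadrant n q => (p.1, p.2.1)) (𝓝 (d, w)) := by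
  rw [nhdsWithin_prod_eq, nhdsWithin_univ, ← map_nhds_subtype_val, nhds_prod_eq]
  exact Filter.prod_map_right _ _ _

theorem eventually_quadrant_iff {d : D} {w : Quadrant n q} {P : D × Euc n → Prop} :
    (∀ᶠ p in 𝓝[univ ×ˢ quadrantSet n q] (d, w.1), P p) ↔ ∀ᶠ p in 𝓝 (d, w), P (p.1, p.2.1) := by
  rw [nhdsWithin_quadrant_eq_map]
  rfl

omit [ChartedSpace (EuclideanQuadrant n) X] in
theorem continuousAt_of_extend {Y : Type*} [TopologicalSpace Y] {f : Y → X} {y : Y}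
    (e : OpenPartialHomeomorph X (EuclideanQuadrant n)) (h : ∀ᶠ z in 𝓝 y, f z ∈ e.source)
    (hc : ContinuousAt (fun z => e.extend (cornerModel n) (f z)) y) : ContinuousAt f y := by
  rw [e.continuousAt_iff_continuousAt_comp_left h,
    (cornerModel n).isClosedEmbedding.isInducing.continuousAt_iff]
  exact hc

variable [IsManifold (cornerModel n) ∞ X]

omit [IsManifold (cornerModel n) ∞ X] in
theorem contMDiffAt_quadrant_iff {φ : Quadrant n q → X} {w : Quadrant n q}
    {e : OpenPartialHomeomorph X (EuclideanQuadrant n)}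
    (he : e ∈ IsManifold.maximalAtlas (cornerModel n) ∞ X) (hw : φ w ∈ e.source) :
    ContMDiffAt (quadrantModel n q) (cornerModel n) ∞ φ w ↔ ContinuousAt φ w ∧
      ContDiffWithinAt ℝ ∞ (fun u => e.extend (cornerModel n) (φ ((quadrantModel n q).symm u)))
        (quadrantSet n q) w.1 := by
  rw [← contMDiffWithinAt_univ, contMDiffWithinAt_iff_of_mem_maximalAtlas' he hw,
    continuousWithinAt_univ, preimage_univ, univ_inter, range_quadrantModel]
  rfl

/-- The family `G d`, `d ∈ D`, of maps from a quadrant to `X` is smooth near `p`, and all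
derivatives are jointly continuous at `p`. -/
structure SmoothMapFamilyAt (G : D → Quadrant n q → X) (p : D × Quadrant n q) : Prop where
  cont : ContinuousAt (fun p' : D × Quadrant n q => G p'.1 p'.2) p
  smooth : SmoothFamilyAt
    (fun d u => extChartAt (cornerModel n) (G p.1 p.2) (G d ((quadrantModel n q).symm u)))
    (quadrantSet n q) (p.1, p.2.1)

variable {G : D → Quadrant n q → X} {p : D × Quadrant n q}

omit [IsManifold (cornerModel n) ∞ X] in
-- The coordinate change is smooth and independent of the parameter, so the composition rule for
-- families applies. The condition is thus independent of the chart.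
theorem smoothFamilyAt_extend_of_extend {e e' : OpenPartialHomeomorph X (EuclideanQuadrant n)}
    (he : e ∈ IsManifold.maximalAtlas (cornerModel n) ∞ X)
    (he' : e' ∈ IsManifold.maximalAtlas (cornerModel n) ∞ X)
    (hp : G p.1 p.2 ∈ e.source) (hp' : G p.1 p.2 ∈ e'.source)
    (hc : ContinuousAt (fun p' : D × Quadrant n q => G p'.1 p'.2) p)
    (h : SmoothFamilyAt (fun d u => e.extend (cornerModel n) (G d ((quadrantModel n q).symm u)))
      (quadrantSet n q) (p.1, p.2.1)) :
    SmoothFamilyAt (fun d u => e'.extend (cornerModel n) (G d ((quadrantModel n q).symm u)))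
      (quadrantSet n q) (p.1, p.2.1) := by
  have hS := uniqueDiffOn_quadrantSet n q
  have hs : ((cornerModel n).extendCoordChange e e').source ∈
      𝓝[range (cornerModel n)] (e.extend (cornerModel n) (G p.1 p.2)) :=
    (cornerModel n).extendCoordChange_source_mem_nhdsWithin' hp hp'
  have htr : SmoothFamilyAt (fun _ : D => ((cornerModel n).extendCoordChange e e'))
      (range (cornerModel n))
      (p.1, e.extend (cornerModel n) (G p.1 ((quadrantModel n q).symm p.2.1))) := by
    refine SmoothFamilyAt.of_contDiffWithinAt (cornerModel n).uniqueDiffOn ?_ (mem_range_self _)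
    rw [quadrantModel_symm_coe]
    filter_upwards [hs] with y hy
    exact (cornerModel n).contDiffWithinAt_extendCoordChange he he' hy
  refine (SmoothFamilyAt.comp hS (cornerModel n).uniqueDiffOn p.2.2 htr h
    (Eventually.of_forall fun _ => mem_range_self _)).congr p.2.2 ?_
  rw [eventually_quadrant_iff (P := fun p' => e'.extend (cornerModel n)
    (G p'.1 ((quadrantModel n q).symm p'.2)) = (cornerModel n).extendCoordChange e e'
      (e.extend (cornerModel n) (G p'.1 ((quadrantModel n q).symm p'.2))))]
  filter_upwards [hc.eventually (e.open_source.mem_nhds hp)] with p' hp'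
  rw [quadrantModel_symm_coe]
  simp only [ModelWithCorners.extendCoordChange, PartialEquiv.coe_trans, Function.comp_apply]
  rw [e.extend_left_inv hp']

namespace SmoothMapFamilyAt

theorem extend (h : SmoothMapFamilyAt G p) {e : OpenPartialHomeomorph X (EuclideanQuadrant n)}
    (he : e ∈ IsManifold.maximalAtlas (cornerModel n) ∞ X) (hp : G p.1 p.2 ∈ e.source) :
    SmoothFamilyAt (fun d u => e.extend (cornerModel n) (G d ((quadrantModel n q).symm u)))
      (quadrantSet n q) (p.1, p.2.1) :=
  smoothFamilyAt_extend_of_extend (IsManifold.chart_mem_maximalAtlas _) he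
    (mem_chart_source _ _) hp h.cont h.smooth

theorem of_extend {e : OpenPartialHomeomorph X (EuclideanQuadrant n)}
    (he : e ∈ IsManifold.maximalAtlas (cornerModel n) ∞ X)
    (hp : ∀ᶠ p' in 𝓝 p, G p'.1 p'.2 ∈ e.source)
    (h : SmoothFamilyAt (fun d u => e.extend (cornerModel n) (G d ((quadrantModel n q).symm u)))
      (quadrantSet n q) (p.1, p.2.1)) : SmoothMapFamilyAt G p := by
  have hc : ContinuousAt (fun p' : D × Quadrant n q => G p'.1 p'.2) p := by
    refine continuousAt_of_extend e hp ?_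
    have := h.continuousWithinAt
    rw [ContinuousWithinAt, nhdsWithin_quadrant_eq_map, tendsto_map'_iff] at this
    refine (this.congr fun p' => ?_).trans_eq ?_
    · simp only [Function.comp_apply, quadrantModel_symm_coe]
    · simp only [quadrantModel_symm_coe]
  exact ⟨hc, smoothFamilyAt_extend_of_extend he (IsManifold.chart_mem_maximalAtlas _)
    hp.self_of_nhds (mem_chart_source _ _) hc h⟩

omit [IsManifold (cornerModel n) ∞ X] in
theorem congr {G' : D → Quadrant n q → X} (h : SmoothMapFamilyAt G p)
    (he : ∀ᶠ p' in 𝓝 p, G' p'.1 p'.2 = G p'.1 p'.2) : SmoothMapFamilyAt G' p := by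
  refine ⟨h.cont.congr (he.mono fun _ h => h.symm), ?_⟩
  rw [he.self_of_nhds]
  refine h.smooth.congr p.2.2 (eventually_quadrant_iff.2 ?_)
  filter_upwards [he] with p' hp'
  simp only [quadrantModel_symm_coe, hp']

theorem contMDiffAt (h : SmoothMapFamilyAt G p) :
    ∀ᶠ p' in 𝓝 p, ContMDiffAt (quadrantModel n q) (cornerModel n) ∞ (G p'.1) p'.2 := by
  have hs := h.cont.eventually ((chartAt _ (G p.1 p.2)).open_source.mem_nhds
    (mem_chart_source (EuclideanQuadrant n) (G p.1 p.2)))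
  have h1 := eventually_quadrant_iff.1 h.smooth.smooth
  filter_upwards [h1, hs.eventually_nhds] with p' h2 h3
  have h4 : ∀ᶠ w in 𝓝 p'.2, G p'.1 w ∈ (chartAt (EuclideanQuadrant n) (G p.1 p.2)).source :=
    (Continuous.tendsto (f := fun w => (p'.1, w)) (by fun_prop) p'.2).eventually h3
  refine (contMDiffAt_quadrant_iff (IsManifold.chart_mem_maximalAtlas _) h3.self_of_nhds).2
    ⟨continuousAt_of_extend _ h4 ?_, h2⟩
  have h5 := h2.continuousWithinAt
  rw [ContinuousWithinAt, ← map_nhds_subtype_val, tendsto_map'_iff] at h5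
  refine (h5.congr fun w => ?_).trans_eq ?_
  · simp only [Function.comp_apply, quadrantModel_symm_coe]; rfl
  · simp only [quadrantModel_symm_coe]; rfl

end SmoothMapFamilyAt

/-- The derivative at the origin, read in the chart around `y`. -/
theorem fderivWithin_extChartAt_eq_frameCoords {φ : Quadrant n q → X} {y : X}
    (hφ : MDifferentiableAt (quadrantModel n q) (cornerModel n) φ 0)
    (hy : φ 0 ∈ (extChartAt (cornerModel n) y).source) :
    fderivWithin ℝ (fun u => extChartAt (cornerModel n) y (φ ((quadrantModel n q).symm u)))
      (quadrantSet n q) 0 =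
    frameCoords y (φ 0) (mfderiv (quadrantModel n q) (cornerModel n) φ 0) := by
  have h1 : HasMFDerivAt (cornerModel n) 𝓘(ℝ, Euc n) (extChartAt (cornerModel n) y) (φ 0)
      (tangentCoordChange (cornerModel n) (φ 0) y (φ 0)) :=
    ⟨continuousAt_extChartAt' hy,
      hasFDerivWithinAt_tangentCoordChange ⟨mem_extChartAt_source _, hy⟩⟩
  have h2 : HasFDerivWithinAt
      (fun u => extChartAt (cornerModel n) y (φ ((quadrantModel n q).symm u)))
      (frameCoords y (φ 0) (mfderiv (quadrantModel n q) (cornerModel n) φ 0))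
      (range (quadrantModel n q)) (0 : Euc n) := (h1.comp (0 : Quadrant n q) hφ.hasMFDerivAt).2
  rw [range_quadrantModel] at h2
  exact h2.fderivWithin (uniqueDiffOn_quadrantSet n q _ (zero_mem_quadrantSet n q))

/-- The first-order jet at the origin. -/
def originJet (φ : Quadrant n q → X) : HomBundle n X :=
  ⟨φ 0, mfderiv (quadrantModel n q) (cornerModel n) φ 0⟩

/-- In the fixed chart around `G d 0`, the frame coordinates of the jets are first derivatives at
the origin, which are continuous in the parameter. -/
theorem SmoothMapFamilyAt.continuousAt_originJet {d : D} (h : SmoothMapFamilyAt G (d, 0)) :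
    ContinuousAt (fun d => originJet (G d)) d := by
  have hk : Continuous fun d' : D => (d', (0 : Quadrant n q)) := by fun_prop
  refine (continuousAt_homBundle_iff (y := G d 0) (mem_extChartAt_source _)).2 ⟨?_, ?_⟩
  · exact ContinuousAt.comp (f := fun d' => (d', (0 : Quadrant n q))) h.cont hk.continuousAt
  · have h1 := h.smooth.continuousWithinAt_fderivWithin (uniqueDiffOn_quadrantSet n q)
      (zero_mem_quadrantSet n q)
    rw [ContinuousWithinAt, nhdsWithin_quadrant_eq_map, tendsto_map'_iff] at h1
    have h2 := h1.comp (hk.tendsto d)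
    have h3 : ∀ᶠ d' in 𝓝 d, fderivWithin ℝ
        (fun u => extChartAt (cornerModel n) (G d 0) (G d' ((quadrantModel n q).symm u)))
        (quadrantSet n q) 0 = frameCoords (G d 0) (originJet (G d')).proj (originJet (G d')).snd := by
      filter_upwards [(hk.tendsto d).eventually h.contMDiffAt, (hk.tendsto d).eventually
        (h.cont.eventually ((isOpen_extChartAt_source (I := cornerModel n) (G d 0)).mem_nhds
          (mem_extChartAt_source _)))]
        with d' h4 h5
      exact fderivWithin_extChartAt_eq_frameCoords (h4.mdifferentiableAt (by simp)) h5
    rw [ContinuousAt, ← h3.self_of_nhds]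
    exact h2.congr' h3

end QuadrantFamilies

/-! ### Continuous families in the weak topology -/

section WeakTopology

open Filter

variable {n : ℕ} {X : Type*} [TopologicalSpace X] [ChartedSpace (EuclideanQuadrant n) X]
  {D : Type*} [TopologicalSpace D] [IsManifold (cornerModel n) ∞ X] {ι : Type*} {q : ι → ℕ}

omit [IsManifold (cornerModel n) ∞ X] in
theorem continuousAt_chartDeriv (f : SmoothMaps n X q) (j : ι) {w : Quadrant n (q j)}
    {e : OpenPartialHomeomorph X (EuclideanQuadrant n)}
    (he : e ∈ IsManifold.maximalAtlas (cornerModel n) ∞ X) (hw : f.1 ⟨j, w⟩ ∈ e.source) (k : ℕ) :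
    ContinuousAt (fun v : Quadrant n (q j) => chartDeriv n e k f.1 j v) w := by
  have h := ((contMDiffAt_quadrant_iff (φ := fun v => f.1 ⟨j, v⟩) he hw).1 (f.2 j w)).2
  have h1 := h.continuousWithinAt_iteratedFDerivWithin (k := k) (uniqueDiffOn_quadrantSet n (q j))
    (by exact_mod_cast le_top) w.2
  rwa [ContinuousWithinAt, ← map_nhds_subtype_val, tendsto_map'_iff] at h1

/-- On a compact neighbourhood of `w`, subbasic sets centred at `g d` itself make the derivatives of
`g d'` uniformly close to those of `g d`. Together with continuity of the latter in the point, this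
gives joint continuity. -/
theorem smoothMapFamilyAt_of_continuousAt {g : D → SmoothMaps n X q} {d : D}
    (hg : ContinuousAt g d) (j : ι) (w : Quadrant n (q j)) :
    SmoothMapFamilyAt (fun d v => (g d).1 ⟨j, v⟩) (d, w) := by
  set e := chartAt (EuclideanQuadrant n) ((g d).1 ⟨j, w⟩) with he
  have hem : e ∈ IsManifold.maximalAtlas (cornerModel n) ∞ X := IsManifold.chart_mem_maximalAtlas _
  have hw : (g d).1 ⟨j, w⟩ ∈ e.source := mem_chart_source _ _
  have hcont : ContinuousAt (fun v => (g d).1 ⟨j, v⟩) w := ((g d).2 j).continuous.continuousAt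
  have : LocallyCompactSpace (Quadrant n (q j)) := (quadrantModel n (q j)).locallyCompactSpace
  obtain ⟨K, ⟨hKw, hKc⟩, hKe⟩ := (compact_basis_nhds w).mem_iff.1
    (hcont.preimage_mem_nhds (e.open_source.mem_nhds hw))
  have hN : ∀ (r : ℕ) (ε : ℝ), 0 < ε → ∀ᶠ d' in 𝓝 d, ∀ v ∈ K, (g d').1 ⟨j, v⟩ ∈ e.source ∧
      ∀ k ≤ r, ‖chartDeriv n e k (g d').1 j v - chartDeriv n e k (g d).1 j v‖ < ε := by
    intro r ε hε
    have ho : IsOpen {f : SmoothMaps n X q | ∀ v ∈ K, f.1 ⟨j, v⟩ ∈ e.source ∧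
        ∀ k ≤ r, ‖chartDeriv n e k f.1 j v - chartDeriv n e k (g d).1 j v‖ < ε} :=
      TopologicalSpace.isOpen_generateFrom_of_mem
        ⟨g d, e, j, K, r, ε, hem, hKc, hε, fun v hv => hKe hv, rfl⟩
    refine hg.eventually (ho.mem_nhds ?_)
    exact fun v hv => ⟨hKe hv, fun k _ => by simpa using hε⟩
  have hK : ∀ᶠ p in 𝓝 (d, w), p.2 ∈ K := continuousAt_snd.eventually hKw
  have hsrc : ∀ᶠ p in 𝓝 (d, w), (g p.1).1 ⟨j, p.2⟩ ∈ e.source := by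
    filter_upwards [continuousAt_fst.eventually (hN 0 1 one_pos), hK] with p h1 h2
      using (h1 _ h2).1
  have hder : ∀ k, Tendsto (fun p : D × Quadrant n (q j) => chartDeriv n e k (g p.1).1 j p.2)
      (𝓝 (d, w)) (𝓝 (chartDeriv n e k (g d).1 j w)) := by
    intro k
    have h1 : Tendsto (fun p : D × Quadrant n (q j) => chartDeriv n e k (g d).1 j p.2)
        (𝓝 (d, w)) (𝓝 (chartDeriv n e k (g d).1 j w)) :=
      (continuousAt_chartDeriv (g d) j hem hw k).tendsto.comp continuousAt_snd
    have h2 : Tendsto (fun p : D × Quadrant n (q j) => chartDeriv n e k (g p.1).1 j p.2 -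
        chartDeriv n e k (g d).1 j p.2) (𝓝 (d, w)) (𝓝 0) := by
      rw [Metric.tendsto_nhds]
      intro ε hε
      filter_upwards [continuousAt_fst.eventually (hN k ε hε), hK] with p h3 h4
      rw [dist_zero_right]
      exact (h3 _ h4).2 k le_rfl
    simpa using h2.add h1
  refine SmoothMapFamilyAt.of_extend hem hsrc ⟨?_, fun k => ?_⟩
  · refine eventually_quadrant_iff.2 ?_
    filter_upwards [hsrc] with p hp
    exact ((contMDiffAt_quadrant_iff (φ := fun v => (g p.1).1 ⟨j, v⟩) hem hp).1
      ((g p.1).2 j p.2)).2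
  · rw [ContinuousWithinAt, nhdsWithin_quadrant_eq_map, tendsto_map'_iff]
    exact hder k

/-- Joint continuity makes the strict inequalities of a subbasic set hold near each `(d, v)`.
Compactness of `K` yields a neighbourhood of `d` that serves all `v ∈ K` at once. -/
theorem continuousAt_of_smoothMapFamilyAt {g : D → SmoothMaps n X q} {d : D}
    (h : ∀ j w, SmoothMapFamilyAt (fun d v => (g d).1 ⟨j, v⟩) (d, w)) : ContinuousAt g d := by
  refine TopologicalSpace.tendsto_nhds_generateFrom_iff.2 ?_
  rintro _ ⟨f, e, j, K, r, ε, he, hK, hε, hf, rfl⟩ hgd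
  refine IsCompact.eventually_forall_of_forall_eventually hK fun v hv => ?_
  obtain ⟨hs, hd⟩ := hgd v hv
  refine ((h j v).cont.eventually (e.open_source.mem_nhds hs)).and ?_
  refine (eventually_all_finite (Set.finite_le_nat r)).2 fun k hk => ?_
  have h1 := ((h j v).extend he hs).cont k
  rw [ContinuousWithinAt, nhdsWithin_quadrant_eq_map, tendsto_map'_iff] at h1
  have h2 : Tendsto (fun p : D × Quadrant n (q j) => chartDeriv n e k f.1 j p.2)
        (𝓝 (d, v)) (𝓝 (chartDeriv n e k f.1 j v)) :=
      (continuousAt_chartDeriv f j he (hf v hv) k).tendsto.comp continuousAt_snd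
  exact (h1.sub h2).norm.eventually (gt_mem_nhds (hd k hk))

end WeakTopology

end

noncomputable section

/-! ### Linear coordinates adapted to a continuous family of inner frames -/

section Straightening

open Filter

theorem eventually_slice_iff_exists_ball {D E : Type*} [TopologicalSpace D] [NormedAddCommGroup E]
    {S : Set E} {d : D} {P : D × E → Prop} :
    (∀ᶠ p in 𝓝[univ ×ˢ S] (d, (0 : E)), P p) ↔
      ∃ r > 0, ∀ᶠ d' in 𝓝 d, ∀ u ∈ S ∩ Metric.ball 0 r, P (d', u) := by
  rw [nhdsWithin_prod_eq, nhdsWithin_univ, Filter.eventually_prod_iff]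
  constructor
  · rintro ⟨pa, ha, pb, hb, h⟩
    obtain ⟨r, hr, hrb⟩ := Metric.mem_nhdsWithin_iff.1 hb
    exact ⟨r, hr, ha.mono fun d' hd' u hu => h hd' (hrb ⟨hu.2, hu.1⟩)⟩
  · rintro ⟨r, hr, h⟩
    refine ⟨_, h, fun u => u ∈ S ∩ Metric.ball 0 r, ?_, fun hx _ hy => hx _ hy⟩
    exact inter_mem self_mem_nhdsWithin (mem_nhdsWithin_of_mem_nhds (Metric.ball_mem_nhds _ hr))

variable {n : ℕ} {X : Type*} [TopologicalSpace X] [ChartedSpace (EuclideanQuadrant n) X]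
  [IsManifold (cornerModel n) ∞ X]

theorem homBundle_ext {v w : HomBundle n X} (h : v.proj = w.proj)
    (h' : (v.snd : Euc n →L[ℝ] Euc n) = w.snd) : v = w := by
  obtain ⟨x, A⟩ := v
  obtain ⟨x', A'⟩ := w
  obtain rfl : x = x' := h
  obtain rfl : A = A' := h'
  rfl

theorem homBundle_ext_frameCoords {v w : HomBundle n X} {y : X}
    (hy : v.proj ∈ (extChartAt (cornerModel n) y).source) (h : w.proj = v.proj)
    (h' : frameCoords y w.proj w.snd = frameCoords y v.proj v.snd) : w = v := by
  refine homBundle_ext h ?_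
  rw [h] at h'
  ext1 u
  have h2 := congrArg (tangentCoordChange (cornerModel n) y v.proj v.proj)
    (congrArg (fun L : Euc n →L[ℝ] Euc n => L u) h')
  have hz := (⟨mem_extChartAt_source v.proj, hy⟩ :
    v.proj ∈ (extChartAt (cornerModel n) v.proj).source ∩ _)
  exact (tangentCoordChange_symm hz.symm _).symm.trans (h2.trans (tangentCoordChange_symm hz.symm _))

/-- The affine coordinates `u ↦ a + M u` in the chart around `y` identify a neighbourhood of the
origin in a quadrant with an open set of `X`, compatibly with the stratum `K`. -/
structure IsStraight (K : Stratum n X) (y : X) (a : Euc n) (M : Euc n →L[ℝ] Euc n) (r : ℝ) :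
    Prop where
  equiv : ∃ e : Euc n ≃L[ℝ] Euc n, (e : Euc n →L[ℝ] Euc n) = M
  target : ∀ u ∈ quadrantSet n K.index ∩ Metric.ball 0 r,
    a + M u ∈ (extChartAt (cornerModel n) y).target
  inv_mem : ∀ z : X, ContinuousLinearMap.inverse M (extChartAt (cornerModel n) y z - a) ∈
    quadrantSet n K.index
  carrier : ∀ u ∈ quadrantSet n K.index ∩ Metric.ball 0 r,
    (∀ i : Fin n, n ≤ i.val + K.index → u i = 0) →
    (extChartAt (cornerModel n) y).symm (a + M u) ∈ K.carrier

namespace IsStraight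

variable {K : Stratum n X} {y : X} {a : Euc n} {M : Euc n →L[ℝ] Euc n} {r : ℝ}

omit [IsManifold (cornerModel n) ∞ X] in
theorem inverse_apply (h : IsStraight K y a M r) (u : Euc n) :
    ContinuousLinearMap.inverse M (M u) = u := by
  obtain ⟨e, rfl⟩ := h.equiv
  simp

omit [IsManifold (cornerModel n) ∞ X] in
theorem apply_inverse (h : IsStraight K y a M r) (u : Euc n) :
    M (ContinuousLinearMap.inverse M u) = u := by
  obtain ⟨e, rfl⟩ := h.equiv
  simp

end IsStraight

variable {D : Type*} [TopologicalSpace D]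

/-- A map into the Hom-bundle takes values in inner frames over the stratum `K`. -/
def IsFrameFamily (K : Stratum n X) (v : D → HomBundle n X) : Prop :=
  Continuous v ∧ ∀ d, (v d).proj ∈ K.carrier ∧ IsInnerFrame n (v d).proj (v d).snd

/-- The base points of a family of frames in the chart around `y`. -/
def baseCoords (v : D → HomBundle n X) (y : X) (d : D) : Euc n :=
  extChartAt (cornerModel n) y (v d).proj

/-- The family of frames in the chart around `y`. -/
def matrixCoords (v : D → HomBundle n X) (y : X) (d : D) : Euc n →L[ℝ] Euc n :=
  frameCoords y (v d).proj (v d).snd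

namespace IsFrameFamily

variable {K : Stratum n X} {v : D → HomBundle n X}

theorem continuous_proj (hv : IsFrameFamily K v) : Continuous fun d => (v d).proj :=
  (FiberBundle.continuous_proj (Euc n →L[ℝ] Euc n) (fun x : X =>
    Bundle.Trivial X (Euc n) x →L[ℝ] TangentSpace (cornerModel n) x)).comp hv.1

theorem eventually_mem_source (hv : IsFrameFamily K v) {d : D} {y : X}
    (hy : (v d).proj ∈ (extChartAt (cornerModel n) y).source) :
    ∀ᶠ d' in 𝓝 d, (v d').proj ∈ (extChartAt (cornerModel n) y).source :=
  hv.continuous_proj.continuousAt.eventually ((isOpen_extChartAt_source y).mem_nhds hy)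

theorem continuousAt_baseCoords (hv : IsFrameFamily K v) {d : D} {y : X}
    (hy : (v d).proj ∈ (extChartAt (cornerModel n) y).source) :
    ContinuousAt (baseCoords v y) d :=
  ContinuousAt.comp (f := fun d => (v d).proj) (continuousAt_extChartAt' hy)
    hv.continuous_proj.continuousAt

theorem continuousAt_matrixCoords (hv : IsFrameFamily K v) {d : D} {y : X}
    (hy : (v d).proj ∈ (extChartAt (cornerModel n) y).source) :
    ContinuousAt (matrixCoords v y) d :=
  ((continuousAt_homBundle_iff hy).1 hv.1.continuousAt).2

theorem exists_equiv (hv : IsFrameFamily K v) {d : D} {y : X}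
    (hy : (v d).proj ∈ (extChartAt (cornerModel n) y).source) :
    ∃ e : Euc n ≃L[ℝ] Euc n, (e : Euc n →L[ℝ] Euc n) = matrixCoords v y d := by
  have hb : Function.Bijective (matrixCoords v y d) := bijective_frameCoords hy (hv.2 d).2.1
  exact ⟨(LinearEquiv.ofBijective (matrixCoords v y d).toLinearMap hb).toContinuousLinearEquiv,
    by ext; rfl⟩

theorem image_matrixCoords (hv : IsFrameFamily K v) {d : D} {y : X}
    (hy : (v d).proj ∈ (extChartAt (cornerModel n) y).source) :
    matrixCoords v y d '' quadrantSet n K.index = innerCone (baseCoords v y d) := by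
  have := image_frameCoords hy (hv.2 d).2
  rwa [K.cornerIndex_eq (hv.2 d).1] at this

theorem ncard_baseCoords (hv : IsFrameFamily K v) {d : D} {y : X}
    (hy : (v d).proj ∈ (extChartAt (cornerModel n) y).source) :
    {i : Fin n | baseCoords v y d i = 0}.ncard = K.index :=
  (ncard_zeros_eq_cornerIndex hy).trans (K.cornerIndex_eq (hv.2 d).1)

theorem continuousAt_inverse (hv : IsFrameFamily K v) {d : D} {y : X}
    (hy : (v d).proj ∈ (extChartAt (cornerModel n) y).source) :
    ContinuousAt (fun d => ContinuousLinearMap.inverse (matrixCoords v y d)) d := by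
  obtain ⟨e, he⟩ := hv.exists_equiv hy
  have h1 : ContinuousAt (ContinuousLinearMap.inverse : (Euc n →L[ℝ] Euc n) → _)
      (matrixCoords v y d) := by
    rw [← he]
    exact (contDiffAt_map_inverse (𝕜 := ℝ) (n := 0) e).continuousAt
  exact ContinuousAt.comp (f := matrixCoords v y) h1 (hv.continuousAt_matrixCoords hy)

/-- Chart coordinates positive at the base point stay positive nearby. The vanishing ones are
controlled because an inner frame carries the quadrant exactly onto the inner cone. The radius can
be uniform since the set of vanishing coordinates is locally constant in the parameter. -/
theorem exists_isStraight (hv : IsFrameFamily K v) {d : D} {y : X}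
    (hy : (v d).proj ∈ (extChartAt (cornerModel n) y).source) :
    ∃ r > 0, ∀ᶠ d' in 𝓝 d, IsStraight K y (baseCoords v y d') (matrixCoords v y d') r := by
  set S := quadrantSet n K.index
  set a := baseCoords v y
  set M := matrixCoords v y
  have hpos : ∀ d' i, 0 ≤ a d' i := fun d' i => extend_nonneg _ _ i
  -- Nearby, zeros can only be lost; as the number of zeros is always `K.index`, none is lost.
  have hzeros : ∀ᶠ d' in 𝓝 d, {i : Fin n | a d' i = 0} = {i : Fin n | a d i = 0} := by
    have h1 : ∀ᶠ d' in 𝓝 d, ∀ i : Fin n, a d i ≠ 0 → a d' i ≠ 0 := by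
      refine eventually_all.2 fun i => ?_
      by_cases hi : a d i = 0
      · exact Eventually.of_forall fun d' h => absurd hi h
      · have : ContinuousAt (fun d' => a d' i) d :=
          (PiLp.continuous_apply 2 _ i).continuousAt.comp (hv.continuousAt_baseCoords hy)
        exact (this.eventually_ne hi).mono fun d' h _ => h
    filter_upwards [h1, hv.eventually_mem_source hy] with d' h2 h3
    refine Set.eq_of_subset_of_ncard_le (fun i hi => ?_) ?_ (Set.toFinite _)
    · by_contra h4
      exact h2 i h4 hi
    · rw [hv.ncard_baseCoords hy, hv.ncard_baseCoords h3]
  have hcont : ContinuousWithinAt (fun p : D × Euc n => a p.1 + M p.1 p.2) (univ ×ˢ S) (d, 0) := by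
    have h1 : ContinuousAt (fun p : D × Euc n => a p.1) (d, 0) :=
      ContinuousAt.comp (f := Prod.fst) (hv.continuousAt_baseCoords hy) continuousAt_fst
    have h2 : ContinuousAt (fun p : D × Euc n => M p.1) (d, 0) :=
      ContinuousAt.comp (f := Prod.fst) (hv.continuousAt_matrixCoords hy) continuousAt_fst
    exact (h1.add (h2.clm_apply continuousAt_snd)).continuousWithinAt
  have h0 : a d + M d 0 = a d := by simp
  have hnear : ∀ᶠ p in 𝓝[univ ×ˢ S] (d, (0 : Euc n)), ∀ i : Fin n, a d i ≠ 0 →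
      0 < (a p.1 + M p.1 p.2) i := by
    refine eventually_all.2 fun i => ?_
    by_cases hi : a d i = 0
    · exact Eventually.of_forall fun d' h => absurd hi h
    · have h1 : ContinuousWithinAt (fun p : D × Euc n => (a p.1 + M p.1 p.2) i)
          (univ ×ˢ S) (d, 0) := (PiLp.continuous_apply 2 _ i).continuousAt.comp_continuousWithinAt
            hcont
      have h2 : 0 < (a d + M d 0) i := by
        rw [h0]
        exact lt_of_le_of_ne (hpos d i) (Ne.symm hi)
      exact (h1.eventually (lt_mem_nhds h2)).mono fun p h _ => h
  have htarget : ∀ᶠ p in 𝓝[univ ×ˢ S] (d, (0 : Euc n)), a p.1 + M p.1 p.2 ∈ range (cornerModel n) →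
      a p.1 + M p.1 p.2 ∈ (extChartAt (cornerModel n) y).target := by
    have h1 := extChartAt_target_mem_nhdsWithin' (I := cornerModel n) hy
    have h2 : ∀ᶠ u in 𝓝 (a d), u ∈ range (cornerModel n) →
        u ∈ (extChartAt (cornerModel n) y).target := by
      rw [← eventually_nhdsWithin_iff]
      exact h1
    exact hcont.eventually (h0.symm ▸ h2)
  obtain ⟨r, hr, hball⟩ := eventually_slice_iff_exists_ball.1 (hnear.and htarget)
  refine ⟨r, hr, ?_⟩
  filter_upwards [hball, hzeros, hv.eventually_mem_source hy] with d' h1 h2 h3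
  have hcone := hv.image_matrixCoords h3
  have hz : ∀ i, a d i = 0 ↔ a d' i = 0 := fun i => (Set.ext_iff.1 h2 i).symm
  have htar : ∀ u ∈ S ∩ Metric.ball 0 r, a d' + M d' u ∈ (extChartAt (cornerModel n) y).target := by
    intro u hu
    refine (h1 u hu).2 (mem_range_cornerModel.2 fun i => ?_)
    by_cases hi : a d i = 0
    · have h4 : M d' u ∈ innerCone (a d') := hcone ▸ mem_image_of_mem _ hu.1
      have h5 := h4 i ((hz i).1 hi)
      simp only [PiLp.add_apply, (hz i).1 hi, zero_add, h5]
    · exact ((h1 u hu).1 i hi).le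
  refine ⟨hv.exists_equiv h3, htar, ?_, ?_⟩
  · intro z
    -- Chart values are nonnegative everywhere, so their difference from the base point lies in the
    -- inner cone, which is the image of the quadrant. No condition on `z` is needed.
    have h4 : extChartAt (cornerModel n) y z - a d' ∈ innerCone (a d') := by
      intro i hi
      simpa [hi] using extend_nonneg (chartAt (EuclideanQuadrant n) y) z i
    rw [← hcone] at h4
    obtain ⟨u, hu, hMu⟩ := h4
    obtain ⟨e, he⟩ := hv.exists_equiv h3
    change ContinuousLinearMap.inverse (matrixCoords v y d') _ ∈ _
    have hMu : matrixCoords v y d' u = _ := hMu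
    rw [← hMu, ← he, ContinuousLinearMap.inverse_equiv]
    simpa using hu
  · intro u hu hu0
    -- `L` is the deepest stratum in the ball. It is connected and its image has constant index, so
    -- this image stays in the component containing the base point.
    set L : Set (Euc n) :=
      {u | ∀ i : Fin n, n ≤ i.val + K.index → u i = 0} ∩ Metric.ball 0 r with hL
    have hLS : L ⊆ S ∩ Metric.ball 0 r := fun w hw => ⟨fun i hi => (hw.1 i hi).ge, hw.2⟩
    set σ : Euc n → X := fun w => (extChartAt (cornerModel n) y).symm (a d' + M d' w) with hσ
    have hidx : ∀ w ∈ L, cornerIndex n (σ w) = K.index := by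
      intro w hw
      have h4 := htar w (hLS hw)
      have h5 := ncard_zeros_eq_cornerIndex ((extChartAt (cornerModel n) y).map_target h4)
      rw [(extChartAt (cornerModel n) y).right_inv h4] at h5
      rw [hσ]
      refine h5.symm.trans ?_
      rw [← hv.ncard_baseCoords h3]
      congr 1
      ext i
      simp only [mem_ofPred_eq]
      by_cases hi : a d i = 0
      · have h6 : M d' w ∈ innerCone (a d') := hcone ▸ mem_image_of_mem _ (hLS hw).1
        have h7 : M d' (-w) ∈ innerCone (a d') :=
          hcone ▸ mem_image_of_mem _ (fun i hi => by simp [hw.1 i hi])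
        have h8 := h6 i ((hz i).1 hi)
        have h9 := h7 i ((hz i).1 hi)
        rw [map_neg, PiLp.neg_apply] at h9
        have h10 : M d' w i = 0 := le_antisymm (neg_nonneg.1 h9) h8
        simp only [PiLp.add_apply, h10, add_zero]
        rfl
      · exact iff_of_false ((h1 w (hLS hw)).1 i hi).ne' (fun h => hi ((hz i).2 h))
    have hconv : Convex ℝ L := by
      refine Convex.inter (fun x hx w hw s t _ _ _ i hi => ?_) (convex_ball _ _)
      simp [hx i hi, hw i hi]
    have hσc : ContinuousOn σ L :=
      (continuousOn_extChartAt_symm y).comp (by fun_prop) fun w hw => htar w (hLS hw)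
    have h0L : (0 : Euc n) ∈ L := ⟨fun _ _ => rfl, Metric.mem_ball_self hr⟩
    have hσ0 : σ 0 = (v d').proj := by
      simp only [hσ, map_zero, add_zero]
      exact (extChartAt (cornerModel n) y).left_inv h3
    obtain ⟨x₀, hx₀, hK⟩ := K.isComponent
    have h11 : (v d').proj ∈ connectedComponentIn {z : X | cornerIndex n z = K.index} x₀ :=
      hK ▸ (hv.2 d').1
    have h12 := (hconv.isPreconnected.image σ hσc).subset_connectedComponentIn
      (F := {z : X | cornerIndex n z = K.index}) (mem_image_of_mem σ h0L) (by
        rintro _ ⟨w, hw, rfl⟩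
        exact hidx w hw)
    rw [hσ0, ← connectedComponentIn_eq h11, ← hK] at h12
    exact h12 (mem_image_of_mem σ ⟨hu0, hu.2⟩)

end IsFrameFamily

end Straightening

end

noncomputable section

/-! ### Germs of lifts -/

section GermLifts

open Filter

variable {n : ℕ} {X : Type*} [TopologicalSpace X] [ChartedSpace (EuclideanQuadrant n) X]
  {D : Type*} [TopologicalSpace D]

/-- A family of maps of quadrants that fix the origin to first order and preserve facets. -/
structure IsNearIdFamilyAt (q : ℕ) (ψ : D → Euc n → Euc n) (d : D) : Prop where
  family : ∀ᶠ p in 𝓝[univ ×ˢ quadrantSet n q] (d, (0 : Euc n)),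
    SmoothFamilyAt ψ (quadrantSet n q) p
  zero : ∀ᶠ d' in 𝓝 d, ψ d' 0 = 0
  deriv : ∀ᶠ d' in 𝓝 d, fderivWithin ℝ (ψ d') (quadrantSet n q) 0 =
    ContinuousLinearMap.id ℝ (Euc n)
  maps : ∀ᶠ p in 𝓝[univ ×ˢ quadrantSet n q] (d, (0 : Euc n)), ψ p.1 p.2 ∈ quadrantSet n q
  facets : ∀ᶠ p in 𝓝[univ ×ˢ quadrantSet n q] (d, (0 : Euc n)), ∀ i : Fin n,
    n ≤ i.val + q → p.2 i = 0 → ψ p.1 p.2 i = 0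

/-- The derivative is the identity at the origin and jointly continuous, hence within `1/4` of the
identity on a ball of uniform radius. -/
theorem eventually_isNearId {q : ℕ} {ψ : D → Euc n → Euc n} {d : D}
    (family : ∀ᶠ p in 𝓝[univ ×ˢ quadrantSet n q] (d, (0 : Euc n)),
      SmoothFamilyAt ψ (quadrantSet n q) p)
    (deriv : ∀ᶠ d' in 𝓝 d, fderivWithin ℝ (ψ d') (quadrantSet n q) 0 =
      ContinuousLinearMap.id ℝ (Euc n))
    (maps : ∀ᶠ p in 𝓝[univ ×ˢ quadrantSet n q] (d, (0 : Euc n)), ψ p.1 p.2 ∈ quadrantSet n q) :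
    ∃ r > 0, ∀ᶠ d' in 𝓝 d, IsNearId q (ψ d') r := by
  have hS := uniqueDiffOn_quadrantSet n q
  have h0 : ((d, 0) : D × Euc n) ∈ (univ : Set D) ×ˢ quadrantSet n q :=
    ⟨mem_univ _, zero_mem_quadrantSet n q⟩
  have h1 := (family.self_of_nhdsWithin h0).continuousWithinAt_fderivWithin hS h0.2
  have h2 : ∀ᶠ p in 𝓝[univ ×ˢ quadrantSet n q] (d, (0 : Euc n)),
      ‖fderivWithin ℝ (ψ p.1) (quadrantSet n q) p.2 - ContinuousLinearMap.id ℝ (Euc n)‖ ≤ 1 / 4 := by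
    have h3 := (h1.sub_const (ContinuousLinearMap.id ℝ (Euc n))).norm
    have h4 : ‖fderivWithin ℝ (ψ d) (quadrantSet n q) 0 - ContinuousLinearMap.id ℝ (Euc n)‖ <
        (1 / 4 : ℝ) := by simp [deriv.self_of_nhds]
    exact (h3.eventually (gt_mem_nhds h4)).mono fun p hp => le_of_lt hp
  obtain ⟨r, hr, h⟩ := eventually_slice_iff_exists_ball.1 ((family.and h2).and maps)
  refine ⟨r, hr, h.mono fun d' hd' => ⟨fun w hw => ?_, fun w hw => (hd' w hw).1.2,
    fun w hw => (hd' w hw).2⟩⟩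
  exact ((hd' w hw).1.1.contDiffWithinAt hw.1).mono inter_subset_left

theorem IsNearId.mono {q : ℕ} {f : Euc n → Euc n} {r s : ℝ} (h : IsNearId q f r) (hs : s ≤ r) :
    IsNearId q f s :=
  have hsub := inter_subset_inter_right (quadrantSet n q) (Metric.ball_subset_ball (x := 0) hs)
  ⟨h.smooth.mono hsub, fun w hw => h.deriv w (hsub hw), h.maps.mono_left hsub⟩

namespace IsNearIdFamilyAt

variable {q : ℕ} {ψ : D → Euc n → Euc n} {d : D}

theorem smoothFamilyAt_id (p : D × Euc n) (hp : p.2 ∈ quadrantSet n q) :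
    SmoothFamilyAt (fun (_ : D) (u : Euc n) => u) (quadrantSet n q) p :=
  SmoothFamilyAt.of_contDiffWithinAt (uniqueDiffOn_quadrantSet n q)
    (Eventually.of_forall fun _ => contDiffWithinAt_id) hp

/-- Straight-line deformation towards the identity. -/
theorem lineMap (h : IsNearIdFamilyAt q ψ d) {μ : D → ℝ} (hμ : Continuous μ)
    (hμ01 : ∀ d, μ d ∈ Icc (0 : ℝ) 1) :
    IsNearIdFamilyAt q (fun d u => μ d • ψ d u + (1 - μ d) • u) d := by
  have hS := uniqueDiffOn_quadrantSet n q
  have h0 := zero_mem_quadrantSet n q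
  refine ⟨?_, ?_, ?_, ?_, ?_⟩
  · filter_upwards [h.family, self_mem_nhdsWithin] with p hp hpS
    exact SmoothFamilyAt.add hS hpS.2 (hp.smul hS hpS.2 hμ.continuousAt)
      ((smoothFamilyAt_id p hpS.2).smul hS hpS.2 (continuous_const.sub hμ).continuousAt)
  · filter_upwards [h.zero] with d' hd'
    simp [hd']
  · have hk : Tendsto (fun d' : D => (d', (0 : Euc n))) (𝓝 d) (𝓝[univ ×ˢ quadrantSet n q] (d, 0)) :=
      tendsto_nhdsWithin_iff.2 ⟨Continuous.tendsto (by fun_prop) d,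
        Eventually.of_forall fun d' => ⟨mem_univ _, h0⟩⟩
    filter_upwards [h.deriv, hk.eventually h.family] with d' hd' hf
    have h1 : HasFDerivWithinAt (ψ d') (ContinuousLinearMap.id ℝ (Euc n)) (quadrantSet n q) 0 := by
      rw [← hd']
      exact ((hf.contDiffWithinAt h0).differentiableWithinAt (by simp)).hasFDerivWithinAt
    have h2 := (h1.const_smul (μ d')).add
      ((hasFDerivWithinAt_id (𝕜 := ℝ) (0 : Euc n) (quadrantSet n q)).const_smul (1 - μ d'))
    refine (h2.fderivWithin (hS _ h0)).trans ?_
    rw [← add_smul]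
    simp
  · filter_upwards [h.maps, self_mem_nhdsWithin] with p hp hpS
    exact convex_quadrantSet n q hp hpS.2 (hμ01 _).1 (by linarith [(hμ01 p.1).2]) (by ring)
  · filter_upwards [h.facets] with p hp i hi hpi
    simp [hp i hi hpi, hpi]

theorem congr {ψ' : D → Euc n → Euc n} (h : IsNearIdFamilyAt q ψ d)
    (he : ∀ᶠ d' in 𝓝 d, ψ' d' = ψ d') : IsNearIdFamilyAt q ψ' d := by
  have hfst : Tendsto Prod.fst (𝓝[univ ×ˢ quadrantSet n q] (d, (0 : Euc n))) (𝓝 d) :=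
    continuous_fst.continuousWithinAt
  have he' := hfst.eventually he
  refine ⟨?_, ?_, ?_, ?_, ?_⟩
  · filter_upwards [h.family, eventually_eventually_nhdsWithin.2 he', self_mem_nhdsWithin]
      with p hp h1 h2
    exact hp.congr h2.2 (h1.mono fun p' hp' => by rw [hp'])
  · filter_upwards [h.zero, he] with d' h1 h2
    rw [h2, h1]
  · filter_upwards [h.deriv, he] with d' h1 h2
    rw [h2, h1]
  · filter_upwards [h.maps, he'] with p h1 h2
    rwa [h2]
  · filter_upwards [h.facets, he'] with p h1 h2
    rwa [h2]

theorem id (q : ℕ) (d : D) : IsNearIdFamilyAt q (fun (_ : D) (u : Euc n) => u) d :=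
  ⟨eventually_mem_nhdsWithin.mono fun p hp => smoothFamilyAt_id p hp.2,
    Eventually.of_forall fun _ => rfl,
    Eventually.of_forall fun _ => fderivWithin_id
      (uniqueDiffOn_quadrantSet n q _ (zero_mem_quadrantSet n q)),
    eventually_mem_nhdsWithin.mono fun _ hp => hp.2,
    Eventually.of_forall fun _ _ _ h => h⟩

end IsNearIdFamilyAt

theorem IsLocalDiffeomorphAt.congr_of_eventuallyEq {q : ℕ} {φ φ' : Quadrant n q → X}
    {w : Quadrant n q}
    (h : IsLocalDiffeomorphAt (quadrantModel n q) (cornerModel n) ∞ φ w) (he : φ' =ᶠ[𝓝 w] φ) :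
    IsLocalDiffeomorphAt (quadrantModel n q) (cornerModel n) ∞ φ' w := by
  obtain ⟨Φ, hw, hΦ⟩ := h
  obtain ⟨U, hU, hUo, hwU⟩ := eventually_nhds_iff.1 he
  refine ⟨⟨Φ.toPartialEquiv.restr U, Φ.open_source.inter hUo,
    (Φ.toOpenPartialHomeomorph.restrOpen U hUo).open_target,
    Φ.contMDiffOn_toFun.mono inter_subset_left, Φ.contMDiffOn_invFun.mono inter_subset_left⟩,
    ⟨hw, hwU⟩, fun z hz => ?_⟩
  exact (hU z hz.2).trans (hΦ hz.1)

variable [IsManifold (cornerModel n) ∞ X]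

omit [IsManifold (cornerModel n) ∞ X] in
theorem IsStraight.injOn {K : Stratum n X} {y : X} {a : Euc n} {M : Euc n →L[ℝ] Euc n} {r : ℝ}
    (h : IsStraight K y a M r) : InjOn (fun u => (extChartAt (cornerModel n) y).symm (a + M u))
      (quadrantSet n K.index ∩ Metric.ball 0 r) := by
  intro u hu w hw huw
  have h1 := (extChartAt (cornerModel n) y).symm.injOn (h.target u hu) (h.target w hw) huw
  rw [← h.inverse_apply u, ← h.inverse_apply w, add_left_cancel h1]

/-- The map is the smooth open embedding `f` followed by the affine coordinates. Its inverse is that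
of `f` from `IsNearId.exists_inverse` composed with `z ↦ M⁻¹(E z - a)`. -/
theorem IsStraight.isLocalDiffeomorphAt {K : Stratum n X} {y : X} {a : Euc n}
    {M : Euc n →L[ℝ] Euc n} {r s : ℝ} (h : IsStraight K y a M r) {f : Euc n → Euc n}
    (hf : IsNearId K.index f s)
    (hfacet : ∀ x ∈ quadrantSet n K.index ∩ Metric.ball 0 s, ∀ i : Fin n, n ≤ i.val + K.index →
      x i = 0 → f x i = 0)
    (hr : MapsTo f (quadrantSet n K.index ∩ Metric.ball 0 s) (Metric.ball 0 r))
    {w : Quadrant n K.index} (hw : w.1 ∈ Metric.ball (0 : Euc n) s) :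
    IsLocalDiffeomorphAt (quadrantModel n K.index) (cornerModel n) ∞
      (fun w : Quadrant n K.index => (extChartAt (cornerModel n) y).symm (a + M (f w.1))) w := by
  obtain ⟨U, g, hU, himg, hg, hgf⟩ := hf.exists_inverse hfacet
  set S := quadrantSet n K.index
  set E := extChartAt (cornerModel n) y
  set Mi := ContinuousLinearMap.inverse M
  have htar : ∀ x ∈ S ∩ Metric.ball 0 s, a + M (f x) ∈ E.target := fun x hx =>
    h.target _ ⟨hf.maps hx, hr hx⟩
  have hback : ∀ x ∈ S ∩ Metric.ball 0 s, Mi (E (E.symm (a + M (f x))) - a) = f x := by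
    intro x hx
    rw [E.right_inv (htar x hx), add_sub_cancel_left, h.inverse_apply]
  have hκ : ∀ z : X, Mi (E z - a) ∈ S := h.inv_mem
  have hfwd : ∀ z ∈ E.source, Mi (E z - a) ∈ U → g (Mi (E z - a)) ∈ S ∩ Metric.ball 0 s ∧
      f (g (Mi (E z - a))) = Mi (E z - a) := by
    intro z _ hz
    have h1 : Mi (E z - a) ∈ f '' (S ∩ Metric.ball 0 s) := himg ▸ ⟨hκ z, hz⟩
    obtain ⟨x, hx, hxz⟩ := h1
    rw [← hxz, hgf x hx]
    exact ⟨hx, rfl⟩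
  have hEc : ContinuousOn (fun z => Mi (E z - a)) E.source :=
    (Mi.continuous.comp (continuous_id.sub continuous_const)).comp_continuousOn
      (continuousOn_extChartAt y)
  -- Since `M⁻¹(E z - a)` always lies in the quadrant, intersecting with the open set `U` of `ℝⁿ`
  -- suffices to describe the image, which is therefore open in `X`.
  have hopen : IsOpen (E.source ∩ (fun z => Mi (E z - a)) ⁻¹' U) :=
    hEc.isOpen_inter_preimage (isOpen_extChartAt_source y) hU
  refine ⟨⟨⟨fun w => E.symm (a + M (f w.1)), fun z => (quadrantModel n K.index).symm
      (g (Mi (E z - a))), {w | w.1 ∈ Metric.ball (0 : Euc n) s},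
      E.source ∩ (fun z => Mi (E z - a)) ⁻¹' U, ?_, ?_, ?_, ?_⟩, ?_, hopen, ?_, ?_⟩, hw,
      fun _ _ => rfl⟩
  · intro x hx
    refine ⟨E.map_target (htar _ ⟨x.2, hx⟩), ?_⟩
    change Mi (E (E.symm (a + M (f x.1))) - a) ∈ U
    rw [hback _ ⟨x.2, hx⟩]
    exact (himg ▸ mem_image_of_mem f ⟨x.2, hx⟩ : f x.1 ∈ S ∩ U).2
  · intro z hz
    have h1 := (hfwd z hz.1 hz.2).1
    simp only [mem_ofPred_eq]
    rw [coe_quadrantModel_symm h1.1]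
    exact h1.2
  · intro x hx
    rw [hback _ ⟨x.2, hx⟩, hgf _ ⟨x.2, hx⟩, quadrantModel_symm_coe]
  · intro z hz
    have h1 := hfwd z hz.1 hz.2
    rw [coe_quadrantModel_symm h1.1.1, h1.2, h.apply_inverse, add_sub_cancel]
    exact E.left_inv hz.1
  · exact Metric.isOpen_ball.preimage continuous_subtype_val
  · intro x hx
    have hx : x.1 ∈ S ∩ Metric.ball 0 s := ⟨x.2, hx⟩
    have hcd : ContDiffWithinAt ℝ ∞ (fun u => a + M (f u)) S x.1 :=
      contDiffWithinAt_const.add (M.contDiff.comp_contDiffWithinAt (hf.contDiffWithinAt hx))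
    have hcs : ContMDiffWithinAt 𝓘(ℝ, Euc n) (cornerModel n) ∞ E.symm E.target (a + M (f x.1)) :=
      contMDiffOn_extChartAt_symm y _ (htar _ hx)
    have hcf : ContMDiffAt (quadrantModel n K.index) 𝓘(ℝ, Euc n) ∞
        (fun w : Quadrant n K.index => a + M (f w.1)) x := by
      rw [contMDiffAt_iff]
      refine ⟨?_, ?_⟩
      · have := hcd.continuousWithinAt
        rwa [ContinuousWithinAt, ← map_nhds_subtype_val, tendsto_map'_iff] at this
      · rw [range_quadrantModel]
        refine hcd.congr_of_mem (fun u hu => ?_) x.2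
        change a + M (f ((quadrantModel n K.index).symm u).1) = _
        rw [coe_quadrantModel_symm hu]
    exact ContMDiffWithinAt.comp (f := fun w : Quadrant n K.index => a + M (f w.1)) x hcs
      hcf.contMDiffWithinAt fun w hw => htar _ ⟨w.2, hw⟩
  · have h1 : ContMDiffOn (cornerModel n) 𝓘(ℝ, Euc n) ∞ (fun z => Mi (E z - a))
        (chartAt (EuclideanQuadrant n) y).source := by
      have h2 : ContDiff ℝ ∞ fun u : Euc n => Mi (u - a) := by fun_prop
      exact h2.contMDiff.comp_contMDiffOn contMDiffOn_extChartAt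
    have h3 : ContMDiffOn 𝓘(ℝ, Euc n) 𝓘(ℝ, Euc n) ∞ g (S ∩ U) := hg.contMDiffOn
    have h4 : ContMDiffOn 𝓘(ℝ, Euc n) (quadrantModel n K.index) ∞ (quadrantModel n K.index).symm
        (range (quadrantModel n K.index)) := (quadrantModel n K.index).contMDiffOn_symm
    have h5 := h3.comp (h1.mono (t := E.source ∩ (fun z => Mi (E z - a)) ⁻¹' U)
      (by rw [← extChartAt_source (cornerModel n)]; exact inter_subset_left))
      fun z hz => ⟨hκ z, hz.2⟩
    refine h4.comp h5 fun z hz => ?_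
    rw [range_quadrantModel]
    exact (hfwd z hz.1 hz.2).1.1

end GermLifts

end

noncomputable section

/-! ### From near-identity families to germ lifts -/

section GermLifts

open Filter

variable {n : ℕ} {X : Type*} [TopologicalSpace X] [ChartedSpace (EuclideanQuadrant n) X]
  {D : Type*} [TopologicalSpace D] [IsManifold (cornerModel n) ∞ X]

/-- Near the origin and for parameters near `d`, the maps `G d` are stratum-preserving embeddings
that lift the family of frames `v`. -/
structure IsGermLiftAt (K : Stratum n X) (v : D → HomBundle n X)
    (G : D → Quadrant n K.index → X) (d : D) : Prop where
  family : ∀ᶠ p in 𝓝 (d, (0 : Quadrant n K.index)), SmoothMapFamilyAt G p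
  diffeo : ∀ᶠ p in 𝓝 (d, (0 : Quadrant n K.index)),
    IsLocalDiffeomorphAt (quadrantModel n K.index) (cornerModel n) ∞ (G p.1) p.2
  carrier : ∀ᶠ p in 𝓝 (d, (0 : Quadrant n K.index)), p.2 ∈ deepestStratum n K.index →
    G p.1 p.2 ∈ K.carrier
  inj : ∀ᶠ p in 𝓝 (d, ((0, 0) : Quadrant n K.index × Quadrant n K.index)),
    G p.1 p.2.1 = G p.1 p.2.2 → p.2.1 = p.2.2
  jet : ∀ᶠ d' in 𝓝 d, originJet (G d') = v d'

variable {K : Stratum n X} {v : D → HomBundle n X} {G G' : D → Quadrant n K.index → X} {d : D}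

theorem tendsto_prodMk_const {Y : Type*} [TopologicalSpace Y] (d : D) (y : Y) :
    Tendsto (fun d' => (d', y)) (𝓝 d) (𝓝 (d, y)) :=
  Continuous.tendsto (by fun_prop) d

theorem originJet_congr {q : ℕ} {φ φ' : Quadrant n q → X} (h : φ' =ᶠ[𝓝 0] φ) :
    originJet φ' = originJet φ :=
  homBundle_ext h.self_of_nhds h.mfderiv_eq

namespace IsGermLiftAt

theorem eventually (h : IsGermLiftAt K v G d) : ∀ᶠ d' in 𝓝 d, IsGermLiftAt K v G d' := by
  filter_upwards [(tendsto_prodMk_const d _).eventually h.family.eventually_nhds,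
    (tendsto_prodMk_const d _).eventually h.diffeo.eventually_nhds,
    (tendsto_prodMk_const d _).eventually h.carrier.eventually_nhds,
    (tendsto_prodMk_const d _).eventually h.inj.eventually_nhds, h.jet.eventually_nhds]
    with d' h1 h2 h3 h4 h5 using ⟨h1, h2, h3, h4, h5⟩

theorem congr (h : IsGermLiftAt K v G d)
    (he : ∀ᶠ p in 𝓝 (d, (0 : Quadrant n K.index)), G' p.1 p.2 = G p.1 p.2) :
    IsGermLiftAt K v G' d := by
  have hslice : ∀ᶠ p in 𝓝 (d, (0 : Quadrant n K.index)), G' p.1 =ᶠ[𝓝 p.2] G p.1 := by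
    filter_upwards [he.eventually_nhds] with p hp
    exact (Continuous.tendsto (f := fun w => (p.1, w)) (by fun_prop) p.2).eventually hp
  refine ⟨?_, ?_, ?_, ?_, ?_⟩
  · filter_upwards [h.family, he.eventually_nhds] with p h1 h2 using h1.congr h2
  · filter_upwards [h.diffeo, hslice] with p h1 h2 using
      IsLocalDiffeomorphAt.congr_of_eventuallyEq h1 h2
  · filter_upwards [h.carrier, he] with p h1 h2
    rwa [h2]
  · have h1 : Tendsto (fun p : D × Quadrant n K.index × Quadrant n K.index => (p.1, p.2.1))
      (𝓝 (d, (0, 0))) (𝓝 (d, 0)) := Continuous.tendsto (by fun_prop) (d, (0, 0))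
    have h2 : Tendsto (fun p : D × Quadrant n K.index × Quadrant n K.index => (p.1, p.2.2))
      (𝓝 (d, (0, 0))) (𝓝 (d, 0)) := Continuous.tendsto (by fun_prop) (d, (0, 0))
    filter_upwards [h.inj, h1.eventually he, h2.eventually he] with p h3 h4 h5
    rwa [h4, h5]
  · filter_upwards [h.jet, (tendsto_prodMk_const d _).eventually hslice] with d' h1 h2
    rw [originJet_congr h2, h1]

end IsGermLiftAt

/-- The map of quadrants `ψ d` transported to `X` by the straight coordinates at `v d`. -/
def unstraighten (v : D → HomBundle n X) (y : X) {q : ℕ} (ψ : D → Euc n → Euc n) (d : D)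
    (w : Quadrant n q) : X :=
  (extChartAt (cornerModel n) y).symm (baseCoords v y d + matrixCoords v y d (ψ d w.1))

/-- A family of maps from a quadrant to `X` in the straight coordinates at `v d`. -/
def straighten (v : D → HomBundle n X) (y : X) {q : ℕ} (G : D → Quadrant n q → X) (d : D)
    (u : Euc n) : Euc n :=
  ContinuousLinearMap.inverse (matrixCoords v y d)
    (extChartAt (cornerModel n) y (G d ((quadrantModel n q).symm u)) - baseCoords v y d)

/-- Conjugation by the straight coordinates transports the properties of `ψ` to `X`; the jet is the
prescribed frame because `ψ` fixes `0` with derivative the identity. -/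
theorem IsNearIdFamilyAt.isGermLiftAt (hv : IsFrameFamily K v) {y : X}
    (hy : (v d).proj ∈ (extChartAt (cornerModel n) y).source) {ψ : D → Euc n → Euc n}
    (h : IsNearIdFamilyAt K.index ψ d) : IsGermLiftAt K v (unstraighten v y ψ) d := by
  set S := quadrantSet n K.index
  set E := extChartAt (cornerModel n) y
  set a := baseCoords v y
  set M := matrixCoords v y
  have hS : UniqueDiffOn ℝ S := uniqueDiffOn_quadrantSet n K.index
  have h0S : (0 : Euc n) ∈ S := zero_mem_quadrantSet n K.index
  obtain ⟨r, hr, hstr⟩ := hv.exists_isStraight hy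
  obtain ⟨s₁, hs₁, hnear⟩ := eventually_isNearId h.family h.deriv h.maps
  have hψr : ∀ᶠ p in 𝓝[univ ×ˢ S] (d, (0 : Euc n)), ψ p.1 p.2 ∈ Metric.ball (0 : Euc n) r := by
    have h1 := (h.family.self_of_nhdsWithin ⟨mem_univ _, h0S⟩).continuousWithinAt
    refine h1.eventually (Metric.isOpen_ball.mem_nhds ?_)
    simp [h.zero.self_of_nhds, hr]
  obtain ⟨s₂, hs₂, hball⟩ := eventually_slice_iff_exists_ball.1 ((h.family.and hψr).and h.facets)
  set t := min s₁ s₂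
  have ht : 0 < t := lt_min hs₁ hs₂
  -- `N d'` collects everything needed at the parameter `d'` on one common ball of radius `t`.
  let N : D → Prop := fun d' => (IsStraight K y (a d') (M d') r ∧ IsNearId K.index (ψ d') t ∧
    (∀ u ∈ S ∩ Metric.ball 0 t, SmoothFamilyAt ψ S (d', u)) ∧
    (∀ u ∈ S ∩ Metric.ball 0 t, ψ d' u ∈ Metric.ball (0 : Euc n) r) ∧
    (∀ u ∈ S ∩ Metric.ball 0 t, ∀ i : Fin n, n ≤ i.val + K.index → u i = 0 → ψ d' u i = 0)) ∧
    ψ d' 0 = 0 ∧ fderivWithin ℝ (ψ d') S 0 = ContinuousLinearMap.id ℝ (Euc n) ∧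
    (v d').proj ∈ E.source
  have hN : ∀ᶠ d' in 𝓝 d, N d' := by
    filter_upwards [hstr, hnear, hball, h.zero, h.deriv, hv.eventually_mem_source hy]
      with d' h1 h2 h3 h4 h5 h6
    have hsub : ∀ u ∈ S ∩ Metric.ball (0 : Euc n) t, u ∈ S ∩ Metric.ball (0 : Euc n) s₂ :=
      fun u hu => ⟨hu.1, Metric.ball_subset_ball (min_le_right _ _) hu.2⟩
    exact ⟨⟨h1, h2.mono (min_le_left _ _), fun u hu => (h3 u (hsub u hu)).1.1,
      fun u hu => (h3 u (hsub u hu)).1.2, fun u hu => (h3 u (hsub u hu)).2⟩, h4, h5, h6⟩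
  have hB : ∀ᶠ w : Quadrant n K.index in 𝓝 0, w.1 ∈ Metric.ball (0 : Euc n) t :=
    continuous_subtype_val.continuousAt.eventually (Metric.ball_mem_nhds _ ht)
  have htar : ∀ d', N d' → ∀ u ∈ S ∩ Metric.ball (0 : Euc n) t, a d' + M d' (ψ d' u) ∈ E.target :=
    fun d' hd' u hu => hd'.1.1.target _ ⟨hd'.1.2.1.maps hu, hd'.1.2.2.2.1 u hu⟩
  have hdiff : ∀ d', N d' → ∀ w : Quadrant n K.index, w.1 ∈ Metric.ball (0 : Euc n) t →
      IsLocalDiffeomorphAt (quadrantModel n K.index) (cornerModel n) ∞ (unstraighten v y ψ d') w :=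
    fun d' hd' w hw => hd'.1.1.isLocalDiffeomorphAt hd'.1.2.1 hd'.1.2.2.2.2 hd'.1.2.2.2.1 hw
  have hNB : ∀ᶠ p : D × Quadrant n K.index in 𝓝 (d, 0), N p.1 ∧ p.2.1 ∈ Metric.ball (0 : Euc n) t :=
    ((continuous_fst.tendsto (d, (0 : Quadrant n K.index))).eventually hN).and
      ((continuous_snd.tendsto (d, (0 : Quadrant n K.index))).eventually hB)
  refine ⟨?_, ?_, ?_, ?_, ?_⟩
  · filter_upwards [hNB.eventually_nhds] with p hp
    obtain ⟨hpN, hpB⟩ := hp.self_of_nhds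
    refine SmoothMapFamilyAt.of_extend (e := chartAt (EuclideanQuadrant n) y)
      (IsManifold.chart_mem_maximalAtlas _) ?_ ?_
    · filter_upwards [hp] with p' hp'
      have := E.map_target (htar _ hp'.1 p'.2.1 ⟨p'.2.2, hp'.2⟩)
      rwa [extChartAt_source] at this
    · have h1 : SmoothFamilyAt (fun d' z => a d' + M d' z) univ (p.1, ψ p.1 p.2.1) :=
        SmoothFamilyAt.of_contDiff
          (g := fun z : (Euc n × (Euc n →L[ℝ] Euc n)) × Euc n => z.1.1 + z.1.2 z.2)
          (by fun_prop) (c := fun d' => (a d', M d'))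
          ((hv.continuousAt_baseCoords hpN.2.2.2).prodMk (hv.continuousAt_matrixCoords hpN.2.2.2))
          uniqueDiffOn_univ (mem_univ _)
      have h2 := SmoothFamilyAt.comp hS uniqueDiffOn_univ p.2.2 h1
        (hpN.1.2.2.1 p.2.1 ⟨p.2.2, hpB⟩) (Eventually.of_forall fun _ => mem_univ _)
      refine h2.congr p.2.2 (eventually_quadrant_iff.2 ?_)
      filter_upwards [hp] with p' hp'
      rw [quadrantModel_symm_coe]
      exact E.right_inv (htar _ hp'.1 p'.2.1 ⟨p'.2.2, hp'.2⟩)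
  · filter_upwards [hNB] with p hp using hdiff _ hp.1 _ hp.2
  · filter_upwards [hNB] with p hp hdeep
    have hu : p.2.1 ∈ S ∩ Metric.ball (0 : Euc n) t := ⟨p.2.2, hp.2⟩
    exact hp.1.1.1.carrier _ ⟨hp.1.1.2.1.maps hu, hp.1.1.2.2.2.1 _ hu⟩
      fun i hi => hp.1.1.2.2.2.2 _ hu i hi (hdeep i hi)
  · have h1 : ∀ᶠ p : D × Quadrant n K.index × Quadrant n K.index in 𝓝 (d, (0, 0)),
        N p.1 ∧ p.2.1.1 ∈ Metric.ball (0 : Euc n) t ∧ p.2.2.1 ∈ Metric.ball (0 : Euc n) t :=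
      ((continuous_fst.tendsto (d, ((0, 0) : Quadrant n K.index × Quadrant n K.index))).eventually
        hN).and
      ((((continuous_fst.comp continuous_snd).tendsto
        (d, ((0, 0) : Quadrant n K.index × Quadrant n K.index))).eventually hB).and
      (((continuous_snd.comp continuous_snd).tendsto
        (d, ((0, 0) : Quadrant n K.index × Quadrant n K.index))).eventually hB))
    filter_upwards [h1] with p hp heq
    have hu : p.2.1.1 ∈ S ∩ Metric.ball (0 : Euc n) t := ⟨p.2.1.2, hp.2.1⟩
    have hu' : p.2.2.1 ∈ S ∩ Metric.ball (0 : Euc n) t := ⟨p.2.2.2, hp.2.2⟩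
    exact Subtype.ext (hp.1.1.2.1.injOn hu hu' (hp.1.1.1.injOn
      ⟨hp.1.1.2.1.maps hu, hp.1.1.2.2.2.1 _ hu⟩ ⟨hp.1.1.2.1.maps hu', hp.1.1.2.2.2.1 _ hu'⟩ heq))
  · filter_upwards [hN] with d' hd'
    have hbase : unstraighten v y ψ d' (0 : Quadrant n K.index) = (v d').proj := by
      change E.symm (a d' + M d' (ψ d' 0)) = _
      rw [hd'.2.1, map_zero, add_zero]
      exact E.left_inv hd'.2.2.2
    have hsrc : unstraighten v y ψ d' (0 : Quadrant n K.index) ∈ E.source := hbase ▸ hd'.2.2.2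
    refine homBundle_ext_frameCoords hd'.2.2.2 hbase ?_
    have h0B : (0 : Euc n) ∈ Metric.ball (0 : Euc n) t := Metric.mem_ball_self ht
    refine (fderivWithin_extChartAt_eq_frameCoords
      ((hdiff d' hd' 0 h0B).mdifferentiableAt (by simp)) hsrc).symm.trans ?_
    have h1 : (fun u => E (unstraighten v y ψ d' ((quadrantModel n K.index).symm u))) =ᶠ[𝓝[S] 0]
        fun u => a d' + M d' (ψ d' u) := by
      filter_upwards [self_mem_nhdsWithin, mem_nhdsWithin_of_mem_nhds (Metric.ball_mem_nhds _ ht)]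
        with u hu hut
      simp only [unstraighten, coe_quadrantModel_symm hu]
      exact E.right_inv (htar d' hd' u ⟨hu, hut⟩)
    rw [h1.fderivWithin_eq_of_mem h0S]
    have h2 : HasFDerivWithinAt (ψ d') (ContinuousLinearMap.id ℝ (Euc n)) S 0 := by
      rw [← hd'.2.2.1]
      exact hd'.1.2.1.hasFDerivWithinAt ⟨h0S, h0B⟩
    exact ((M d').hasFDerivAt.comp_hasFDerivWithinAt _ h2).const_add (a d')
      |>.fderivWithin (hS _ h0S)

end GermLifts

end

noncomputable section

/-! ### From germ lifts back to near-identity families -/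

section GermLifts

open Filter

variable {n : ℕ} {X : Type*} [TopologicalSpace X] [ChartedSpace (EuclideanQuadrant n) X]
  {D : Type*} [TopologicalSpace D] [IsManifold (cornerModel n) ∞ X]

omit [IsManifold (cornerModel n) ∞ X] in
theorem IsLocalDiffeomorphAt.image_mem_nhds_quadrant {q : ℕ} {φ : Quadrant n q → X}
    {w : Quadrant n q}
    (h : IsLocalDiffeomorphAt (quadrantModel n q) (cornerModel n) ∞ φ w) {s : Set (Quadrant n q)}
    (hs : s ∈ 𝓝 w) : φ '' s ∈ 𝓝 (φ w) := by
  obtain ⟨Φ, hw, hΦ⟩ := h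
  have h1 := Φ.toOpenPartialHomeomorph.image_mem_nhds hw
    (Filter.inter_mem hs (Φ.open_source.mem_nhds hw))
  rw [hΦ hw]
  refine mem_of_superset h1 ?_
  rintro _ ⟨x, hx, rfl⟩
  exact ⟨x, hx.1, hΦ hx.2⟩

variable {K : Stratum n X} {v : D → HomBundle n X} {G : D → Quadrant n K.index → X} {d : D}

namespace IsGermLiftAt

theorem apply_zero (h : IsGermLiftAt K v G d) : G d 0 = (v d).proj :=
  congrArg Bundle.TotalSpace.proj h.jet.self_of_nhds

theorem eventually_mem_source (h : IsGermLiftAt K v G d) {y : X}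
    (hy : (v d).proj ∈ (extChartAt (cornerModel n) y).source) :
    ∀ᶠ p in 𝓝 (d, (0 : Quadrant n K.index)), G p.1 p.2 ∈ (extChartAt (cornerModel n) y).source :=
  h.family.self_of_nhds.cont.eventually
    ((isOpen_extChartAt_source y).mem_nhds (by rwa [← h.apply_zero] at hy))

theorem eventually_unstraighten_straighten (h : IsGermLiftAt K v G d) (hv : IsFrameFamily K v)
    {y : X} (hy : (v d).proj ∈ (extChartAt (cornerModel n) y).source) :
    ∀ᶠ p in 𝓝 (d, (0 : Quadrant n K.index)),
      unstraighten v y (straighten v y G) p.1 p.2 = G p.1 p.2 := by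
  obtain ⟨r, -, hstr⟩ := hv.exists_isStraight hy
  filter_upwards [h.eventually_mem_source hy,
    (continuous_fst.tendsto (d, (0 : Quadrant n K.index))).eventually hstr] with p h1 h2
  rw [unstraighten, straighten, h2.apply_inverse, quadrantModel_symm_coe, add_sub_cancel]
  exact (extChartAt (cornerModel n) y).left_inv h1

theorem eventually_smoothFamilyAt_straighten (h : IsGermLiftAt K v G d) (hv : IsFrameFamily K v)
    {y : X} (hy : (v d).proj ∈ (extChartAt (cornerModel n) y).source) :
    ∀ᶠ p in 𝓝[univ ×ˢ quadrantSet n K.index] (d, (0 : Euc n)),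
      SmoothFamilyAt (straighten v y G) (quadrantSet n K.index) p := by
  refine eventually_quadrant_iff (w := 0).2 ?_
  filter_upwards [h.family, h.eventually_mem_source hy,
    (continuous_fst.tendsto (d, (0 : Quadrant n K.index))).eventually (hv.eventually_mem_source hy)]
    with p h1 h2 h3
  have h4 := h1.extend (IsManifold.chart_mem_maximalAtlas y)
    (by rwa [← extChartAt_source (cornerModel n)])
  refine SmoothFamilyAt.comp (uniqueDiffOn_quadrantSet n K.index) uniqueDiffOn_univ p.2.2
    (g := fun d' z => ContinuousLinearMap.inverse (matrixCoords v y d') (z - baseCoords v y d'))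
    ?_ h4 (Eventually.of_forall fun _ => mem_univ _)
  exact SmoothFamilyAt.of_contDiff
    (g := fun z : (Euc n × (Euc n →L[ℝ] Euc n)) × Euc n => z.1.2 (z.2 - z.1.1)) (by fun_prop)
    (c := fun d' => (baseCoords v y d', ContinuousLinearMap.inverse (matrixCoords v y d')))
    ((hv.continuousAt_baseCoords h3).prodMk (hv.continuousAt_inverse h3)) uniqueDiffOn_univ
    (mem_univ _)

theorem straighten_zero (h : IsGermLiftAt K v G d) (y : X) : straighten v y G d 0 = 0 := by
  have h0 : (quadrantModel n K.index).symm 0 = 0 := quadrantModel_symm_coe 0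
  rw [straighten, h0, h.apply_zero, baseCoords, sub_self, map_zero]

/-- The jet condition says that the chart derivative of `G d` at the origin is the frame matrix,
which straightening inverts. -/
theorem fderivWithin_straighten (h : IsGermLiftAt K v G d) (hv : IsFrameFamily K v)
    {y : X} (hy : (v d).proj ∈ (extChartAt (cornerModel n) y).source) :
    fderivWithin ℝ (straighten v y G d) (quadrantSet n K.index) 0 =
      ContinuousLinearMap.id ℝ (Euc n) := by
  set S := quadrantSet n K.index
  have h0S : (0 : Euc n) ∈ S := zero_mem_quadrantSet n K.index
  have hsrc := (h.eventually_mem_source hy).self_of_nhds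
  have h1 := (h.family.self_of_nhds.extend (IsManifold.chart_mem_maximalAtlas y)
    (by rwa [← extChartAt_source (cornerModel n)])).contDiffWithinAt h0S
  have h2 := (h1.differentiableWithinAt (by simp)).hasFDerivWithinAt
  have h3 := fderivWithin_extChartAt_eq_frameCoords
    (h.diffeo.self_of_nhds.mdifferentiableAt (by simp)) hsrc
  have h4 : frameCoords y (originJet (G d)).proj (originJet (G d)).snd = matrixCoords v y d := by
    rw [h.jet.self_of_nhds]
    rfl
  obtain ⟨r, -, hstr⟩ := hv.exists_isStraight hy
  have h5 := ((ContinuousLinearMap.inverse (matrixCoords v y d)).hasFDerivAt.comp_hasFDerivWithinAt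
    _ (h2.sub_const (baseCoords v y d))).fderivWithin (uniqueDiffOn_quadrantSet n K.index _ h0S)
  refine Eq.trans h5 ?_
  ext1 u
  refine Eq.trans (congrArg (fun L : Euc n →L[ℝ] Euc n =>
    ContinuousLinearMap.inverse (matrixCoords v y d) (L u)) (h3.trans h4)) ?_
  exact hstr.self_of_nhds.inverse_apply u

theorem eventually_straighten_mem (hv : IsFrameFamily K v) {y : X}
    (hy : (v d).proj ∈ (extChartAt (cornerModel n) y).source) (p : Euc n) :
    ∀ᶠ p in 𝓝[univ ×ˢ quadrantSet n K.index] (d, p),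
      straighten v y G p.1 p.2 ∈ quadrantSet n K.index := by
  obtain ⟨r, -, hstr⟩ := hv.exists_isStraight hy
  filter_upwards [mem_nhdsWithin_of_mem_nhds
    ((continuous_fst.tendsto (d, p)).eventually hstr)] with p' h2 using h2.inv_mem _

/-- Everything except the facet condition is formal. Facets are preserved because `G` is a local
diffeomorphism, so its straightened form is open in the quadrant and `IsNearId.apply_eq_zero`
applies. -/
theorem isNearIdFamilyAt (h : IsGermLiftAt K v G d) (hv : IsFrameFamily K v)
    {y : X} (hy : (v d).proj ∈ (extChartAt (cornerModel n) y).source) :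
    IsNearIdFamilyAt K.index (straighten v y G) d := by
  set S := quadrantSet n K.index
  set E := extChartAt (cornerModel n) y
  have h0S : (0 : Euc n) ∈ S := zero_mem_quadrantSet n K.index
  have hfam := h.eventually_smoothFamilyAt_straighten hv hy
  have hderiv : ∀ᶠ d' in 𝓝 d, fderivWithin ℝ (straighten v y G d') S 0 =
      ContinuousLinearMap.id ℝ (Euc n) := by
    filter_upwards [h.eventually, hv.eventually_mem_source hy] with d' h1 h2 using
      h1.fderivWithin_straighten hv h2
  have hmaps := eventually_straighten_mem (G := G) hv hy 0
  refine ⟨hfam, h.eventually.mono fun d' h' => h'.straighten_zero y, hderiv, hmaps, ?_⟩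
  obtain ⟨s, hs, hnear⟩ := eventually_isNearId hfam hderiv hmaps
  obtain ⟨r, hr, hstr⟩ := hv.exists_isStraight hy
  have hψr : ∀ᶠ p in 𝓝[univ ×ˢ S] (d, (0 : Euc n)),
      straighten v y G p.1 p.2 ∈ Metric.ball (0 : Euc n) r := by
    have h1 := (hfam.self_of_nhdsWithin ⟨mem_univ _, h0S⟩).continuousWithinAt
    refine h1.eventually (Metric.isOpen_ball.mem_nhds ?_)
    simp [h.straighten_zero y, hr]
  refine eventually_quadrant_iff (w := 0).2 ?_
  have htend := continuous_fst.tendsto (d, (0 : Quadrant n K.index))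
  have hB : ∀ᶠ p : D × Quadrant n K.index in 𝓝 (d, 0), p.2.1 ∈ Metric.ball (0 : Euc n) s :=
    ((continuous_subtype_val.comp continuous_snd).tendsto
      (d, (0 : Quadrant n K.index))).eventually (Metric.ball_mem_nhds _ hs)
  filter_upwards [htend.eventually hnear, htend.eventually hstr, eventually_quadrant_iff (w := 0).1 hψr,
    hB, h.diffeo, h.eventually_mem_source hy] with p h1 h2 h3 h4 h5 h6 i hi hpi
  refine h1.apply_eq_zero ⟨p.2.2, h4⟩ ?_ hi hpi
  have hN := h5.image_mem_nhds_quadrant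
    ((Metric.isOpen_ball.preimage continuous_subtype_val).mem_nhds h4)
  set ψ := straighten v y G p.1
  have hψ : ψ p.2.1 = ContinuousLinearMap.inverse (matrixCoords v y p.1)
      (E (G p.1 p.2) - baseCoords v y p.1) := by
    simp only [ψ, straighten, quadrantModel_symm_coe, E]
  have hψS : ψ p.2.1 ∈ S := hψ ▸ h2.inv_mem _
  have hval : E.symm (baseCoords v y p.1 + matrixCoords v y p.1 (ψ p.2.1)) = G p.1 p.2 := by
    rw [hψ, h2.apply_inverse, add_sub_cancel]
    exact E.left_inv h6
  have hball : ∀ᶠ u in 𝓝[S] (ψ p.2.1), u ∈ S ∩ Metric.ball (0 : Euc n) r :=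
    Filter.inter_mem self_mem_nhdsWithin
      (mem_nhdsWithin_of_mem_nhds (Metric.isOpen_ball.mem_nhds h3))
  -- Openness of `G` is pulled back along the continuous map from straight coordinates to `X`.
  have hσ : ContinuousWithinAt
      (fun u => E.symm (baseCoords v y p.1 + matrixCoords v y p.1 u))
      (S ∩ Metric.ball (0 : Euc n) r) (ψ p.2.1) := by
    refine ((continuousOn_extChartAt_symm y).comp
      (f := fun u => baseCoords v y p.1 + matrixCoords v y p.1 u) (by fun_prop)
      fun u hu => h2.target u hu) _ ⟨hψS, h3⟩
  have hσ' : Tendsto (fun u => E.symm (baseCoords v y p.1 + matrixCoords v y p.1 u))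
      (𝓝[S] (ψ p.2.1)) (𝓝 (G p.1 p.2)) := by
    have := hσ.tendsto
    rw [hval] at this
    refine this.mono_left ?_
    rw [nhdsWithin_inter_of_mem' (mem_nhdsWithin_of_mem_nhds (Metric.isOpen_ball.mem_nhds h3))]
  filter_upwards [hσ'.eventually hN, hball] with u hu hur
  obtain ⟨w', hw', hwu⟩ := hu
  refine ⟨w'.1, ⟨w'.2, hw'⟩, ?_⟩
  simp only [ψ, straighten, quadrantModel_symm_coe, hwu]
  rw [E.right_inv (h2.target u hur), add_sub_cancel_left, h2.inverse_apply]

end IsGermLiftAt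

end GermLifts

end

noncomputable section

/-! ### Extension of germ lifts over the parameter space -/

section Gluing

open Filter

variable {n : ℕ} {X : Type*} [TopologicalSpace X] [ChartedSpace (EuclideanQuadrant n) X]
  {D : Type*} [TopologicalSpace D] [IsManifold (cornerModel n) ∞ X]

variable {K : Stratum n X} {v : D → HomBundle n X} {G : D → Quadrant n K.index → X} {d : D}

open Classical in
-- In one chart, the straightened germ is interpolated with the identity, which is always a valid
-- germ. The cutoff keeps `G` near `A` and gives the identity where `G` may fail to be a germ lift.
theorem exists_isGermLiftAt_union [NormalSpace D] (hv : IsFrameFamily K v) {y : X} {A k : Set D}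
    (hA : IsClosed A) (hk : ∀ d ∈ k, (v d).proj ∈ (extChartAt (cornerModel n) y).source)
    (hG : ∀ d ∈ A, IsGermLiftAt K v G d) :
    ∃ G' : D → Quadrant n K.index → X, (∀ᶠ d in 𝓝ˢ A, G' d = G d) ∧
      ∀ d ∈ A ∪ k, IsGermLiftAt K v G' d := by
  set U := {d | (v d).proj ∈ (extChartAt (cornerModel n) y).source}
  have hU : IsOpen U := (isOpen_extChartAt_source y).preimage hv.continuous_proj
  set O := {d | IsGermLiftAt K v G d}
  have hO : IsOpen O := isOpen_iff_eventually.2 fun d hd => IsGermLiftAt.eventually hd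
  -- Two nested neighbourhoods of `A` are needed so that `μ` is `1` on the inner one and vanishes
  -- locally around every point outside `O`.
  obtain ⟨V₁, hV₁, hAV₁, hV₁O⟩ := normal_exists_closure_subset hA hO hG
  obtain ⟨V₂, hV₂, hV₁₂, hV₂O⟩ := normal_exists_closure_subset isClosed_closure hO hV₁O
  obtain ⟨μ, hμ0, hμ1, hμ01⟩ := exists_continuous_zero_one_of_isClosed hV₂.isClosed_compl
    isClosed_closure (disjoint_compl_left_iff_subset.2 hV₁₂)
  have hμV₁ : ∀ d ∈ V₁, μ d = 1 := fun d hd => hμ1 (subset_closure hd)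
  set ψ : D → Euc n → Euc n := fun d u => μ d • straighten v y G d u + (1 - μ d) • u
  -- Where `μ = 1`, `G` is kept unchanged: unstraightening its straightened form recovers it only
  -- near the origin.
  set G' : D → Quadrant n K.index → X := fun d =>
    if d ∈ U ∧ μ d < 1 then unstraighten v y ψ d else G d
  have hG'V₁ : ∀ d ∈ V₁, G' d = G d := fun d hd => if_neg fun h => h.2.ne (hμV₁ d hd)
  refine ⟨G', mem_of_superset (hV₁.mem_nhdsSet.2 hAV₁) hG'V₁, fun d hd => ?_⟩
  by_cases hdU : d ∈ U
  · have hev : ∀ᶠ p in 𝓝 (d, (0 : Quadrant n K.index)), p.1 ∈ U :=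
      (continuous_fst.tendsto (d, (0 : Quadrant n K.index))).eventually (hU.mem_nhds hdU)
    by_cases hdO : d ∈ O
    · refine (((hdO.isNearIdFamilyAt hv hdU).lineMap μ.continuous hμ01).isGermLiftAt hv hdU).congr ?_
      filter_upwards [hev, hdO.eventually_unstraighten_straighten hv hdU] with p h1 h2
      rcases (hμ01 p.1).2.lt_or_eq with h3 | h3
      · exact congrFun (if_pos ⟨h1, h3⟩) p.2
      · refine (congrFun (if_neg fun h => h.2.ne h3) p.2).trans ?_
        rw [← h2]
        simp only [unstraighten, h3, one_smul, sub_self, zero_smul, add_zero]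
    · have hμd : ∀ᶠ d' in 𝓝 d, μ d' = 0 := by
        filter_upwards [isClosed_closure.isOpen_compl.mem_nhds fun h => hdO (hV₂O h)] with d' h1
        exact hμ0 fun h => h1 (subset_closure h)
      have h1 : IsNearIdFamilyAt K.index ψ d := (IsNearIdFamilyAt.id K.index d).congr <|
        hμd.mono fun d' h => by ext u; simp [ψ, h]
      refine (h1.isGermLiftAt hv hdU).congr ?_
      filter_upwards [hev, (continuous_fst.tendsto (d, (0 : Quadrant n K.index))).eventually hμd]
        with p h1 h2
      exact congrFun (if_pos ⟨h1, by rw [h2]; exact one_pos⟩) p.2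
  · have hdA : d ∈ A := hd.resolve_right fun h => hdU (hk d h)
    refine (hG d hdA).congr ?_
    filter_upwards [(continuous_fst.tendsto (d, (0 : Quadrant n K.index))).eventually
      (hV₁.mem_nhds (hAV₁ hdA))] with p hp
    rw [hG'V₁ _ hp]

/-- Finitely many closed sets, each with base points in a single chart, cover `D`; the extension is
made over them one at a time. -/
theorem exists_isGermLiftAt [CompactSpace D] [T2Space D] (hv : IsFrameFamily K v) {C : Set D}
    (hC : IsClosed C) (hG : ∀ d ∈ C, IsGermLiftAt K v G d) :
    ∃ G' : D → Quadrant n K.index → X, (∀ᶠ d in 𝓝ˢ C, G' d = G d) ∧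
      ∀ d, IsGermLiftAt K v G' d := by
  have h1 : ∀ d : D, ∃ k ∈ 𝓝 d, IsClosed k ∧
      k ⊆ {d' | (v d').proj ∈ (extChartAt (cornerModel n) (v d).proj).source} := fun d =>
    exists_mem_nhds_isClosed_subset (hv.eventually_mem_source (mem_extChartAt_source _))
  choose k hk hkc hks using h1
  obtain ⟨t, ht⟩ := CompactSpace.elim_nhds_subcover k hk
  have h2 : ∀ t : Finset D, ∃ G' : D → Quadrant n K.index → X, (∀ᶠ d in 𝓝ˢ C, G' d = G d) ∧
      ∀ d ∈ C ∪ ⋃ x ∈ t, k x, IsGermLiftAt K v G' d := by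
    classical
    intro t
    induction t using Finset.induction_on with
    | empty => exact ⟨G, Eventually.of_forall fun _ => rfl, by simpa using hG⟩
    | insert x t _ ih =>
      obtain ⟨G₁, h1, h2⟩ := ih
      obtain ⟨G₂, h3, h4⟩ := exists_isGermLiftAt_union hv
        (hC.union (t.finite_toSet.isClosed_biUnion fun x _ => hkc x)) (hks x) h2
      refine ⟨G₂, ?_, ?_⟩
      · filter_upwards [h1, h3.filter_mono (nhdsSet_mono subset_union_left)] with d h5 h6
        rw [h6, h5]
      · rw [Finset.set_biUnion_insert, union_comm (k x), ← union_assoc]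
        exact h4
  obtain ⟨G', h3, h4⟩ := h2 t
  exact ⟨G', h3, fun d => h4 d (Or.inr (ht ▸ mem_univ d))⟩

end Gluing

end

noncomputable section

/-! ### Shrinking quadrants into balls -/

section Shrinking

open Filter

variable {n q : ℕ}

/-- The map `w ↦ ρ(w) w` of a quadrant. -/
def quadrantScale (ρ : Euc n → ℝ) (hρ : ∀ u, 0 ≤ ρ u) (w : Quadrant n q) : Quadrant n q :=
  ⟨ρ w.1 • w.1, fun i hi => mul_nonneg (hρ _) (w.2 i hi)⟩

theorem contMDiffAt_quadrantScale {ρ : Euc n → ℝ} (hρ : ∀ u, 0 ≤ ρ u) {w : Quadrant n q}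
    (h : ContDiffAt ℝ ∞ ρ w.1) :
    ContMDiffAt (quadrantModel n q) (quadrantModel n q) ∞ (quadrantScale ρ hρ) w := by
  have h1 : ContDiffAt ℝ ∞ (fun u => ρ u • u) w.1 := h.smul contDiffAt_id
  rw [contMDiffAt_iff]
  refine ⟨?_, ?_⟩
  · rw [ContinuousAt, tendsto_subtype_rng]
    exact h1.continuousAt.comp (f := Subtype.val) continuous_subtype_val.continuousAt
  · rw [range_quadrantModel]
    refine h1.contDiffWithinAt.congr_of_mem (fun u hu => ?_) w.2
    change ρ ((quadrantModel n q).symm u).1 • ((quadrantModel n q).symm u).1 = _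
    rw [coe_quadrantModel_symm hu]

/-- The factor by which `shrink s` scales a vector. -/
def shrinkFactor (s : ℝ) (u : Euc n) : ℝ := (√(1 + s ^ 2 * ‖u‖ ^ 2))⁻¹

theorem shrinkFactor_nonneg (s : ℝ) (u : Euc n) : 0 ≤ shrinkFactor s u := by
  unfold shrinkFactor; positivity

theorem contDiff_shrinkFactor : ContDiff ℝ ∞ fun p : ℝ × Euc n => shrinkFactor p.1 p.2 := by
  have h1 : ContDiff ℝ ∞ fun p : ℝ × Euc n => 1 + p.1 ^ 2 * ‖p.2‖ ^ 2 :=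
    contDiff_const.add ((contDiff_fst.pow 2).mul (contDiff_snd.norm_sq ℝ))
  exact (h1.sqrt fun p => by positivity).inv fun p => by positivity

theorem contDiff_shrinkFactor_right (s : ℝ) : ContDiff ℝ ∞ (shrinkFactor s : Euc n → ℝ) :=
  contDiff_shrinkFactor.comp (g := fun p : ℝ × Euc n => shrinkFactor p.1 p.2)
    (f := fun u => (s, u)) (by fun_prop)

/-- The diffeomorphism `w ↦ w / √(1 + s²|w|²)` from a quadrant to its intersection with the ball of
radius `1 / s`. -/
def shrink (s : ℝ) : Quadrant n q → Quadrant n q :=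
  quadrantScale (shrinkFactor s) (shrinkFactor_nonneg s)

theorem shrink_coe (s : ℝ) (w : Quadrant n q) : (shrink s w).1 = shrinkFactor s w.1 • w.1 := rfl

theorem shrink_apply_zero (s : ℝ) : shrink s (0 : Quadrant n q) = 0 :=
  Subtype.ext (smul_zero (shrinkFactor s (0 : Euc n)))

theorem shrink_zero (w : Quadrant n q) : shrink 0 w = w :=
  Subtype.ext (by simp [shrink_coe, shrinkFactor])

theorem shrink_mem_deepestStratum (s : ℝ) {w : Quadrant n q} (hw : w ∈ deepestStratum n q) :
    shrink s w ∈ deepestStratum n q := fun i hi => by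
  simp [shrink_coe, hw i hi]

/-- This identity recovers the scaling factor from the image point, which gives injectivity, the
explicit inverse and the radius of the image. -/
theorem sq_mul_norm_shrink (s : ℝ) (w : Quadrant n q) :
    1 - s ^ 2 * ‖(shrink s w).1‖ ^ 2 = shrinkFactor s w.1 ^ 2 := by
  have h : 0 < 1 + s ^ 2 * ‖w.1‖ ^ 2 := by positivity
  rw [shrink_coe, norm_smul, mul_pow, Real.norm_eq_abs, sq_abs, shrinkFactor, inv_pow,
    Real.sq_sqrt h.le]
  field_simp
  ring

theorem shrinkFactor_pos (s : ℝ) (u : Euc n) : 0 < shrinkFactor s u := by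
  unfold shrinkFactor; positivity

theorem norm_shrink_lt {r s : ℝ} (hr : 0 < r) (hs : 1 ≤ r * s) (w : Quadrant n q) :
    ‖(shrink s w).1‖ < r := by
  have h1 := sq_mul_norm_shrink s w
  have h2 : 0 < shrinkFactor s w.1 ^ 2 := pow_pos (shrinkFactor_pos s w.1) 2
  have h3 : (s * ‖(shrink s w).1‖) ^ 2 < 1 := by rw [mul_pow]; linarith
  have h4 : s * ‖(shrink s w).1‖ < 1 := lt_of_pow_lt_pow_left₀ 2 zero_le_one (by simpa using h3)
  by_contra h5
  push Not at h5
  have hs0 : 0 < s := pos_of_mul_pos_right (zero_lt_one.trans_le hs) hr.le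
  nlinarith

/-- The inverse is `w ↦ w / √(1 - s²‖w‖²)` on the open set where the radicand is positive; elsewhere
the scaling factor defaults to `0`, which still maps into the quadrant. -/
theorem isLocalDiffeomorphAt_shrink (s : ℝ) (w : Quadrant n q) :
    IsLocalDiffeomorphAt (quadrantModel n q) (quadrantModel n q) ∞ (shrink s) w := by
  have hexp : ∀ u : Euc n, 0 ≤ (√(1 - s ^ 2 * ‖u‖ ^ 2))⁻¹ := fun u => by positivity
  have hopen : IsOpen {w : Quadrant n q | 0 < 1 - s ^ 2 * ‖w.1‖ ^ 2} :=
    isOpen_lt continuous_const (by fun_prop)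
  have hmaps : ∀ w : Quadrant n q, 0 < 1 - s ^ 2 * ‖(shrink s w).1‖ ^ 2 := fun w => by
    rw [sq_mul_norm_shrink]
    exact pow_pos (shrinkFactor_pos s w.1) 2
  refine ⟨⟨⟨shrink s, quadrantScale _ hexp, univ, {w | 0 < 1 - s ^ 2 * ‖w.1‖ ^ 2},
    fun w _ => hmaps w, fun _ _ => mem_univ _, fun w _ => Subtype.ext ?_,
    fun w hw => Subtype.ext ?_⟩, isOpen_univ, hopen, fun w _ => ?_, fun w hw => ?_⟩, mem_univ _,
    fun _ _ => rfl⟩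
  · change (√(1 - s ^ 2 * ‖(shrink s w).1‖ ^ 2))⁻¹ • (shrink s w).1 = w.1
    rw [sq_mul_norm_shrink, Real.sqrt_sq (shrinkFactor_nonneg s _), shrink_coe, smul_smul,
      inv_mul_cancel₀ (shrinkFactor_pos s _).ne', one_smul]
  · have hw : 0 < 1 - s ^ 2 * ‖w.1‖ ^ 2 := hw
    change shrinkFactor s ((√(1 - s ^ 2 * ‖w.1‖ ^ 2))⁻¹ • w.1) •
      ((√(1 - s ^ 2 * ‖w.1‖ ^ 2))⁻¹ • w.1) = w.1
    have h1 : shrinkFactor s ((√(1 - s ^ 2 * ‖w.1‖ ^ 2))⁻¹ • w.1) = √(1 - s ^ 2 * ‖w.1‖ ^ 2) := by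
      rw [shrinkFactor, norm_smul, mul_pow, Real.norm_eq_abs, sq_abs, inv_pow, Real.sq_sqrt hw.le,
        ← Real.sqrt_inv]
      congr 1
      field_simp
      ring
    rw [h1, smul_smul, mul_inv_cancel₀ (Real.sqrt_pos.2 hw).ne', one_smul]
  · exact (contMDiffAt_quadrantScale (shrinkFactor_nonneg s)
      (contDiff_shrinkFactor_right s).contDiffAt).contMDiffWithinAt
  · refine (contMDiffAt_quadrantScale hexp ?_).contMDiffWithinAt
    have h1 : ContDiff ℝ ∞ fun u : Euc n => 1 - s ^ 2 * ‖u‖ ^ 2 :=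
      contDiff_const.sub (contDiff_const.mul (contDiff_id.norm_sq ℝ))
    exact (h1.contDiffAt.sqrt (ne_of_gt hw)).inv (Real.sqrt_pos.2 hw).ne'

theorem shrink_injective (s : ℝ) : Function.Injective (shrink s : Quadrant n q → Quadrant n q) := by
  intro w w' h
  have h1 : shrinkFactor s w.1 = shrinkFactor s w'.1 := by
    refine (pow_left_inj₀ (shrinkFactor_nonneg s _) (shrinkFactor_nonneg s _) two_ne_zero).1 ?_
    rw [← sq_mul_norm_shrink, ← sq_mul_norm_shrink, h]
  have h2 := congrArg Subtype.val h
  rw [shrink_coe, shrink_coe, h1] at h2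
  exact Subtype.ext (smul_right_injective _ (shrinkFactor_pos s _).ne' h2)

theorem continuous_shrink : Continuous fun p : ℝ × Quadrant n q => shrink p.1 p.2 :=
  ((contDiff_shrinkFactor.continuous.comp (f := fun p : ℝ × Quadrant n q => (p.1, p.2.1))
    (by fun_prop)).smul (continuous_subtype_val.comp continuous_snd)).subtype_mk _

variable {X : Type*} [TopologicalSpace X] [ChartedSpace (EuclideanQuadrant n) X]

/-- The scaling factor is `1` at the origin, and its own derivative is multiplied by the zero
vector. -/
theorem hasMFDerivAt_shrink (s : ℝ) : HasMFDerivAt (quadrantModel n q) (quadrantModel n q)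
    (shrink s) (0 : Quadrant n q) (ContinuousLinearMap.id ℝ (Euc n)) := by
  refine ⟨(isLocalDiffeomorphAt_shrink s 0).contMDiffAt.continuousAt, ?_⟩
  have h1 : HasFDerivAt (fun u : Euc n => shrinkFactor s u • u) (ContinuousLinearMap.id ℝ (Euc n))
      0 := by
    have h2 : DifferentiableAt ℝ (shrinkFactor s : Euc n → ℝ) 0 :=
      (contDiff_shrinkFactor_right s).differentiable (by simp) 0
    have h3 := h2.hasFDerivAt.smul (hasFDerivAt_id (0 : Euc n))
    refine h3.congr_fderiv ?_
    ext1 u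
    simp [shrinkFactor]
  rw [range_quadrantModel]
  refine h1.hasFDerivWithinAt.congr' (fun u hu => ?_) (zero_mem_quadrantSet n q)
  change shrinkFactor s ((quadrantModel n q).symm u).1 • ((quadrantModel n q).symm u).1 = _
  rw [coe_quadrantModel_symm hu]

theorem originJet_comp_shrink {φ : Quadrant n q → X} [IsManifold (cornerModel n) ∞ X]
    (hφ : MDifferentiableAt (quadrantModel n q) (cornerModel n) φ 0) (s : ℝ) :
    originJet (φ ∘ shrink s) = originJet φ := by
  -- `shrink s 0 = 0` holds only propositionally, so the derivative is stated at any point equal to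
  -- `0`.
  have h1 : ∀ w : Quadrant n q, w = 0 → HasMFDerivAt (quadrantModel n q) (cornerModel n) φ w
      (mfderiv (quadrantModel n q) (cornerModel n) φ 0 : Euc n →L[ℝ] Euc n) := by
    rintro _ rfl
    exact hφ.hasMFDerivAt
  refine homBundle_ext (congrArg φ (shrink_apply_zero s)) ?_
  exact ((h1 _ (shrink_apply_zero s)).comp 0 (hasMFDerivAt_shrink s)).mfderiv

theorem SmoothMapFamilyAt.comp_shrink {D : Type*} [TopologicalSpace D]
    [IsManifold (cornerModel n) ∞ X] {G : D → Quadrant n q → X} {s : D → ℝ} {d : D}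
    {w : Quadrant n q} (hs : ContinuousAt s d) (h : SmoothMapFamilyAt G (d, shrink (s d) w)) :
    SmoothMapFamilyAt (fun d => G d ∘ shrink (s d)) (d, w) := by
  refine ⟨?_, ?_⟩
  · have h1 : ContinuousAt (fun p : D × Quadrant n q => (p.1, shrink (s p.1) p.2)) (d, w) :=
      continuousAt_fst.prodMk (continuous_shrink.continuousAt.comp
        (f := fun p : D × Quadrant n q => (s p.1, p.2))
        ((hs.comp (x := (d, w)) continuousAt_fst).prodMk continuousAt_snd))
    exact h.cont.comp (f := fun p : D × Quadrant n q => (p.1, shrink (s p.1) p.2)) h1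
  · have hmem : ∀ d' (u : Euc n), u ∈ quadrantSet n q → shrinkFactor (s d') u • u ∈ quadrantSet n q :=
      fun d' u hu i hi => mul_nonneg (shrinkFactor_nonneg _ _) (hu i hi)
    have h1 : SmoothFamilyAt (fun d' (u : Euc n) => shrinkFactor (s d') u • u) (quadrantSet n q)
        (d, w.1) :=
      SmoothFamilyAt.of_contDiff (g := fun p : ℝ × Euc n => shrinkFactor p.1 p.2 • p.2)
        (contDiff_shrinkFactor.smul contDiff_snd) hs (uniqueDiffOn_quadrantSet n q) w.2
    have h2 := SmoothFamilyAt.comp (uniqueDiffOn_quadrantSet n q) (uniqueDiffOn_quadrantSet n q)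
      (p := (d, w.1)) w.2 h.smooth h1 (eventually_mem_nhdsWithin.mono fun p hp => hmem _ _ hp.2)
    refine h2.congr w.2 ?_
    filter_upwards [self_mem_nhdsWithin] with p hp
    have h3 : shrink (s p.1) ((quadrantModel n q).symm p.2) =
        (quadrantModel n q).symm (shrinkFactor (s p.1) p.2 • p.2) := by
      refine Subtype.ext ?_
      rw [coe_quadrantModel_symm (hmem _ _ hp.2), shrink_coe, coe_quadrantModel_symm hp.2]
    simp only [Function.comp_apply, h3]

end Shrinking

end

noncomputable section

/-! ### From germs to embeddings, and the relative lifting property -/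

section Lifting

open Filter

/-- A point determines its index, and then its component. -/
theorem Stratum.eq_of_mem {n : ℕ} {X : Type*} [TopologicalSpace X]
    [ChartedSpace (EuclideanQuadrant n) X] {K L : Stratum n X} {x : X} (hK : x ∈ K.carrier)
    (hL : x ∈ L.carrier) : K = L := by
  have h1 : K.index = L.index := (K.cornerIndex_eq hK).symm.trans (L.cornerIndex_eq hL)
  have h2 : ∀ M : Stratum n X, x ∈ M.carrier →
      M.carrier = connectedComponentIn {y : X | cornerIndex n y = M.index} x := by
    intro M hM
    obtain ⟨y, -, hy⟩ := M.isComponent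
    rw [hy] at hM ⊢
    exact connectedComponentIn_eq hM
  have h3 : K.carrier = L.carrier := by rw [h2 K hK, h2 L hL, h1]
  cases K
  cases L
  cases h1
  cases h3
  rfl

theorem eventually_quadrant_prod_exists {D : Type*} [TopologicalSpace D] {n q q' : ℕ} {d : D}
    {P : D × Quadrant n q × Quadrant n q' → Prop} (h : ∀ᶠ p in 𝓝 (d, (0, 0)), P p) :
    ∃ r > 0, ∀ᶠ d' in 𝓝 d, ∀ (w : Quadrant n q) (w' : Quadrant n q'), ‖w.1‖ < r → ‖w'.1‖ < r →
      P (d', (w, w')) := by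
  rw [nhds_prod_eq, eventually_prod_iff] at h
  obtain ⟨pa, ha, pb, hb, hP⟩ := h
  obtain ⟨r, hr, hb⟩ := Metric.eventually_nhds_iff.1 hb
  refine ⟨r, hr, ha.mono fun d' hd' w w' hw hw' => hP hd' (hb ?_)⟩
  rw [Prod.dist_eq, max_lt_iff, Subtype.dist_eq, Subtype.dist_eq, Quadrant.coe_zero,
    Quadrant.coe_zero, dist_zero_right, dist_zero_right]
  exact ⟨hw, hw'⟩

theorem eventually_quadrant_exists {D : Type*} [TopologicalSpace D] {n q : ℕ} {d : D}
    {P : D × Quadrant n q → Prop} (h : ∀ᶠ p in 𝓝 (d, 0), P p) :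
    ∃ r > 0, ∀ᶠ d' in 𝓝 d, ∀ w : Quadrant n q, ‖w.1‖ < r → P (d', w) := by
  have h1 : Tendsto (fun p : D × Quadrant n q × Quadrant n q => (p.1, p.2.1)) (𝓝 (d, (0, 0)))
      (𝓝 (d, 0)) := Continuous.tendsto (by fun_prop) (d, (0, 0))
  obtain ⟨r, hr, h2⟩ := eventually_quadrant_prod_exists (h1.eventually h)
  exact ⟨r, hr, h2.mono fun d' h w hw => h w w hw hw⟩

/-- In a compact space, radii that work near each point give a radius that works everywhere. -/
theorem exists_radius {D : Type*} [TopologicalSpace D] [CompactSpace D] {Q : D → ℝ → Prop}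
    (hmono : ∀ d r s, s ≤ r → Q d r → Q d s) (h : ∀ d, ∃ r > 0, ∀ᶠ d' in 𝓝 d, Q d' r) :
    ∃ r > 0, ∀ d, Q d r := by
  have := isCompact_univ.induction_on (p := fun s : Set D => ∃ r > 0, ∀ d ∈ s, Q d r)
    ⟨1, one_pos, by simp⟩ (fun s t hst ⟨r, hr, ht⟩ => ⟨r, hr, fun d hd => ht d (hst hd)⟩)
    (fun s t ⟨r, hr, hs⟩ ⟨r', hr', ht⟩ => ⟨min r r', lt_min hr hr', fun d hd =>
      hd.elim (fun hd => hmono _ _ _ (min_le_left _ _) (hs d hd))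
        fun hd => hmono _ _ _ (min_le_right _ _) (ht d hd)⟩)
    (fun d _ => by
      obtain ⟨r, hr, h⟩ := h d
      exact ⟨_, mem_nhdsWithin_of_mem_nhds h, r, hr, fun _ h => h⟩)
  obtain ⟨r, hr, h⟩ := this
  exact ⟨r, hr, fun d => h d (mem_univ d)⟩

variable {n : ℕ} {X : Type*} [TopologicalSpace X] [ChartedSpace (EuclideanQuadrant n) X]
  [IsManifold (cornerModel n) ∞ X] {ι : Type*} {Z : ι → Stratum n X}
  {D : Type*} [TopologicalSpace D]

theorem continuous_derivAtOrigins (Z : ι → Stratum n X) : Continuous (derivAtOrigins Z) := by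
  refine continuous_pi fun K => continuous_induced_rng.2 (continuous_pi ?_)
  rintro ⟨j, rfl⟩
  have hc : Continuous fun φ : StratEmb n Z => φ.1 := continuous_induced_dom
  exact continuous_iff_continuousAt.2 fun φ =>
    (smoothMapFamilyAt_of_continuousAt hc.continuousAt j 0).continuousAt_originJet

/-- The frame at the `j`-th point of a configuration. -/
def frameAt (v : ∀ K : Stratum n X, InnerFrameConf n {j // Z j = K} K) (j : ι) : HomBundle n X :=
  (v (Z j)).1 ⟨j, rfl⟩

theorem frameAt_derivAtOrigins (φ : StratEmb n Z) (j : ι) :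
    frameAt (derivAtOrigins Z φ) j = originJet fun w => φ.1.1 ⟨j, w⟩ := rfl

theorem ext_frameAt {v w : ∀ K : Stratum n X, InnerFrameConf n {j // Z j = K} K}
    (h : ∀ j, frameAt v j = frameAt w j) : v = w := by
  funext K
  refine Subtype.ext (funext ?_)
  rintro ⟨j, rfl⟩
  exact h j

/-- Points in the same stratum are distinct by the configuration condition, and distinct strata are
disjoint. -/
theorem frameAt_proj_injective (v : ∀ K : Stratum n X, InnerFrameConf n {j // Z j = K} K) :
    Function.Injective fun j => (frameAt v j).proj := by
  intro i j hij
  have hi := (v (Z i)).2.1 ⟨i, rfl⟩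
  have hj := (v (Z j)).2.1 ⟨j, rfl⟩
  have hZ : Z j = Z i := Stratum.eq_of_mem hj (by
    change (frameAt v j).proj ∈ _
    rw [← show (frameAt v i).proj = (frameAt v j).proj from hij]
    exact hi)
  have h1 : ∀ (K : Stratum n X) (h : Z j = K), (v K).1 ⟨j, h⟩ = frameAt v j := by
    rintro _ rfl
    rfl
  have h2 : (⟨i, rfl⟩ : {k // Z k = Z i}) = ⟨j, hZ⟩ := (v (Z i)).2.2.1 (by
    change (frameAt v i).proj = ((v (Z i)).1 ⟨j, hZ⟩).proj
    rw [h1]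
    exact hij)
  exact congrArg Subtype.val h2

theorem isFrameFamily_frameAt {v : D → ∀ K : Stratum n X, InnerFrameConf n {j // Z j = K} K}
    (hv : Continuous v) (j : ι) : IsFrameFamily (Z j) fun d => frameAt (v d) j := by
  refine ⟨?_, fun d => ⟨(v d (Z j)).2.1 _, (v d (Z j)).2.2.2 _⟩⟩
  have h1 : Continuous fun F : InnerFrameConf n {i // Z i = Z j} (Z j) => F.1 :=
    continuous_induced_dom
  exact (continuous_apply _).comp (h1.comp ((continuous_apply (Z j)).comp hv))

open Classical in
/-- The maps `ℝ^{Z(j)} → X` of a family of embeddings on `W`, extended by constant maps. -/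
def extendedFamily {W : Set D} (g : W → StratEmb n Z) (c : D → X) (j : ι) (d : D)
    (w : Quadrant n (Z j).index) : X :=
  if h : d ∈ W then (g ⟨d, h⟩).1.1 ⟨j, w⟩ else c d

omit [IsManifold (cornerModel n) ∞ X] [TopologicalSpace D] in
theorem extendedFamily_of_mem {W : Set D} (g : W → StratEmb n Z) (c : D → X) (j : ι) {d : D}
    (h : d ∈ W) : extendedFamily g c j d = fun w => (g ⟨d, h⟩).1.1 ⟨j, w⟩ := by
  ext w
  exact dif_pos h

theorem smoothMapFamilyAt_extendedFamily {W : Set D} (hW : IsOpen W) {g : W → StratEmb n Z}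
    (hg : Continuous g) (c : D → X) (j : ι) {d : D} (hd : d ∈ W) (w : Quadrant n (Z j).index) :
    SmoothMapFamilyAt (extendedFamily g c j) (d, w) := by
  classical
  -- Off the open set `W` any smooth map would do as a value.
  set gD : D → SmoothMaps n X fun j => (Z j).index :=
    fun d' => if h : d' ∈ W then (g ⟨d', h⟩).1 else (g ⟨d, hd⟩).1
  have hc : ContinuousAt gD d := by
    refine (hW.isOpenEmbedding_subtypeVal.continuousAt_iff (x := ⟨d, hd⟩)).1 ?_
    have h1 : gD ∘ Subtype.val = fun d' : W => (g d').1 := by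
      ext1 d'
      exact dif_pos d'.2
    rw [h1]
    have h2 : Continuous fun φ : StratEmb n Z => φ.1 := continuous_induced_dom
    exact (h2.comp hg).continuousAt
  refine (smoothMapFamilyAt_of_continuousAt hc j w).congr ?_
  filter_upwards [(continuous_fst.tendsto (d, w)).eventually (hW.mem_nhds hd)] with p hp
  have h1 : gD p.1 = (g ⟨p.1, hp⟩).1 := dif_pos hp
  rw [extendedFamily_of_mem g c j hp, h1]

theorem isGermLiftAt_extendedFamily {W : Set D} (hW : IsOpen W) {g : W → StratEmb n Z}
    (hg : Continuous g) (c : D → X) (j : ι)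
    {v : D → ∀ K : Stratum n X, InnerFrameConf n {j // Z j = K} K}
    (hgv : ∀ d, derivAtOrigins Z (g d) = v d) {d : D} (hd : d ∈ W) :
    IsGermLiftAt (Z j) (fun d => frameAt (v d) j) (extendedFamily g c j) d := by
  have hev : ∀ᶠ d' in 𝓝 d, d' ∈ W := hW.mem_nhds hd
  have hev' : ∀ᶠ p in 𝓝 (d, (0 : Quadrant n (Z j).index)), p.1 ∈ W :=
    (continuous_fst.tendsto (d, (0 : Quadrant n (Z j).index))).eventually hev
  refine ⟨?_, ?_, ?_, ?_, ?_⟩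
  · filter_upwards [hev'] with p hp using smoothMapFamilyAt_extendedFamily hW hg c j hp p.2
  · filter_upwards [hev'] with p hp
    rw [extendedFamily_of_mem g c j hp]
    exact (g ⟨p.1, hp⟩).2.2.1 j p.2
  · filter_upwards [hev'] with p hp hdeep
    rw [extendedFamily_of_mem g c j hp]
    exact (g ⟨p.1, hp⟩).2.2.2 j p.2 hdeep
  · filter_upwards [(continuous_fst.tendsto
      (d, ((0, 0) : Quadrant n (Z j).index × Quadrant n (Z j).index))).eventually hev] with p hp h
    rw [extendedFamily_of_mem g c j hp] at h
    exact eq_of_heq (Sigma.mk.inj_iff.1 ((g ⟨p.1, hp⟩).2.1.injective h)).2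
  · filter_upwards [hev] with d' hd'
    rw [extendedFamily_of_mem g c j hd', ← hgv ⟨d', hd'⟩, frameAt_derivAtOrigins]

/-- The maps `G j d` restrict to an embedding of the disjoint union of the balls of radius `r`. -/
structure IsEmbeddingOfBalls (Z : ι → Stratum n X) (G : ∀ j, D → Quadrant n (Z j).index → X)
    (d : D) (r : ℝ) : Prop where
  family : ∀ j (w : Quadrant n (Z j).index), ‖w.1‖ < r → SmoothMapFamilyAt (G j) (d, w)
  diffeo : ∀ j (w : Quadrant n (Z j).index), ‖w.1‖ < r →
    IsLocalDiffeomorphAt (quadrantModel n (Z j).index) (cornerModel n) ∞ (G j d) w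
  carrier : ∀ j (w : Quadrant n (Z j).index), ‖w.1‖ < r → w ∈ deepestStratum n (Z j).index →
    G j d w ∈ (Z j).carrier
  inj : ∀ i j (w : Quadrant n (Z i).index) (w' : Quadrant n (Z j).index), ‖w.1‖ < r → ‖w'.1‖ < r →
    G i d w = G j d w' → (⟨i, w⟩ : Quadrants n fun j => (Z j).index) = ⟨j, w'⟩

omit [IsManifold (cornerModel n) ∞ X] in
theorem IsEmbeddingOfBalls.mono {G : ∀ j, D → Quadrant n (Z j).index → X} {d : D} {r s : ℝ}
    (h : IsEmbeddingOfBalls Z G d r) (hs : s ≤ r) : IsEmbeddingOfBalls Z G d s :=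
  ⟨fun j w hw => h.family j w (hw.trans_le hs), fun j w hw => h.diffeo j w (hw.trans_le hs),
    fun j w hw => h.carrier j w (hw.trans_le hs),
    fun i j w w' hw hw' => h.inj i j w w' (hw.trans_le hs) (hw'.trans_le hs)⟩

/-- Injectivity on a single quadrant is part of being a germ lift. Different quadrants have distinct
centres in the Hausdorff space `X`, so their small balls have disjoint images. Finiteness of the
index set gives a common radius. -/
theorem exists_isEmbeddingOfBalls [T2Space X] [Finite ι]
    {v : D → ∀ K : Stratum n X, InnerFrameConf n {j // Z j = K} K}
    {G : ∀ j, D → Quadrant n (Z j).index → X} {d : D}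
    (h : ∀ j, IsGermLiftAt (Z j) (fun d => frameAt (v d) j) (G j) d) :
    ∃ r > 0, ∀ᶠ d' in 𝓝 d, IsEmbeddingOfBalls Z G d' r := by
  have h1 := fun j => eventually_quadrant_exists
    ((h j).family.and ((h j).diffeo.and (h j).carrier))
  have h2 : ∀ p : ι × ι, ∃ r > 0, ∀ᶠ d' in 𝓝 d, ∀ (w : Quadrant n (Z p.1).index)
      (w' : Quadrant n (Z p.2).index), ‖w.1‖ < r → ‖w'.1‖ < r → G p.1 d' w = G p.2 d' w' →
      (⟨p.1, w⟩ : Quadrants n fun j => (Z j).index) = ⟨p.2, w'⟩ := by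
    rintro ⟨i, j⟩
    rcases eq_or_ne i j with rfl | hij
    · obtain ⟨r, hr, h3⟩ := eventually_quadrant_prod_exists (h i).inj
      exact ⟨r, hr, h3.mono fun d' h w w' hw hw' he =>
        congrArg (Sigma.mk (β := fun j => Quadrant n (Z j).index) i) (h w w' hw hw' he)⟩
    · have hne : G i d 0 ≠ G j d 0 := by
        rw [(h i).apply_zero, (h j).apply_zero]
        exact fun he => hij (frameAt_proj_injective (v d) he)
      have hci : Tendsto (fun p : D × Quadrant n (Z i).index × Quadrant n (Z j).index =>
          G i p.1 p.2.1) (𝓝 (d, (0, 0))) (𝓝 (G i d 0)) :=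
        (h i).family.self_of_nhds.cont.tendsto.comp
          (Continuous.tendsto (f := fun p : D × Quadrant n (Z i).index × Quadrant n (Z j).index =>
            (p.1, p.2.1)) (by fun_prop) (d, (0, 0)))
      have hcj : Tendsto (fun p : D × Quadrant n (Z i).index × Quadrant n (Z j).index =>
          G j p.1 p.2.2) (𝓝 (d, (0, 0))) (𝓝 (G j d 0)) :=
        (h j).family.self_of_nhds.cont.tendsto.comp
          (Continuous.tendsto (f := fun p : D × Quadrant n (Z i).index × Quadrant n (Z j).index =>
            (p.1, p.2.2)) (by fun_prop) (d, (0, 0)))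
      obtain ⟨r, hr, h3⟩ := eventually_quadrant_prod_exists ((hci.prodMk_nhds hcj).eventually
        (isClosed_diagonal.isOpen_compl.mem_nhds (x := (G i d 0, G j d 0)) hne))
      exact ⟨r, hr, h3.mono fun d' h w w' hw hw' he => absurd he (h w w' hw hw')⟩
  choose r hr h1 using h1
  choose r' hr' h2 using h2
  obtain ⟨s, hs, hsr⟩ : ∃ s > 0, (∀ j, s ≤ r j) ∧ ∀ p, s ≤ r' p := by
    have h3 : ∀ᶠ s in 𝓝[>] (0 : ℝ), (∀ j, s < r j) ∧ ∀ p, s < r' p :=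
      (eventually_all.2 fun j => nhdsWithin_le_nhds (Iio_mem_nhds (hr j))).and
        (eventually_all.2 fun p => nhdsWithin_le_nhds (Iio_mem_nhds (hr' p)))
    obtain ⟨s, hs, hs0⟩ := (h3.and self_mem_nhdsWithin).exists
    exact ⟨s, hs0, fun j => (hs.1 j).le, fun p => (hs.2 p).le⟩
  refine ⟨s, hs, ?_⟩
  filter_upwards [eventually_all.2 h1, eventually_all.2 h2] with d' h3 h4
  exact ⟨fun j w hw => (h3 j w (hw.trans_le (hsr.1 j))).1,
    fun j w hw => (h3 j w (hw.trans_le (hsr.1 j))).2.1,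
    fun j w hw => (h3 j w (hw.trans_le (hsr.1 j))).2.2,
    fun i j w w' hw hw' => h4 (i, j) w w' (hw.trans_le (hsr.2 _)) (hw'.trans_le (hsr.2 _))⟩

/-- The embedding of a disjoint union of quadrants obtained by shrinking the maps `F j`. -/
def StratEmb.ofShrink {F : ∀ j, Quadrant n (Z j).index → X} {s : ℝ}
    (hdiffeo : ∀ j w, IsLocalDiffeomorphAt (quadrantModel n (Z j).index) (cornerModel n) ∞ (F j)
      (shrink s w))
    (hcarrier : ∀ j, ∀ w ∈ deepestStratum n (Z j).index, F j (shrink s w) ∈ (Z j).carrier)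
    (hinj : ∀ i j w w', F i (shrink s w) = F j (shrink s w') →
      (⟨i, shrink s w⟩ : Quadrants n fun j => (Z j).index) = ⟨j, shrink s w'⟩) : StratEmb n Z :=
  have hd : ∀ j, IsLocalDiffeomorph (quadrantModel n (Z j).index) (cornerModel n) ∞
      (F j ∘ shrink s) := fun j w =>
    IsLocalDiffeomorphAt.comp (hf := isLocalDiffeomorphAt_shrink s w) (hg := hdiffeo j w)
  ⟨⟨fun p => F p.1 (shrink s p.2), fun j => (hd j).contMDiff⟩,
    Topology.IsOpenEmbedding.of_continuous_injective_isOpenMap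
      (continuous_sigma fun j => (hd j).contMDiff.continuous)
      (by
        rintro ⟨i, w⟩ ⟨j, w'⟩ h
        have h1 := hinj i j w w' h
        obtain rfl : i = j := congrArg Sigma.fst h1
        rw [shrink_injective s (eq_of_heq (Sigma.mk.inj_iff.1 h1).2)])
      (isOpenMap_sigma.2 fun j => (hd j).isOpenMap), hd, hcarrier⟩

/-- Extending germs keeps the given embeddings on a neighbourhood `V` of `C`. Over `V` any amount of
shrinking gives embeddings; outside `V` the quadrants are shrunk into the radius where germs are
embeddings; over `C` nothing is shrunk. -/
theorem hasRelativeLifts_derivAtOrigins [T2Space X] [Finite ι] (Z : ι → Stratum n X) :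
    HasRelativeLifts (derivAtOrigins Z) := by
  intro D _ _ _ v C W hC hW hCW g hgv
  have hv := fun j => isFrameFamily_frameAt v.continuous j
  set G₀ : ∀ j, D → Quadrant n (Z j).index → X := fun j =>
    extendedFamily g (fun d => (frameAt (v d) j).proj) j
  have h1 := fun j => exists_isGermLiftAt (hv j) hC fun d hd =>
    isGermLiftAt_extendedFamily hW g.continuous (fun d => (frameAt (v d) j).proj) j hgv (hCW hd)
  choose G hGG₀ hG using h1
  -- Over `V` the extended germs are the full given embeddings, not merely germs of them.
  obtain ⟨V, hV, hCV, hVG⟩ := mem_nhdsSet_iff_exists.1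
    ((eventually_all.2 hGG₀).and (hW.mem_nhdsSet.2 hCW))
  obtain ⟨r, hr, hball⟩ := exists_radius (Q := IsEmbeddingOfBalls Z G)
    (fun d r s hs h => IsEmbeddingOfBalls.mono h hs)
    fun d => exists_isEmbeddingOfBalls (v := v) (G := G) fun j => hG j d
  obtain ⟨μ, hμ0, hμ1, -⟩ := exists_continuous_zero_one_of_isClosed hC hV.isClosed_compl
    (disjoint_compl_right_iff_subset.2 hCV)
  -- Shrinking by `s` maps into the ball of radius `1/s`; the parameter `μ / r` equals `1/r` off `V`
  -- and `0` on `C`.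
  have hnorm : ∀ d ∉ V, ∀ j (w : Quadrant n (Z j).index), ‖(shrink (μ d / r) w).1‖ < r :=
    fun d hd j w => norm_shrink_lt hr (by rw [hμ1 hd]; simp [hr.ne']) w
  have hGV : ∀ j, ∀ d (hd : d ∈ V), G j d = fun w => (g ⟨d, (hVG hd).2⟩).1.1 ⟨j, w⟩ :=
    fun j d hd => ((hVG hd).1 j).trans (extendedFamily_of_mem g _ j (hVG hd).2)
  have hfam : ∀ d j (w : Quadrant n (Z j).index),
      SmoothMapFamilyAt (G j) (d, shrink (μ d / r) w) := by
    intro d j w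
    by_cases hd : d ∈ V
    · refine (smoothMapFamilyAt_extendedFamily hW g.continuous
        (fun d => (frameAt (v d) j).proj) j (hVG hd).2 _).congr ?_
      filter_upwards [(continuous_fst.tendsto (d, shrink (μ d / r) w)).eventually (hV.mem_nhds hd)]
        with p hp
      exact congrFun ((hVG hp).1 j) p.2
    · exact (hball d).family j _ (hnorm d hd j w)
  have hdiffeo : ∀ d j (w : Quadrant n (Z j).index), IsLocalDiffeomorphAt
      (quadrantModel n (Z j).index) (cornerModel n) ∞ (G j d) (shrink (μ d / r) w) := by
    intro d j w
    by_cases hd : d ∈ V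
    · rw [hGV j d hd]
      exact (g ⟨d, (hVG hd).2⟩).2.2.1 j _
    · exact (hball d).diffeo j _ (hnorm d hd j w)
  have hcarrier : ∀ d j, ∀ w ∈ deepestStratum n (Z j).index,
      G j d (shrink (μ d / r) w) ∈ (Z j).carrier := by
    intro d j w hw
    by_cases hd : d ∈ V
    · rw [hGV j d hd]
      exact (g ⟨d, (hVG hd).2⟩).2.2.2 j _ (shrink_mem_deepestStratum _ hw)
    · exact (hball d).carrier j _ (hnorm d hd j w) (shrink_mem_deepestStratum _ hw)
  have hinj : ∀ d i j (w : Quadrant n (Z i).index) (w' : Quadrant n (Z j).index),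
      G i d (shrink (μ d / r) w) = G j d (shrink (μ d / r) w') →
      (⟨i, shrink (μ d / r) w⟩ : Quadrants n fun j => (Z j).index) = ⟨j, shrink (μ d / r) w'⟩ := by
    intro d i j w w' h
    by_cases hd : d ∈ V
    · rw [hGV i d hd, hGV j d hd] at h
      exact (g ⟨d, (hVG hd).2⟩).2.1.injective h
    · exact (hball d).inj i j _ _ (hnorm d hd i w) (hnorm d hd j w') h
  set u : D → StratEmb n Z := fun d =>
    StratEmb.ofShrink (hdiffeo d) (hcarrier d) (hinj d)
  have hu : Continuous u := by
    refine continuous_induced_rng.2 (continuous_iff_continuousAt.2 fun d =>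
      continuousAt_of_smoothMapFamilyAt fun j w => ?_)
    exact (hfam d j w).comp_shrink (s := fun d => μ d / r) (by fun_prop)
  refine ⟨⟨u, hu⟩, fun d => ext_frameAt fun j => ?_, fun d hd => ?_⟩
  · have h0 := hdiffeo d j 0
    rw [shrink_apply_zero] at h0
    exact (originJet_comp_shrink (h0.mdifferentiableAt (by simp)) _).trans
      (hG j d).jet.self_of_nhds
  · refine Subtype.ext (Subtype.ext (funext ?_))
    rintro ⟨j, w⟩
    change G j d (shrink (μ d / r) w) = _
    rw [hμ0 hd, Pi.zero_apply, zero_div, shrink_zero, hGV j d (hCV hd)]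

end Lifting

end

theorem mainTheorem10 (n : ℕ) (X : Type*) [TopologicalSpace X] [T2Space X]
    [SecondCountableTopology X] [ChartedSpace (EuclideanQuadrant n) X]
    [IsManifold (modelWithCornersEuclideanQuadrant n) ∞ X]
    (ι : Type*) [Finite ι] (Z : ι → Stratum n X) :
    IsWeakHomotopyEquiv (derivAtOrigins Z) :=
  (hasRelativeLifts_derivAtOrigins Z).isWeakHomotopyEquiv (continuous_derivAtOrigins Z)
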